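/- **Theorem 6 (Third order dilation of Lindbladians).** Consider a chain of $N\ge 1$ qubits and a nearest-neighbour Lindbladian $$\mathcal L(\rho)=-i[H_S,\rho]+\sum_{i=1}^{N-1}\Big(J_{i,i+1}\,\rho\, J_{i,i+1}^\dagger-\tfrac12\{J_{i,i+1}^\dagger J_{i,i+1},\rho\}\Big),\qquad H_S=\sum_{i=1}^{N-1}H_{i,i+1},$$ where $H_{i,i+1}=H_{i,i+1}^\dagger$ and $J_{i,i+1}$ act on the qubits $i,i+1$ only and $\|H_{i,i+1}\|,\|J_{i,i+1}\|\le\Lambda$ (operator norm). Suppose that $[J_{i,i+1},J_{j,j+1}]=0$ and $[J_{i,i+1},J_{j,j+1}^\dagger]=0$ for all $i\ne j$. Attach to every bond $(i,i+1)$ one ancilla with five levels $|0\rangle,\dots,|4\rangle$. Then there are absolute constants $K,R\in\mathbb N$ and a constant $C$ depending only on $\Lambda$ (in particular neither depends on $N$, on the $H_{i,i+1}$ or on the $J_{i,i+1}$), and there are Hermitian system operators $h_i(\eta)$, $\eta$-independent system operators $S_{i,k}$, and operators $O_{i,k}(\eta)$ on the $i$-th ancilla ($1\le i\le N-1$, $1\le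 k\le K$, $\eta>0$), such that the following holds for the dilated Hamiltonian $$H_{\rm dia}(\eta)=H_0(\eta)+\sum_{i=1}^{N-1}\Big(\sum_{k=1}^K S_{i,k}^\dagger\otimes O_{i,k}(\eta)+\text{h.c.}\Big),\qquad H_0(\eta)=\sum_{i=1}^{N-1}h_i(\eta).$$ 1. (Geometric locality.) For $0<\eta\le1$ the operators $h_i(\eta)$ and $S_{i,k}$ are supported on the qubits at distance at most $R$ from $\{i,i+1\}$, and $\|h_i(\eta)-H_{i,i+1}\|\le C\eta^2$, $\|S_{i,k}\|\le C$. 2. $\|O_{i,k}(\eta)\|\le C\eta^{-1}$ for $0<\eta\le1$. 3. Let $\mathcal E_{\rm dia}(\Delta t)(\rho)=\mathrm{Tr}_E\big(e^{-iH_{\rm dia}(\sqrt{\Delta t})\Delta t}\,(\rho\otimes|{\rm Vac}\rangle\langle{\rm Vac}|)\,e^{iH_{\rm dia}(\sqrt{\Delta t})\Delta t}\big)$, where $|{\rm Vac}\rangle$ is the state with all ancillas in $|0\rangle$ and $\mathrm{Tr}_E$ is the trace over the ancillas. Then, for fixed $N$, $H_{i,i+1}$ and $J_{i,i+1}$, as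 $\Delta t\to0^+$, $$e^{\mathcal L\Delta t}-\mathcal E_{\rm dia}(\Delta t)=O(\Delta t^4).$$ 4. There is a superoperator $\mathcal G^{(4)}$ such that, for fixed $N$, $H_{i,i+1}$ and $J_{i,i+1}$, as $\Delta t\to0^+$, $e^{\mathcal L\Delta t}-\mathcal E_{\rm dia}(\Delta t)=\mathcal G^{(4)}\Delta t^4+O(\Delta t^5)$, and its diamond norm satisfies $\|\mathcal G^{(4)}\|_\diamond\le C N$. Here $\|\Phi\|_\diamond=\sup_{k}\sup_{\|X\|_{\rm tr}=1}\|(\Phi\otimes\mathrm{id}_k)(X)\|_{\rm tr}$ with $\|X\|_{\rm tr}=\mathrm{Tr}\sqrt{X^\dagger X}$. -/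

import Mathlib

open scoped Matrix Kronecker Matrix.Norms.L2Operator Topology ENNReal

noncomputable section

namespace LindbladDilation

/-! ### The chain, its ancillas, and locality

The chain has `n + 1` qubits and `n` bonds; bond `i : Fin n` joins the sites `i` and `i + 1`.
Each bond carries one ancilla with the five levels `0, 1, 2, 3, 4`.
The norm of a matrix is its operator norm on the Euclidean space. -/

/-- Basis configurations of the `n + 1` system qubits. -/
abbrev Sys (n : ℕ) : Type := Fin (n + 1) → Fin 2

/-- Basis configurations of the `n` five-level ancillas. -/
abbrev Anc (n : ℕ) : Type := Fin n → Fin 5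

/-- Operators on the system. -/
abbrev SysOp (n : ℕ) : Type := Matrix (Sys n) (Sys n) ℂ

/-- Operators on system and ancillas. -/
abbrev JointOp (n : ℕ) : Type := Matrix (Sys n × Anc n) (Sys n × Anc n) ℂ

/-- Superoperators: (continuous) linear maps on the space of matrices. -/
abbrev SuperOp (ι : Type) [Fintype ι] [DecidableEq ι] : Type :=
  Matrix ι ι ℂ →L[ℂ] Matrix ι ι ℂ

/-- The sites at distance at most `R` from the bond `{i, i + 1}`. -/
def bondNhd {n : ℕ} (R : ℕ) (i : Fin n) : Set (Fin (n + 1)) :=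
  {k | (i : ℕ) ≤ (k : ℕ) + R ∧ (k : ℕ) ≤ (i : ℕ) + 1 + R}

/-- `A = B ⊗ 1` with `B` acting on the qubits in `X` and the identity on all other qubits. -/
def SupportedOn {n : ℕ} (X : Set (Fin (n + 1))) (A : SysOp n) : Prop :=
  ∃ B : Matrix (X → Fin 2) (X → Fin 2) ℂ, ∀ s t : Sys n,
    ((∀ k, k ∉ X → s k = t k) → A s t = B (fun k => s k) (fun k => t k)) ∧
    (¬ (∀ k, k ∉ X → s k = t k) → A s t = 0)

/-- The operator that acts as `o` on the ancilla of bond `i` and as the identity on the others. -/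
def ancOp {n : ℕ} (i : Fin n) (o : Matrix (Fin 5) (Fin 5) ℂ) : Matrix (Anc n) (Anc n) ℂ :=
  Matrix.of fun a b => if ∀ j, j ≠ i → a j = b j then o (a i) (b i) else 0

/-! ### The Lindbladian -/

/-- `ρ ↦ J ρ J† - (J† J ρ + ρ J† J) / 2`. -/
def dissipator {ι : Type} [Fintype ι] [DecidableEq ι] (J : Matrix ι ι ℂ) : SuperOp ι :=
  LinearMap.toContinuousLinearMap
    (LinearMap.mulLeftRight ℂ (J, Jᴴ)
      - (1 / 2 : ℂ) • (LinearMap.mulLeft ℂ (Jᴴ * J) + LinearMap.mulRight ℂ (Jᴴ * J)))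

/-- `ρ ↦ -i [H, ρ]`. -/
def hamiltonianPart {ι : Type} [Fintype ι] [DecidableEq ι] (H : Matrix ι ι ℂ) : SuperOp ι :=
  LinearMap.toContinuousLinearMap
    (-Complex.I • (LinearMap.mulLeft ℂ H - LinearMap.mulRight ℂ H))

/-- The Lindbladian with Hamiltonian `∑ i, H i` and jump operators `J i`. -/
def lindbladian {n : ℕ} (H J : Fin n → SysOp n) : SuperOp (Sys n) :=
  hamiltonianPart (∑ i, H i) + ∑ i, dissipator (J i)

/-! ### The dilation -/

/-- The operators from which a dilated Hamiltonian is built: `H₀(η) = ∑ i, h i η`, and the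
interaction of bond `i` with its own ancilla is `∑ k, (S i k)† ⊗ O i k η + h.c.`. -/
structure DilationData (n K : ℕ) where
  /-- local terms of the system Hamiltonian `H₀(η)` -/
  h : Fin n → ℝ → SysOp n
  /-- system factors of the interaction -/
  S : Fin n → Fin K → SysOp n
  /-- ancilla factors of the interaction -/
  O : Fin n → Fin K → ℝ → Matrix (Fin 5) (Fin 5) ℂ

/-- `∑ k, (S i k)† ⊗ O i k η`. -/
def DilationData.coupling {n K : ℕ} (D : DilationData n K) (η : ℝ) (i : Fin n) : JointOp n :=
  ∑ k, (D.S i k)ᴴ ⊗ₖ ancOp i (D.O i k η)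

/-- `H_dia(η) = H₀(η) + ∑ i, (∑ k, (S i k)† ⊗ O i k η + h.c.)`. -/
def DilationData.hamiltonian {n K : ℕ} (D : DilationData n K) (η : ℝ) : JointOp n :=
  (∑ i, D.h i η) ⊗ₖ (1 : Matrix (Anc n) (Anc n) ℂ)
    + ∑ i, (D.coupling η i + (D.coupling η i)ᴴ)

/-- The state of the ancillas in which each of them is in level `0`. -/
def vac (n : ℕ) : Matrix (Anc n) (Anc n) ℂ :=
  Matrix.single (fun _ => 0) (fun _ => 0) 1

/-- `ρ ↦ ρ ⊗ |Vac⟩⟨Vac|`. -/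
def adjoinVac (n : ℕ) : SysOp n →ₗ[ℂ] JointOp n where
  toFun ρ := ρ ⊗ₖ vac n
  map_add' ρ σ := Matrix.add_kronecker ρ σ (vac n)
  map_smul' c ρ := Matrix.smul_kronecker c ρ (vac n)

/-- The partial trace over the ancillas. -/
def traceAnc (n : ℕ) : JointOp n →ₗ[ℂ] SysOp n where
  toFun M := Matrix.of fun s t => ∑ a, M (s, a) (t, a)
  map_add' M M' := by
    ext s t
    simp [Finset.sum_add_distrib]
  map_smul' c M := by
    ext s t
    simp [Finset.mul_sum]

/-- `ρ ↦ Tr_E (exp (-i τ H) (ρ ⊗ |Vac⟩⟨Vac|) exp (i τ H))`. -/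
def reducedEvolution {n : ℕ} (H : JointOp n) (τ : ℝ) : SuperOp (Sys n) :=
  LinearMap.toContinuousLinearMap
    (traceAnc n ∘ₗ
      LinearMap.mulLeftRight ℂ (NormedSpace.exp (-(Complex.I * (τ : ℂ)) • H),
        NormedSpace.exp ((Complex.I * (τ : ℂ)) • H)) ∘ₗ
      adjoinVac n)

/-- The channel of one time step `τ` of the dilated evolution, with `η = √τ`. -/
def DilationData.channel {n K : ℕ} (D : DilationData n K) (τ : ℝ) : SuperOp (Sys n) :=
  reducedEvolution (D.hamiltonian (Real.sqrt τ)) τ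

/-- The dilation error `exp (τ L) - E_dia(τ)`. -/
def dilationError {n K : ℕ} (H J : Fin n → SysOp n) (D : DilationData n K) (τ : ℝ) :
    SuperOp (Sys n) :=
  NormedSpace.exp ((τ : ℂ) • lindbladian H J) - D.channel τ

/-! ### The diamond norm -/

/-- The trace norm `Tr √(X† X)`, i.e. the sum of the singular values of `X`. -/
def traceNorm {ι : Type} [Fintype ι] [DecidableEq ι] (X : Matrix ι ι ℂ) : ℝ :=
  ∑ a, Real.sqrt ((Matrix.isHermitian_conjTranspose_mul_self X).eigenvalues a)

/-- `(Φ ⊗ id_k) X`. -/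
def ampliate {ι : Type} [Fintype ι] [DecidableEq ι] (Φ : SuperOp ι) (k : ℕ)
    (X : Matrix (ι × Fin k) (ι × Fin k) ℂ) : Matrix (ι × Fin k) (ι × Fin k) ℂ :=
  Matrix.of fun p q => Φ (Matrix.of fun s t => X (s, p.2) (t, q.2)) p.1 q.1

/-- The diamond norm: the supremum of `‖(Φ ⊗ id_k) X‖_tr` over all `k` and all `X` with
`‖X‖_tr = 1`, with values in `[0, ∞]`. -/
def diamondNorm {ι : Type} [Fintype ι] [DecidableEq ι] (Φ : SuperOp ι) : ℝ≥0∞ :=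
  ⨆ (k : ℕ) (X : Matrix (ι × Fin k) (ι × Fin k) ℂ) (_ : traceNorm X = 1),
    ENNReal.ofReal (traceNorm (ampliate Φ k X))

end LindbladDilation

end

/-!
The dilated evolution over the time `τ = x ^ 2` is `exp (∑ m, x ^ m G m)`, with `G = genCoeff` the
coefficients of `-i x² H_dia(x)`. The leading term `G 1 = emit J - absorb J` excites the ancilla of
bond `i` while `J i` acts on the system, and `G 2 = -i H`. The terms `G 3, …, G 6` are corrections
of the emission amplitudes (odd orders) and of the Hamiltonian (even orders), together with a weak
transition of the ancillas from level `0` to level `4`. They are chosen such that the reduced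
evolution agrees with `exp (x² L)` up to the order `x ^ 6`.

**Matching.** The lower four levels of an ancilla are those of a truncated oscillator. Up to the
order `x ^ 6` ket and bra together hold at most six excitations, and it suffices to know the state
of one of them for at most three; the truncation is not visible there (`lw_cr_cr_cr_vac`). The
amplitudes of `exp (∑ m, x ^ m G m) |Vac⟩` with up to two excitations are computed order by order,
and they turn out to be the time averages of products of `A = -i H - ∑ i, J i† J i / 2` and of the
jumps (`JumpsCommute.amp1_expVec_five`, `JumpsCommute.amp2_expVec_four`,
`JumpsCommute.amp0_expVec_six`). Averaging amplitudes is not the same as averaging their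
sandwiches with the state; at the order `x ^ 6` the difference is `[A, J i] ρ [A, J i]† / 12`,
and it is made up for by level `4` (`JumpsCommute.pairing_three_three`). This gives
`JumpsCommute.reducedCoeff_eq`. The odd orders vanish, because the parity of the number of
excitations in ket and bra differs (`reducedCoeff_of_odd`). Thus the error is
`x ^ 8 errorCoeff + O(x ^ 10)`, that is `τ ^ 4 errorCoeff + O(τ ^ 5)`.

**Locality.** The corrections contain commutators of `J i` with the global operator
`N = ∑ j, J j† J j`. Since the jump operators and their adjoints commute for different bonds, only
bond `i` contributes to them (`JumpsCommute.selfComm_mul`).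

**The diamond norm of the leading error.** Consider `errorCoeff` as a function of the set `S` of
those bonds that are kept in `H` and `J`. It is a polynomial of degree at most `40` in the
indicators of the bonds (`hasDegree_errorCoeff`), and it is additive over sets of bonds without
common sites, because the exact and the dilated evolution both factorize and an error of order
`x ^ 8` of one factor meets the other one at order `1` (`Confined.errorCoeff_add`). Its expansion
`f S = ∑ T ⊆ S, φ T` therefore contains only intervals `T` of at most `40` bonds, whose number is
linear in `n` and whose coefficients are bounded uniformly (`diamondLE_of_additive`).
-/

noncomputable section

namespace LindbladDilation

/-! ### Trace norm and diamond norm -/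

section TraceNorm

open scoped ComplexOrder

variable {ι : Type} [Fintype ι] [DecidableEq ι]

lemma norm_one_matrix_le : ‖(1 : Matrix ι ι ℂ)‖ ≤ 1 := by
  rw [← Matrix.diagonal_one, Matrix.l2_opNorm_diagonal]
  exact (pi_norm_le_iff_of_nonneg zero_le_one).2 (by simp)

/-- Duality of the operator norm and the trace norm: the trace is expanded in an eigenbasis of
`Zᴴ * Z`, whose images under `Z` have the singular values of `Z` as norms. -/
lemma norm_trace_mul_le (U Z : Matrix ι ι ℂ) : ‖(U * Z).trace‖ ≤ ‖U‖ * traceNorm Z := by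
  set hZ := Matrix.isHermitian_conjTranspose_mul_self Z
  set V : Matrix ι ι ℂ := (hZ.eigenvectorUnitary : Matrix ι ι ℂ) with hV
  have hVmem : V ∈ Matrix.unitaryGroup ι ℂ := hZ.eigenvectorUnitary.2
  have hV1 : V * Vᴴ = 1 := Matrix.mem_unitaryGroup_iff.1 hVmem
  have hspec : (Z * V)ᴴ * (Z * V) = Matrix.diagonal (RCLike.ofReal ∘ hZ.eigenvalues) := by
    have h := hZ.conjStarAlgAut_star_eigenvectorUnitary
    simp only [Unitary.conjStarAlgAut_apply, star_star, Unitary.coe_star] at h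
    rw [← h, Matrix.conjTranspose_mul]
    simp only [Matrix.mul_assoc, Matrix.star_eq_conjTranspose, hV]
  have htr : (U * Z).trace = ∑ a, ((Vᴴ * U) * (Z * V)) a a := by
    change _ = Matrix.trace _
    rw [show Vᴴ * U * (Z * V) = Vᴴ * (U * (Z * V)) from Matrix.mul_assoc _ _ _,
      Matrix.trace_mul_comm Vᴴ, Matrix.mul_assoc, Matrix.mul_assoc, hV1, Matrix.mul_one]
  have hVn : ‖Vᴴ * U‖ ≤ ‖U‖ := by
    have : ‖Vᴴ‖ ≤ 1 := by
      have h := CStarRing.norm_self_mul_star (x := Vᴴ)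
      rw [Matrix.star_eq_conjTranspose, Matrix.conjTranspose_conjTranspose,
        show Vᴴ * V = 1 from Matrix.mem_unitaryGroup_iff'.1 hVmem] at h
      nlinarith [norm_nonneg Vᴴ, norm_one_matrix_le (ι := ι)]
    calc ‖Vᴴ * U‖ ≤ ‖Vᴴ‖ * ‖U‖ := norm_mul_le _ _
      _ ≤ 1 * ‖U‖ := by gcongr
      _ = ‖U‖ := one_mul _
  rw [htr, traceNorm, Finset.mul_sum]
  refine (norm_sum_le _ _).trans (Finset.sum_le_sum fun a _ => ?_)
  set y : EuclideanSpace ℂ ι := WithLp.toLp 2 (fun b => (Z * V) b a)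
  have hy : ‖y‖ = Real.sqrt (hZ.eigenvalues a) := by
    rw [EuclideanSpace.norm_eq]
    congr 1
    have h := congrFun (congrFun hspec a) a
    rw [Matrix.mul_apply, Matrix.diagonal_apply_eq] at h
    have h2 : ((∑ b, ‖y b‖ ^ 2 : ℝ) : ℂ) = (hZ.eigenvalues a : ℂ) := by
      rw [show (hZ.eigenvalues a : ℂ) = (RCLike.ofReal ∘ hZ.eigenvalues) a from rfl, ← h]
      push_cast
      refine Finset.sum_congr rfl fun b _ => ?_
      exact (RCLike.conj_mul ((Z * V) b a)).symm
    exact_mod_cast h2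
  have h1 : ((Vᴴ * U) * (Z * V)) a a
      = (WithLp.toLp 2 ((Vᴴ * U) *ᵥ y.ofLp) : EuclideanSpace ℂ ι) a := by
    simp [Matrix.mul_apply, Matrix.mulVec, dotProduct, y]
  rw [h1, ← hy]
  calc _ ≤ ‖(WithLp.toLp 2 ((Vᴴ * U) *ᵥ y.ofLp) : EuclideanSpace ℂ ι)‖ := PiLp.norm_apply_le _ a
    _ ≤ ‖Vᴴ * U‖ * ‖y‖ := Matrix.l2_opNorm_mulVec _ _
    _ ≤ ‖U‖ * ‖y‖ := by gcongr

/-- The trace norm is attained in the duality with the operator norm, at the adjoint of the partial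
isometry of the polar decomposition of `Z`. -/
lemma exists_norm_le_one_trace_mul_eq (Z : Matrix ι ι ℂ) :
    ∃ U : Matrix ι ι ℂ, ‖U‖ ≤ 1 ∧ (U * Z).trace = (traceNorm Z : ℂ) := by
  set hZ := Matrix.isHermitian_conjTranspose_mul_self Z
  set V : Matrix ι ι ℂ := (hZ.eigenvectorUnitary : Matrix ι ι ℂ) with hV
  have hVmem : V ∈ Matrix.unitaryGroup ι ℂ := hZ.eigenvectorUnitary.2
  have hV1 : V * Vᴴ = 1 := Matrix.mem_unitaryGroup_iff.1 hVmem
  have hspec : (Z * V)ᴴ * (Z * V) = Matrix.diagonal (RCLike.ofReal ∘ hZ.eigenvalues) := by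
    have h := hZ.conjStarAlgAut_star_eigenvectorUnitary
    simp only [Unitary.conjStarAlgAut_apply, star_star, Unitary.coe_star] at h
    rw [← h, Matrix.conjTranspose_mul]
    simp only [Matrix.mul_assoc, Matrix.star_eq_conjTranspose, hV]
  have hnn : ∀ a, 0 ≤ hZ.eigenvalues a :=
    (Matrix.posSemidef_conjTranspose_mul_self Z).eigenvalues_nonneg
  -- On the kernel of `Z` the convention `0⁻¹ = 0` gives the partial isometry.
  set d : ι → ℂ := fun a => ((Real.sqrt (hZ.eigenvalues a))⁻¹ : ℝ)
  have hd : (Matrix.diagonal d)ᴴ = Matrix.diagonal d := by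
    rw [Matrix.diagonal_conjTranspose]
    congr 1
    ext a
    simp [d]
  refine ⟨V * (Matrix.diagonal d * (Z * V)ᴴ), ?_, ?_⟩
  · have hVn : ‖V‖ ≤ 1 := by
      have h := CStarRing.norm_self_mul_star (x := V)
      rw [Matrix.star_eq_conjTranspose, hV1] at h
      nlinarith [norm_nonneg V, norm_one_matrix_le (ι := ι)]
    have hW : ‖Matrix.diagonal d * (Z * V)ᴴ‖ ≤ 1 := by
      have h := CStarRing.norm_self_mul_star (x := Matrix.diagonal d * (Z * V)ᴴ)
      rw [Matrix.star_eq_conjTranspose, Matrix.conjTranspose_mul _ (Z * V)ᴴ, hd,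
        Matrix.conjTranspose_conjTranspose, Matrix.mul_assoc,
        ← Matrix.mul_assoc _ _ (Matrix.diagonal d),
        hspec, Matrix.diagonal_mul_diagonal, Matrix.diagonal_mul_diagonal,
        Matrix.l2_opNorm_diagonal] at h
      have h2 : ‖fun i => d i * ((RCLike.ofReal ∘ hZ.eigenvalues) i * d i)‖ ≤ 1 := by
        refine (pi_norm_le_iff_of_nonneg zero_le_one).2 fun a => ?_
        have : d a * ((RCLike.ofReal ∘ hZ.eigenvalues) a * d a)
            = (((Real.sqrt (hZ.eigenvalues a))⁻¹ * (hZ.eigenvalues a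
              * (Real.sqrt (hZ.eigenvalues a))⁻¹) : ℝ) : ℂ) := by
          simp [d]
        rw [this, Complex.norm_real]
        by_cases h0 : hZ.eigenvalues a = 0
        · simp [h0]
        · have hp : 0 < Real.sqrt (hZ.eigenvalues a) :=
            Real.sqrt_pos.2 (lt_of_le_of_ne (hnn a) (Ne.symm h0))
          have : (Real.sqrt (hZ.eigenvalues a))⁻¹ * (hZ.eigenvalues a
              * (Real.sqrt (hZ.eigenvalues a))⁻¹) = 1 := by
            nth_rewrite 2 [← Real.mul_self_sqrt (hnn a)]
            field_simp
          simp [this]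
      rw [h] at h2
      nlinarith [norm_nonneg (Matrix.diagonal d * (Z * V)ᴴ)]
    calc _ ≤ ‖V‖ * ‖Matrix.diagonal d * (Z * V)ᴴ‖ := norm_mul_le _ _
      _ ≤ 1 * 1 := by gcongr
      _ = 1 := one_mul _
  · rw [Matrix.mul_assoc, Matrix.trace_mul_comm, Matrix.mul_assoc, Matrix.mul_assoc,
      hspec, Matrix.diagonal_mul_diagonal, Matrix.trace_diagonal, traceNorm]
    push_cast
    refine Finset.sum_congr rfl fun a _ => ?_
    have : (Real.sqrt (hZ.eigenvalues a))⁻¹ * hZ.eigenvalues a = Real.sqrt (hZ.eigenvalues a) := by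
      by_cases h0 : hZ.eigenvalues a = 0
      · simp [h0]
      · have hp : 0 < Real.sqrt (hZ.eigenvalues a) :=
          Real.sqrt_pos.2 (lt_of_le_of_ne (hnn a) (Ne.symm h0))
        nth_rewrite 2 [← Real.mul_self_sqrt (hnn a)]
        field_simp
    rw [← this]
    simp [d]

lemma traceNorm_nonneg (Z : Matrix ι ι ℂ) : 0 ≤ traceNorm Z :=
  Finset.sum_nonneg fun _ _ => Real.sqrt_nonneg _

lemma traceNorm_le_of_forall {Z : Matrix ι ι ℂ} {c : ℝ}
    (h : ∀ U : Matrix ι ι ℂ, ‖U‖ ≤ 1 → ‖(U * Z).trace‖ ≤ c) : traceNorm Z ≤ c := by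
  obtain ⟨U, hU, hUZ⟩ := exists_norm_le_one_trace_mul_eq Z
  have := h U hU
  rwa [hUZ, Complex.norm_real, Real.norm_of_nonneg (traceNorm_nonneg Z)] at this

lemma traceNorm_add_le (Y Z : Matrix ι ι ℂ) : traceNorm (Y + Z) ≤ traceNorm Y + traceNorm Z := by
  refine traceNorm_le_of_forall fun U hU => ?_
  rw [Matrix.mul_add, Matrix.trace_add]
  refine (norm_add_le _ _).trans (add_le_add ?_ ?_)
  · exact (norm_trace_mul_le U Y).trans (mul_le_of_le_one_left (traceNorm_nonneg _) hU)
  · exact (norm_trace_mul_le U Z).trans (mul_le_of_le_one_left (traceNorm_nonneg _) hU)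

lemma traceNorm_smul_le (c : ℂ) (Z : Matrix ι ι ℂ) : traceNorm (c • Z) ≤ ‖c‖ * traceNorm Z := by
  refine traceNorm_le_of_forall fun U hU => ?_
  rw [Matrix.mul_smul, Matrix.trace_smul, smul_eq_mul, norm_mul]
  gcongr
  exact (norm_trace_mul_le U Z).trans (mul_le_of_le_one_left (traceNorm_nonneg _) hU)

@[simp] lemma traceNorm_zero : traceNorm (0 : Matrix ι ι ℂ) = 0 :=
  le_antisymm (traceNorm_le_of_forall fun U _ => by simp) (traceNorm_nonneg _)

/-- `c` bounds the diamond norm of `Φ`. As `X` is not normalized, this is a finite homogeneous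
estimate, and `diamondNorm` with its values in `[0, ∞]` is avoided. -/
def DiamondLE (Φ : SuperOp ι) (c : ℝ) : Prop :=
  ∀ (k : ℕ) (X : Matrix (ι × Fin k) (ι × Fin k) ℂ),
    traceNorm (ampliate Φ k X) ≤ c * traceNorm X

lemma DiamondLE.diamondNorm_le {Φ : SuperOp ι} {c : ℝ} (h : DiamondLE Φ c) :
    diamondNorm Φ ≤ ENNReal.ofReal c := by
  refine iSup_le fun k => iSup_le fun X => iSup_le fun hX => ENNReal.ofReal_le_ofReal ?_
  simpa [hX] using h k X

lemma DiamondLE.mono {Φ : SuperOp ι} {c c' : ℝ} (h : DiamondLE Φ c) (hc : c ≤ c') :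
    DiamondLE Φ c' := fun k X =>
  (h k X).trans (mul_le_mul_of_nonneg_right hc (traceNorm_nonneg X))

lemma diamondLE_zero : DiamondLE (0 : SuperOp ι) 0 := fun k X => by
  have : ampliate (0 : SuperOp ι) k X = 0 := by ext; simp [ampliate]
  simp [this]

lemma DiamondLE.add {Φ Ψ : SuperOp ι} {c c' : ℝ} (h : DiamondLE Φ c) (h' : DiamondLE Ψ c') :
    DiamondLE (Φ + Ψ) (c + c') := fun k X => by
  have : ampliate (Φ + Ψ) k X = ampliate Φ k X + ampliate Ψ k X := by ext; simp [ampliate]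
  rw [this, add_mul]
  exact (traceNorm_add_le _ _).trans (add_le_add (h k X) (h' k X))

lemma DiamondLE.smul {Φ : SuperOp ι} {c : ℝ} (h : DiamondLE Φ c) (z : ℂ) :
    DiamondLE (z • Φ) (‖z‖ * c) := fun k X => by
  have : ampliate (z • Φ) k X = z • ampliate Φ k X := by ext; simp [ampliate]
  rw [this, mul_assoc]
  exact (traceNorm_smul_le _ _).trans (mul_le_mul_of_nonneg_left (h k X) (norm_nonneg z))

lemma DiamondLE.neg {Φ : SuperOp ι} {c : ℝ} (h : DiamondLE Φ c) : DiamondLE (-Φ) c := by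
  have := h.smul (-1)
  have e : (-1 : ℂ) • Φ = -Φ := by module
  rwa [e, norm_neg, norm_one, one_mul] at this

lemma DiamondLE.sub {Φ Ψ : SuperOp ι} {c c' : ℝ} (h : DiamondLE Φ c) (h' : DiamondLE Ψ c') :
    DiamondLE (Φ - Ψ) (c + c') := by
  rw [sub_eq_add_neg]
  exact h.add h'.neg

lemma DiamondLE.sum {α : Type*} {s : Finset α} {Φ : α → SuperOp ι} {c : α → ℝ}
    (h : ∀ a ∈ s, DiamondLE (Φ a) (c a)) : DiamondLE (∑ a ∈ s, Φ a) (∑ a ∈ s, c a) := by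
  classical
  induction s using Finset.induction_on with
  | empty => simpa using diamondLE_zero
  | insert a s ha ih =>
    rw [Finset.sum_insert ha, Finset.sum_insert ha]
    exact (h a (by simp)).add (ih fun b hb => h b (by simp [hb]))

lemma DiamondLE.mul {Φ Ψ : SuperOp ι} {c c' : ℝ} (h : DiamondLE Φ c) (h' : DiamondLE Ψ c')
    (hc : 0 ≤ c) : DiamondLE (Φ * Ψ) (c * c') := fun k X => by
  have : ampliate (Φ * Ψ) k X = ampliate Φ k (ampliate Ψ k X) := by
    ext p q
    simp only [ampliate, Matrix.of_apply, mul_apply_eq_comp]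
    rfl
  rw [this, mul_assoc]
  exact (h k _).trans (mul_le_mul_of_nonneg_left (h' k X) hc)

end TraceNorm


/-! ### Taylor coefficients in the step size -/

section Coefficients

variable {A : Type*} [Ring A]

/-- The coefficient of `x ^ p` in `(∑ m, x ^ m G m) ^ k`. -/
def powCoeff (G : ℕ → A) : ℕ → ℕ → A
  | 0, p => if p = 0 then 1 else 0
  | k + 1, p => ∑ m ∈ Finset.range (p + 1), G m * powCoeff G k (p - m)

lemma powCoeff_eq_zero {G : ℕ → A} (h0 : G 0 = 0) :
    ∀ {k p : ℕ}, p < k → powCoeff G k p = 0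
  | 0, _, h => absurd h (Nat.not_lt_zero _)
  | k + 1, p, h => by
    rw [powCoeff]
    refine Finset.sum_eq_zero fun m hm => ?_
    rw [Finset.mem_range] at hm
    rcases Nat.eq_zero_or_pos m with rfl | hpos
    · rw [h0, zero_mul]
    · rw [powCoeff_eq_zero h0 (by omega), mul_zero]

lemma powCoeff_single_two (L : A) :
    ∀ k p : ℕ, powCoeff (Pi.single 2 L : ℕ → A) k p = if p = 2 * k then L ^ k else 0
  | 0, p => by simp [powCoeff]
  | k + 1, p => by
    rw [powCoeff]
    simp only [powCoeff_single_two L k]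
    by_cases hp : p = 2 * (k + 1)
    · rw [if_pos hp, Finset.sum_eq_single 2]
      · rw [Pi.single_eq_same, if_pos (by omega), pow_succ']
      · intro m _ hm
        rw [Pi.single_eq_of_ne hm, zero_mul]
      · intro h
        exact absurd (Finset.mem_range.2 (by omega)) h
    · rw [if_neg hp]
      refine Finset.sum_eq_zero fun m hm => ?_
      rw [Finset.mem_range] at hm
      by_cases h2 : m = 2
      · rw [if_neg (by omega), mul_zero]
      · rw [Pi.single_eq_of_ne h2, zero_mul]

variable [Algebra ℂ A]

/-- The coefficient of `x ^ p` in `exp (∑ m, x ^ m G m)` when `G 0 = 0`. -/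
def expCoeff (G : ℕ → A) (p : ℕ) : A :=
  ∑ k ∈ Finset.range (p + 1), ((k.factorial : ℂ)⁻¹) • powCoeff G k p

lemma expCoeff_single_two (L : A) (m : ℕ) :
    expCoeff (Pi.single 2 L : ℕ → A) (2 * m) = ((m.factorial : ℂ)⁻¹) • L ^ m := by
  rw [expCoeff, Finset.sum_eq_single m]
  · rw [powCoeff_single_two, if_pos rfl]
  · intro k _ hk
    rw [powCoeff_single_two, if_neg (by omega), smul_zero]
  · intro h
    exact absurd (Finset.mem_range.2 (by omega)) h

lemma expCoeff_single_two_of_odd (L : A) {p : ℕ} (hp : Odd p) :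
    expCoeff (Pi.single 2 L : ℕ → A) p = 0 := by
  refine Finset.sum_eq_zero fun k _ => ?_
  rw [powCoeff_single_two, if_neg, smul_zero]
  rintro rfl
  exact (Nat.not_odd_iff_even.2 (even_two_mul k)) hp

end Coefficients

section Jets

open Asymptotics

variable {E F H : Type*} [NormedAddCommGroup E] [NormedSpace ℂ E] [NormedAddCommGroup F]
  [NormedSpace ℂ F] [NormedAddCommGroup H] [NormedSpace ℂ H]

/-- `f x = ∑ p < 10, x ^ p a p + O(x ^ 10)` as `x → 0+`. With `x = √τ`, the order `10` is that of
the remainder `O(τ ^ 5)`. -/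
def HasJet (f : ℝ → E) (a : ℕ → E) : Prop :=
  (fun x : ℝ => f x - ∑ p ∈ Finset.range 10, ((x : ℂ) ^ p) • a p)
    =O[𝓝[>] (0 : ℝ)] (fun x : ℝ => x ^ 10)

lemma isBigO_pow_of_le {m k : ℕ} (h : m ≤ k) :
    (fun x : ℝ => x ^ k) =O[𝓝[>] (0 : ℝ)] (fun x : ℝ => x ^ m) := by
  refine IsBigO.of_bound 1 ?_
  filter_upwards [Ioo_mem_nhdsGT (show (0 : ℝ) < 1 by norm_num)] with x hx
  rw [one_mul, Real.norm_of_nonneg (pow_nonneg hx.1.le _),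
    Real.norm_of_nonneg (pow_nonneg hx.1.le _)]
  exact pow_le_pow_of_le_one hx.1.le hx.2.le h

lemma isBigO_smul_pow (m : ℕ) (a : E) :
    (fun x : ℝ => ((x : ℂ) ^ m) • a) =O[𝓝[>] (0 : ℝ)] (fun x : ℝ => x ^ m) := by
  refine IsBigO.of_bound ‖a‖ (Filter.Eventually.of_forall fun x => ?_)
  rw [norm_smul, norm_pow, Complex.norm_real, norm_pow, mul_comm]

lemma HasJet.isBigO_of_eq_zero {f : ℝ → E} {a : ℕ → E} (h : HasJet f a) {m : ℕ} (hm : m ≤ 10)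
    (ha : ∀ p < m, a p = 0) : f =O[𝓝[>] (0 : ℝ)] (fun x : ℝ => x ^ m) := by
  have h1 : (fun x : ℝ => ∑ p ∈ Finset.range 10, ((x : ℂ) ^ p) • a p)
      =O[𝓝[>] (0 : ℝ)] (fun x : ℝ => x ^ m) := by
    refine IsBigO.fun_sum fun p _ => ?_
    by_cases hp : p < m
    · simp only [ha p hp, smul_zero]
      exact isBigO_zero _ _
    · exact (isBigO_smul_pow p (a p)).trans (isBigO_pow_of_le (not_lt.1 hp))
  have h2 := (IsBigO.trans h (isBigO_pow_of_le hm)).add h1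
  simpa using h2

lemma HasJet.sub {f g : ℝ → E} {a b : ℕ → E} (hf : HasJet f a) (hg : HasJet g b) :
    HasJet (fun x => f x - g x) (fun p => a p - b p) := by
  refine (IsBigO.sub hf hg).congr_left fun x => ?_
  simp only [smul_sub, Finset.sum_sub_distrib]
  abel

lemma HasJet.sum {α : Type*} {s : Finset α} {f : α → ℝ → E} {a : α → ℕ → E}
    (h : ∀ i ∈ s, HasJet (f i) (a i)) :
    HasJet (fun x => ∑ i ∈ s, f i x) (fun p => ∑ i ∈ s, a i p) := by
  refine (IsBigO.fun_sum h).congr_left fun x => ?_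
  rw [Finset.sum_sub_distrib, Finset.sum_comm]
  simp only [Finset.smul_sum]

lemma HasJet.map {f : ℝ → E} {a : ℕ → E} (h : HasJet f a) (T : E →L[ℂ] F) :
    HasJet (fun x => T (f x)) (fun p => T (a p)) := by
  refine ((T.isBigO_comp _ _).trans h).congr_left fun x => ?_
  simp

lemma HasJet.congr {f : ℝ → E} {a b : ℕ → E} (h : HasJet f a) (hab : ∀ p < 10, a p = b p) :
    HasJet f b := by
  refine IsBigO.congr_left h fun x => ?_
  congr 1
  exact Finset.sum_congr rfl fun p hp => by rw [hab p (Finset.mem_range.1 hp)]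

lemma HasJet.bilin {f : ℝ → E} {g : ℝ → F} {a : ℕ → E} {b : ℕ → F} (hf : HasJet f a)
    (hg : HasJet g b) (B : E →L[ℂ] F →L[ℂ] H) :
    HasJet (fun x => B (f x) (g x))
      (fun p => ∑ m ∈ Finset.range (p + 1), B (a m) (b (p - m))) := by
  set P : ℝ → E := fun x => ∑ p ∈ Finset.range 10, ((x : ℂ) ^ p) • a p
  set Q : ℝ → F := fun x => ∑ p ∈ Finset.range 10, ((x : ℂ) ^ p) • b p
  have hB : ∀ {u : ℝ → E} {v : ℝ → F} {k l : ℕ},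
      u =O[𝓝[>] (0 : ℝ)] (fun x : ℝ => x ^ k) → v =O[𝓝[>] (0 : ℝ)] (fun x : ℝ => x ^ l) →
      (fun x => B (u x) (v x)) =O[𝓝[>] (0 : ℝ)] (fun x : ℝ => x ^ k * x ^ l) := by
    intro u v k l hu hv
    have h1 : (fun x => B (u x) (v x)) =O[𝓝[>] (0 : ℝ)] fun x => ‖u x‖ * ‖v x‖ := by
      refine IsBigO.of_bound ‖B‖ (Filter.Eventually.of_forall fun x => ?_)
      rw [Real.norm_of_nonneg (by positivity), ← mul_assoc]
      exact B.le_opNorm₂ _ _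
    exact h1.trans (hu.norm_left.mul hv.norm_left)
  have hP : P =O[𝓝[>] (0 : ℝ)] (fun x : ℝ => x ^ 0) :=
    IsBigO.fun_sum fun p _ => (isBigO_smul_pow p (a p)).trans (isBigO_pow_of_le (Nat.zero_le p))
  have hg0 : g =O[𝓝[>] (0 : ℝ)] (fun x : ℝ => x ^ 0) :=
    hg.isBigO_of_eq_zero (Nat.zero_le _) fun p hp => absurd hp (Nat.not_lt_zero p)
  have e1 : (fun x => B (f x - P x) (g x)) =O[𝓝[>] (0 : ℝ)] (fun x : ℝ => x ^ 10) := by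
    exact (hB (k := 10) (l := 0) hf hg0).trans (by simpa using Asymptotics.isBigO_refl _ _)
  have e2 : (fun x => B (P x) (g x - Q x)) =O[𝓝[>] (0 : ℝ)] (fun x : ℝ => x ^ 10) := by
    exact (hB (k := 0) (l := 10) hP hg).trans (by simpa using Asymptotics.isBigO_refl _ _)
  have e3 : (fun x : ℝ => ∑ p ∈ Finset.range 10, ∑ q ∈ Finset.Ico (10 - p) 10,
      ((x : ℂ) ^ (p + q)) • B (a p) (b q)) =O[𝓝[>] (0 : ℝ)] (fun x : ℝ => x ^ 10) := by
    refine IsBigO.fun_sum fun p _ => IsBigO.fun_sum fun q hq => ?_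
    rw [Finset.mem_Ico] at hq
    exact (isBigO_smul_pow (p + q) _).trans (isBigO_pow_of_le (by omega))
  refine ((e1.add e2).add e3).congr_left fun x => ?_
  have hPQ : B (P x) (Q x) = (∑ p ∈ Finset.range 10, ((x : ℂ) ^ p) •
      ∑ m ∈ Finset.range (p + 1), B (a m) (b (p - m)))
      + ∑ p ∈ Finset.range 10, ∑ q ∈ Finset.Ico (10 - p) 10,
        ((x : ℂ) ^ (p + q)) • B (a p) (b q) := by
    have h1 : B (P x) (Q x) = ∑ p ∈ Finset.range 10, ∑ q ∈ Finset.range 10,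
        ((x : ℂ) ^ (p + q)) • B (a p) (b q) := by
      simp only [P, Q, map_sum, map_smul, sum_apply, smul_apply, smul_smul, pow_add,
        Finset.smul_sum]
      rw [Finset.sum_comm]
      exact Finset.sum_congr rfl fun _ _ => Finset.sum_congr rfl fun _ _ => by rw [mul_comm]
    have h2 : ∑ p ∈ Finset.range 10, ((x : ℂ) ^ p) •
        ∑ m ∈ Finset.range (p + 1), B (a m) (b (p - m))
        = ∑ p ∈ Finset.range 10, ∑ q ∈ Finset.range (10 - p),
          ((x : ℂ) ^ (p + q)) • B (a p) (b q) := by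
      rw [← Finset.sum_range_diag_flip 10 fun p q => ((x : ℂ) ^ (p + q)) • B (a p) (b q)]
      refine Finset.sum_congr rfl fun p _ => ?_
      rw [Finset.smul_sum]
      refine Finset.sum_congr rfl fun m hm => ?_
      rw [Nat.add_sub_cancel' (Nat.lt_succ_iff.1 (Finset.mem_range.1 hm))]
    rw [h1, h2, ← Finset.sum_add_distrib]
    refine Finset.sum_congr rfl fun p _ => ?_
    rw [Finset.sum_range_add_sum_Ico _ (Nat.sub_le 10 p)]
  have hexp : B (f x - P x) (g x) + B (P x) (g x - Q x) = B (f x) (g x) - B (P x) (Q x) := by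
    simp only [map_sub, sub_apply]
    abel
  rw [hexp, hPQ]
  abel

variable {A : Type*} [NormedRing A] [NormedAlgebra ℂ A]

lemma HasJet.mul {f g : ℝ → A} {a b : ℕ → A} (hf : HasJet f a) (hg : HasJet g b) :
    HasJet (fun x => f x * g x)
      (fun p => ∑ m ∈ Finset.range (p + 1), a m * b (p - m)) :=
  hf.bilin hg (ContinuousLinearMap.mul ℂ A)

lemma hasJet_one : HasJet (fun _ => (1 : A)) (fun p => if p = 0 then 1 else 0) := by
  refine (isBigO_zero _ _).congr_left fun x => ?_
  simp

lemma HasJet.pow {y : ℝ → A} {G : ℕ → A} (hy : HasJet y G) :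
    ∀ k : ℕ, HasJet (fun x => y x ^ k) (powCoeff G k)
  | 0 => by
    simp only [pow_zero]
    exact hasJet_one
  | k + 1 => by
    simp only [pow_succ']
    exact hy.mul (hy.pow k)

lemma HasJet.const_smul {f : ℝ → E} {a : ℕ → E} (h : HasJet f a) (c : ℂ) :
    HasJet (fun x => c • f x) (fun p => c • a p) :=
  h.map (c • ContinuousLinearMap.id ℂ E)

/-- The exponential series may be cut after `y x ^ 9`, since `y x = O(x)`. -/
lemma HasJet.exp [CompleteSpace A] {y : ℝ → A} {G : ℕ → A} (hy : HasJet y G) (h0 : G 0 = 0) :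
    HasJet (fun x => NormedSpace.exp (y x)) (expCoeff G) := by
  have hO : y =O[𝓝[>] (0 : ℝ)] (fun x : ℝ => x ^ 1) :=
    hy.isBigO_of_eq_zero (by norm_num) fun p hp => by rwa [Nat.lt_one_iff.1 hp]
  have hlim : Filter.Tendsto y (𝓝[>] (0 : ℝ)) (𝓝 0) := by
    refine hO.trans_tendsto ?_
    simp only [pow_one]
    exact Filter.tendsto_id.mono_left nhdsWithin_le_nhds
  have hser :=
    (NormedSpace.exp_hasFPowerSeriesAt_zero (𝕂 := ℂ) (𝔸 := A)).isBigO_sub_partialSum_pow 10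
  have h1 := (hser.comp_tendsto hlim).trans ((hO.norm_left.pow 10))
  have h2 : HasJet (fun x => ∑ k ∈ Finset.range 10, ((k.factorial : ℂ)⁻¹) • y x ^ k)
      (expCoeff G) := by
    refine (HasJet.sum fun k (_ : k ∈ Finset.range 10) =>
      (hy.pow k).const_smul ((k.factorial : ℂ)⁻¹)).congr fun p hp => ?_
    rw [expCoeff]
    symm
    refine Finset.sum_subset (fun k hk => ?_) fun k _ hk => ?_
    · rw [Finset.mem_range] at hk ⊢
      omega
    · rw [powCoeff_eq_zero h0 (by simpa using hk), smul_zero]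
  have h3 : (fun x => NormedSpace.exp (y x)
      - ∑ k ∈ Finset.range 10, ((k.factorial : ℂ)⁻¹) • y x ^ k)
      =O[𝓝[>] (0 : ℝ)] (fun x : ℝ => x ^ 10) := by
    refine (h1.congr_left fun x => ?_).trans (by simpa using isBigO_refl _ _)
    simp only [Function.comp, zero_add, FormalMultilinearSeries.partialSum,
      NormedSpace.expSeries_apply_eq]
  refine (h3.add h2).congr_left fun x => ?_
  abel

end Jets


/-! ### Functions of a set of bonds: bounded degree and clusters -/

section Degree

variable {α : Type*} [DecidableEq α] {M N P : Type*} [AddCommGroup M] [AddCommGroup N]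
  [AddCommGroup P]

/-- `f` is a sum of terms `S ↦ if T ⊆ S then c else 0` with `T.card ≤ d`, i.e. a polynomial of
degree at most `d` in the indicators of the elements of `S`. -/
def HasDegree (d : ℕ) (f : Finset α → M) : Prop :=
  f ∈ AddSubmonoid.closure
    {g : Finset α → M | ∃ (T : Finset α) (c : M), T.card ≤ d ∧ g = fun S => if T ⊆ S then c else 0}

lemma HasDegree.term {d : ℕ} {T : Finset α} (hT : T.card ≤ d) (c : M) :
    HasDegree d (fun S => if T ⊆ S then c else 0) :=
  AddSubmonoid.subset_closure ⟨T, c, hT, rfl⟩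

lemma HasDegree.mono {d d' : ℕ} (h : d ≤ d') {f : Finset α → M} (hf : HasDegree d f) :
    HasDegree d' f := by
  refine AddSubmonoid.closure_mono ?_ hf
  rintro g ⟨T, c, hT, rfl⟩
  exact ⟨T, c, hT.trans h, rfl⟩

lemma HasDegree.zero (d : ℕ) : HasDegree d (fun _ : Finset α => (0 : M)) :=
  AddSubmonoid.zero_mem _

lemma HasDegree.const (d : ℕ) (c : M) : HasDegree d (fun _ : Finset α => c) := by
  simpa using HasDegree.term (T := (∅ : Finset α)) (Nat.zero_le d) c

lemma HasDegree.indicator (i : α) (c : M) : HasDegree 1 (fun S => if i ∈ S then c else 0) := by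
  simpa using HasDegree.term (T := {i}) (d := 1) (by simp) c

lemma HasDegree.add {d : ℕ} {f g : Finset α → M} (hf : HasDegree d f) (hg : HasDegree d g) :
    HasDegree d (fun S => f S + g S) :=
  AddSubmonoid.add_mem _ hf hg

lemma HasDegree.sum {ι : Type*} {s : Finset ι} {d : ℕ} {f : ι → Finset α → M}
    (h : ∀ i ∈ s, HasDegree d (f i)) : HasDegree d (fun S => ∑ i ∈ s, f i S) := by
  have h1 := AddSubmonoid.sum_mem _ h
  have h2 : (fun S => ∑ i ∈ s, f i S) = ∑ i ∈ s, f i := by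
    ext S
    simp
  exact h2 ▸ h1

lemma HasDegree.map {d : ℕ} {f : Finset α → M} (hf : HasDegree d f) (φ : M →+ N) :
    HasDegree d (fun S => φ (f S)) := by
  induction hf using AddSubmonoid.closure_induction with
  | mem g hg =>
    obtain ⟨T, c, hT, rfl⟩ := hg
    convert HasDegree.term hT (φ c) using 2 with S
    by_cases h : T ⊆ S <;> simp [h]
  | zero => simpa using HasDegree.zero (α := α) (M := N) d
  | add g g' _ _ h h' => simpa using h.add h'

lemma HasDegree.bilin {d d' : ℕ} {f : Finset α → M} {g : Finset α → N} (hf : HasDegree d f)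
    (hg : HasDegree d' g) (B : M →+ N →+ P) : HasDegree (d + d') (fun S => B (f S) (g S)) := by
  induction hf using AddSubmonoid.closure_induction with
  | mem f hf =>
    obtain ⟨T, c, hT, rfl⟩ := hf
    induction hg using AddSubmonoid.closure_induction with
    | mem g hg =>
      obtain ⟨U, c', hU, rfl⟩ := hg
      convert HasDegree.term (T := T ∪ U) ((Finset.card_union_le T U).trans (add_le_add hT hU))
        (B c c') using 2 with S
      by_cases h1 : T ⊆ S <;> by_cases h2 : U ⊆ S <;> simp [h1, h2, Finset.union_subset_iff]
    | zero => simpa using HasDegree.zero (α := α) (M := P) _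
    | add g g' _ _ h h' => simpa using h.add h'
  | zero => simpa using HasDegree.zero (α := α) (M := P) _
  | add f f' _ _ h h' => simpa using h.add h'

lemma HasDegree.mul {R : Type*} [Ring R] {d d' : ℕ} {f g : Finset α → R} (hf : HasDegree d f)
    (hg : HasDegree d' g) : HasDegree (d + d') (fun S => f S * g S) :=
  hf.bilin hg AddMonoidHom.mul

lemma HasDegree.neg {d : ℕ} {f : Finset α → M} (hf : HasDegree d f) :
    HasDegree d (fun S => -f S) :=
  hf.map (-AddMonoidHom.id M)

lemma HasDegree.sub {d : ℕ} {f g : Finset α → M} (hf : HasDegree d f) (hg : HasDegree d g) :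
    HasDegree d (fun S => f S - g S) := by
  simpa only [sub_eq_add_neg] using hf.add hg.neg

lemma HasDegree.smul [Module ℂ M] {d : ℕ} {f : Finset α → M} (hf : HasDegree d f) (z : ℂ) :
    HasDegree d (fun S => z • f S) :=
  hf.map (DistribSMul.toAddMonoidHom M z)

lemma HasDegree.pow {R : Type*} [Ring R] {d : ℕ} {f : Finset α → R} (hf : HasDegree d f) :
    ∀ k : ℕ, HasDegree (k * d) (fun S => f S ^ k)
  | 0 => by simpa using HasDegree.const 0 1
  | k + 1 => by simpa only [pow_succ, Nat.succ_mul] using (hf.pow k).mul hf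

lemma HasDegree.powCoeff {R : Type*} [Ring R] {d : ℕ} {G : Finset α → ℕ → R}
    (h : ∀ m, HasDegree d (fun S => G S m)) :
    ∀ k p : ℕ, HasDegree (k * d) (fun S => powCoeff (G S) k p)
  | 0, p => by simpa only [LindbladDilation.powCoeff, zero_mul] using HasDegree.const 0 _
  | k + 1, p => by
    simp only [LindbladDilation.powCoeff]
    refine HasDegree.sum fun m _ => ?_
    exact ((h m).mul (HasDegree.powCoeff h k (p - m))).mono (by rw [Nat.succ_mul, add_comm])

lemma HasDegree.expCoeff {R : Type*} [Ring R] [Algebra ℂ R] {d : ℕ} {G : Finset α → ℕ → R}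
    (h : ∀ m, HasDegree d (fun S => G S m)) (p : ℕ) :
    HasDegree (p * d) (fun S => expCoeff (G S) p) := by
  refine HasDegree.sum fun k hk => ?_
  have hk' : k ≤ p := Nat.lt_succ_iff.1 (Finset.mem_range.1 hk)
  exact ((HasDegree.powCoeff h k p).mono (Nat.mul_le_mul_right d hk')).smul _

/-- The cluster coefficients `φ` of `f`, with `f S = ∑ T ⊆ S, φ T`. -/
lemma HasDegree.exists_cluster {d : ℕ} {f : Finset α → M} (hf : HasDegree d f) :
    ∃ φ : Finset α → M, (∀ S, f S = ∑ T ∈ S.powerset, φ T) ∧ ∀ T, d < T.card → φ T = 0 := by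
  induction hf using AddSubmonoid.closure_induction with
  | mem f hf =>
    obtain ⟨T, c, hT, rfl⟩ := hf
    refine ⟨Pi.single T c, fun S => ?_, fun U hU => ?_⟩
    · simp
    · refine Pi.single_eq_of_ne ?_ _
      rintro rfl
      omega
  | zero => exact ⟨0, by simp, by simp⟩
  | add f f' _ _ h h' =>
    obtain ⟨φ, h1, h2⟩ := h
    obtain ⟨φ', h1', h2'⟩ := h'
    refine ⟨φ + φ', fun S => ?_, fun T hT => ?_⟩
    · simp [h1, h1', Finset.sum_add_distrib]
    · simp [h2 T hT, h2' T hT]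

end Degree

section Cluster

variable {n : ℕ} {M : Type*} [AddCommGroup M]

/-- The bonds of `S` all lie to the left of those of `S'`, with at least one bond in between. -/
def Separated (S S' : Finset (Fin n)) : Prop :=
  ∀ i ∈ S, ∀ j ∈ S', (i : ℕ) + 1 < j

lemma Separated.disjoint {S S' : Finset (Fin n)} (h : Separated S S') : Disjoint S S' := by
  refine Finset.disjoint_left.2 fun i hi hi' => ?_
  have := h i hi i hi'
  omega

/-- The cluster coefficients of an additive function vanish on sets with a gap, by induction on the
number of elements: in `f (S ∪ S') = ∑ T ⊆ S ∪ S', φ T` the subsets that meet both `S` and `S'` drop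
out, except `S ∪ S'`, while the subsets of `S` and those of `S'` give `f S + f S'`. -/
lemma cluster_eq_zero_of_separated {f φ : Finset (Fin n) → M}
    (hφ : ∀ S, f S = ∑ T ∈ S.powerset, φ T)
    (hadd : ∀ S S', Separated S S' → f (S ∪ S') = f S + f S') :
    ∀ S S' : Finset (Fin n), Separated S S' → S.Nonempty → S'.Nonempty → φ (S ∪ S') = 0 := by
  have h0 : φ ∅ = 0 := by
    have h1 := hadd ∅ ∅ (by simp [Separated])
    have h2 := hφ ∅
    simp only [Finset.union_empty, left_eq_add] at h1
    simpa [h1] using h2.symm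
  suffices H : ∀ (k : ℕ) (S S' : Finset (Fin n)), (S ∪ S').card = k → Separated S S' →
      S.Nonempty → S'.Nonempty → φ (S ∪ S') = 0 from fun S S' => H _ S S' rfl
  intro k
  induction k using Nat.strong_induction_on with
  | _ k ih =>
    intro S S' hk hsep hS hS'
    have hdisj := hsep.disjoint
    have hnot : S ∪ S' ∉ S.powerset ∪ S'.powerset := by
      simp only [Finset.mem_union, Finset.mem_powerset, Finset.union_subset_iff, not_or]
      constructor
      · rintro ⟨-, h⟩
        obtain ⟨j, hj⟩ := hS'
        exact Finset.disjoint_left.1 hdisj (h hj) hj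
      · rintro ⟨h, -⟩
        obtain ⟨j, hj⟩ := hS
        exact Finset.disjoint_left.1 hdisj hj (h hj)
    have hsum : ∑ T ∈ (S ∪ S').powerset, φ T
        = ∑ T ∈ insert (S ∪ S') (S.powerset ∪ S'.powerset), φ T := by
      symm
      refine Finset.sum_subset (fun T hT => ?_) fun T hT hT' => ?_
      · simp only [Finset.mem_insert, Finset.mem_union, Finset.mem_powerset] at hT ⊢
        rcases hT with rfl | h | h
        · exact subset_rfl
        · exact h.trans Finset.subset_union_left
        · exact h.trans Finset.subset_union_right
      · simp only [Finset.mem_insert, Finset.mem_union, Finset.mem_powerset, not_or] at hT hT'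
        have hTu : T = (T ∩ S) ∪ (T ∩ S') := by
          rw [← Finset.inter_union_distrib_left, Finset.inter_eq_left.2 hT]
        have hlt : T.card < k :=
          hk ▸ Finset.card_lt_card (Finset.ssubset_iff_subset_ne.2 ⟨hT, hT'.1⟩)
        rw [hTu] at hlt ⊢
        refine ih _ hlt _ _ rfl (fun i hi j hj => hsep i (Finset.mem_inter.1 hi).2 j
          (Finset.mem_inter.1 hj).2) ?_ ?_
        · rw [Finset.nonempty_iff_ne_empty]
          intro he
          rw [he, Finset.empty_union] at hTu
          exact hT'.2.2 (hTu ▸ Finset.inter_subset_right)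
        · rw [Finset.nonempty_iff_ne_empty]
          intro he
          rw [he, Finset.union_empty] at hTu
          exact hT'.2.1 (hTu ▸ Finset.inter_subset_right)
    have hinter : S.powerset ∩ S'.powerset = {∅} := by
      ext T
      simp only [Finset.mem_inter, Finset.mem_powerset, Finset.mem_singleton]
      constructor
      · rintro ⟨h, h'⟩
        exact Finset.disjoint_self_iff_empty _ |>.1
          (Finset.disjoint_of_subset_left h (Finset.disjoint_of_subset_right h' hdisj))
      · rintro rfl
        simp
    have h1 := Finset.sum_union_inter (s₁ := S.powerset) (s₂ := S'.powerset) (f := φ)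
    rw [hinter, Finset.sum_singleton, h0, add_zero, ← hφ, ← hφ, ← hadd S S' hsep, hφ, hsum,
      Finset.sum_insert hnot] at h1
    simpa using h1

/-- Bounds for the cluster coefficients of a function that is bounded by `B` on small sets; the
recursion is that of Möbius inversion, `φ T = f T - ∑ U ⊂ T, φ U`. -/
def clusterBound (B : ℝ) : ℕ → ℝ
  | 0 => B
  | k + 1 => B + 2 ^ (k + 1) * clusterBound B k

lemma clusterBound_nonneg {B : ℝ} (hB : 0 ≤ B) : ∀ k, 0 ≤ clusterBound B k
  | 0 => hB
  | k + 1 => add_nonneg hB (mul_nonneg (by positivity) (clusterBound_nonneg hB k))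

variable {ι : Type} [Fintype ι] [DecidableEq ι]

lemma diamondLE_cluster {f φ : Finset (Fin n) → SuperOp ι} {B : ℝ} {d : ℕ} (hB : 0 ≤ B)
    (hφ : ∀ S, f S = ∑ T ∈ S.powerset, φ T)
    (hf : ∀ S : Finset (Fin n), S.card ≤ d → DiamondLE (f S) B) :
    ∀ k ≤ d, ∀ T : Finset (Fin n), T.card ≤ k → DiamondLE (φ T) (clusterBound B k) := by
  intro k
  induction k with
  | zero =>
    intro _ T hT
    have hT0 : T = ∅ := Finset.card_eq_zero.1 (Nat.le_zero.1 hT)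
    subst hT0
    have h1 := hφ ∅
    rw [Finset.powerset_empty, Finset.sum_singleton] at h1
    rw [← h1]
    exact hf ∅ (by simp)
  | succ k ih =>
    intro hk T hT
    have h1 : φ T = f T - ∑ U ∈ T.ssubsets, φ U := by
      rw [hφ T, Finset.ssubsets, ← Finset.add_sum_erase _ _ (Finset.mem_powerset_self T)]
      abel
    rw [h1, clusterBound]
    refine (hf T (hT.trans hk)).sub ?_
    refine (DiamondLE.sum fun U hU => ih (by omega) U ?_).mono ?_
    · have := Finset.card_lt_card (Finset.mem_ssubsets.1 hU)
      omega
    · rw [Finset.sum_const, nsmul_eq_mul]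
      refine mul_le_mul_of_nonneg_right ?_ (clusterBound_nonneg hB k)
      have h2 : T.ssubsets.card ≤ 2 ^ T.card := by
        rw [← Finset.card_powerset]
        exact Finset.card_le_card (Finset.erase_subset _ _)
      have h3 : T.ssubsets.card ≤ 2 ^ (k + 1) := h2.trans (Nat.pow_le_pow_right (by norm_num) hT)
      exact_mod_cast h3

/-- A function of bounded degree that is additive over separated sets of bonds is a sum over
intervals of bounded length, so it grows at most linearly with the length of the chain. -/
theorem diamondLE_of_additive {f : Finset (Fin n) → SuperOp ι} {B : ℝ} {d : ℕ} (hB : 0 ≤ B)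
    (hdeg : HasDegree d f) (hadd : ∀ S S', Separated S S' → f (S ∪ S') = f S + f S')
    (hf : ∀ S : Finset (Fin n), S.card ≤ d → DiamondLE (f S) B) :
    DiamondLE (f Finset.univ) (n * (d + 1) * clusterBound B d) := by
  obtain ⟨φ, hφ, hφ0⟩ := hdeg.exists_cluster
  have hzero := cluster_eq_zero_of_separated hφ hadd
  have hempty : φ ∅ = 0 := by
    have h1 := hadd ∅ ∅ (by simp [Separated])
    have h2 := hφ ∅
    simp only [Finset.union_empty, left_eq_add] at h1
    simpa [h1] using h2.symm
  -- The intervals of at most `d` bonds, given by their left end and their length.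
  set I : Finset (Finset (Fin n)) := (Finset.univ ×ˢ Finset.range (d + 1)).image
    fun p : Fin n × ℕ => Finset.univ.filter fun i : Fin n => p.1 ≤ i ∧ (i : ℕ) < p.1 + p.2 with hI
  have hsum : f Finset.univ = ∑ T ∈ I with T.card ≤ d, φ T := by
    rw [hφ]
    symm
    refine Finset.sum_subset (fun T _ => by simp) fun T _ hT => ?_
    by_cases hcard : d < T.card
    · exact hφ0 T hcard
    rw [not_lt] at hcard
    rcases T.eq_empty_or_nonempty with rfl | hne
    · exact hempty
    by_contra hne0
    apply hT
    simp only [hI, Finset.mem_filter, Finset.mem_image, Finset.mem_product, Finset.mem_univ,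
      true_and, Finset.mem_range]
    -- If `T` missed a bond between two of its elements, its coefficient would vanish.
    have hfull : ∀ k, T.min' hne ≤ k → k ≤ T.max' hne → k ∈ T := by
      intro k hk1 hk2
      by_contra hk
      have hk1' : T.min' hne < k :=
        lt_of_le_of_ne hk1 fun h => hk (h ▸ T.min'_mem hne)
      have hk2' : k < T.max' hne :=
        lt_of_le_of_ne hk2 fun h => hk (h ▸ T.max'_mem hne)
      have hT' : T = T.filter (· < k) ∪ T.filter (k < ·) := by
        ext i
        simp only [Finset.mem_union, Finset.mem_filter]
        constructor
        · intro hi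
          rcases lt_trichotomy i k with h | h | h
          · exact Or.inl ⟨hi, h⟩
          · exact absurd (h ▸ hi) hk
          · exact Or.inr ⟨hi, h⟩
        · rintro (h | h) <;> exact h.1
      apply hne0
      rw [hT']
      refine hzero _ _ (fun i hi j hj => ?_) ⟨_, Finset.mem_filter.2 ⟨T.min'_mem hne, hk1'⟩⟩
        ⟨_, Finset.mem_filter.2 ⟨T.max'_mem hne, hk2'⟩⟩
      have h1 := (Finset.mem_filter.1 hi).2
      have h2 := (Finset.mem_filter.1 hj).2
      rw [Fin.lt_def] at h1 h2
      omega
    have hIcc : T = Finset.Icc (T.min' hne) (T.max' hne) := by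
      ext i
      rw [Finset.mem_Icc]
      exact ⟨fun hi => ⟨T.min'_le i hi, T.le_max' i hi⟩, fun h => hfull i h.1 h.2⟩
    have hc : T.card = (T.max' hne : ℕ) + 1 - (T.min' hne : ℕ) := by
      conv_lhs => rw [hIcc, Fin.card_Icc]
    have hle : T.min' hne ≤ T.max' hne := T.min'_le _ (T.max'_mem hne)
    rw [Fin.le_def] at hle
    refine ⟨⟨(T.min' hne, T.card), by simpa using Nat.lt_succ_of_le hcard, ?_⟩, hcard⟩
    conv_rhs => rw [hIcc]
    ext i
    simp only [Finset.mem_filter, Finset.mem_univ, true_and, Finset.mem_Icc, Fin.le_def]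
    omega
  rw [hsum]
  refine (DiamondLE.sum fun T hT => diamondLE_cluster hB hφ hf d le_rfl T
    (Finset.mem_filter.1 hT).2).mono ?_
  rw [Finset.sum_const, nsmul_eq_mul]
  refine mul_le_mul_of_nonneg_right ?_ (clusterBound_nonneg hB d)
  have h1 : (I.filter fun T => T.card ≤ d).card ≤ n * (d + 1) := by
    refine (Finset.card_le_card (Finset.filter_subset _ _)).trans (Finset.card_image_le.trans ?_)
    simp
  exact_mod_cast h1

end Cluster


/-! ### Operators on the chain and on its ancillas -/

section Embeddings

variable {ι κ : Type} [Fintype ι] [DecidableEq ι] [Fintype κ] [DecidableEq κ]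

/-- `X ↦ X ⊗ 1`. -/
def kronLeft (ι κ : Type) [Fintype ι] [DecidableEq ι] [Fintype κ] [DecidableEq κ] :
    Matrix ι ι ℂ →⋆ₐ[ℂ] Matrix (ι × κ) (ι × κ) ℂ where
  toFun X := X ⊗ₖ (1 : Matrix κ κ ℂ)
  map_one' := Matrix.one_kronecker_one
  map_mul' X Y := by rw [← Matrix.mul_kronecker_mul, Matrix.one_mul]
  map_zero' := Matrix.zero_kronecker _
  map_add' X Y := Matrix.add_kronecker X Y _
  commutes' c := by
    simp only [Algebra.algebraMap_eq_smul_one, Matrix.smul_kronecker, Matrix.one_kronecker_one]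
  map_star' X := by
    simp only [Matrix.star_eq_conjTranspose, Matrix.conjTranspose_kronecker,
      Matrix.conjTranspose_one]

/-- `Y ↦ 1 ⊗ Y`. -/
def kronRight (ι κ : Type) [Fintype ι] [DecidableEq ι] [Fintype κ] [DecidableEq κ] :
    Matrix κ κ ℂ →⋆ₐ[ℂ] Matrix (ι × κ) (ι × κ) ℂ where
  toFun Y := (1 : Matrix ι ι ℂ) ⊗ₖ Y
  map_one' := Matrix.one_kronecker_one
  map_mul' X Y := by rw [← Matrix.mul_kronecker_mul, Matrix.one_mul]
  map_zero' := Matrix.kronecker_zero _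
  map_add' X Y := Matrix.kronecker_add _ X Y
  commutes' c := by
    simp only [Algebra.algebraMap_eq_smul_one, Matrix.kronecker_smul, Matrix.one_kronecker_one]
  map_star' X := by
    simp only [Matrix.star_eq_conjTranspose, Matrix.conjTranspose_kronecker,
      Matrix.conjTranspose_one]

lemma kronLeft_mul_kronRight (X : Matrix ι ι ℂ) (Y : Matrix κ κ ℂ) :
    kronLeft ι κ X * kronRight ι κ Y = X ⊗ₖ Y := by
  change (X ⊗ₖ (1 : Matrix κ κ ℂ)) * ((1 : Matrix ι ι ℂ) ⊗ₖ Y) = _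
  rw [← Matrix.mul_kronecker_mul, Matrix.mul_one, Matrix.one_mul]

lemma norm_kronecker_le (X : Matrix ι ι ℂ) (Y : Matrix κ κ ℂ) : ‖X ⊗ₖ Y‖ ≤ ‖X‖ * ‖Y‖ := by
  rw [← kronLeft_mul_kronRight]
  exact (norm_mul_le _ _).trans (mul_le_mul (NonUnitalStarAlgHom.norm_apply_le _ X)
    (NonUnitalStarAlgHom.norm_apply_le _ Y) (norm_nonneg _) (norm_nonneg _))

end Embeddings

section Ancillas

variable {n : ℕ}

/-- A sum over configurations that differ from `a` at bond `i` only. -/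
lemma sum_eq_sum_update {M : Type*} [AddCommMonoid M] (i : Fin n) (a : Anc n) (F : Anc n → M)
    (hF : ∀ c, ¬ (∀ j, j ≠ i → a j = c j) → F c = 0) :
    ∑ c, F c = ∑ m, F (Function.update a i m) := by
  rw [← Finset.sum_subset (Finset.subset_univ (Finset.univ.image (Function.update a i)))]
  · rw [Finset.sum_image]
    intro m _ m' _ h
    simpa using congrFun h i
  · intro c _ hc
    refine hF c fun h => hc ?_
    rw [Finset.mem_image]
    refine ⟨c i, Finset.mem_univ _, ?_⟩
    ext j
    by_cases hj : j = i
    · subst hj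
      simp
    · rw [Function.update_of_ne hj, h j hj]

lemma ancOp_apply (i : Fin n) (o : Matrix (Fin 5) (Fin 5) ℂ) (a b : Anc n) :
    ancOp i o a b = if ∀ j, j ≠ i → a j = b j then o (a i) (b i) else 0 := rfl

lemma ancOp_update (i : Fin n) (o : Matrix (Fin 5) (Fin 5) ℂ) (a : Anc n) (m : Fin 5) :
    ancOp i o a (Function.update a i m) = o (a i) m := by
  rw [ancOp_apply, if_pos, Function.update_self]
  intro j hj
  rw [Function.update_of_ne hj]

lemma ancOp_mul_apply (i : Fin n) (o : Matrix (Fin 5) (Fin 5) ℂ) (M : Matrix (Anc n) (Anc n) ℂ)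
    (a b : Anc n) : (ancOp i o * M) a b = ∑ m, o (a i) m * M (Function.update a i m) b := by
  rw [Matrix.mul_apply, sum_eq_sum_update i a]
  · simp only [ancOp_update]
  · intro c hc
    rw [ancOp_apply, if_neg hc, zero_mul]

/-- `ancOp i` as a homomorphism. -/
def ancHom (i : Fin n) : Matrix (Fin 5) (Fin 5) ℂ →⋆ₐ[ℂ] Matrix (Anc n) (Anc n) ℂ where
  toFun := ancOp i
  map_one' := by
    ext a b
    rw [ancOp_apply]
    by_cases h : a = b
    · subst h
      simp
    · rw [Matrix.one_apply_ne h]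
      by_cases h' : ∀ j, j ≠ i → a j = b j
      · rw [if_pos h', Matrix.one_apply_ne]
        intro hi
        refine h (funext fun j => ?_)
        by_cases hj : j = i
        · rw [hj, hi]
        · exact h' j hj
      · rw [if_neg h']
  map_mul' o o' := by
    ext a b
    rw [ancOp_mul_apply, ancOp_apply]
    have h : ∀ m, (∀ j, j ≠ i → Function.update a i m j = b j) ↔ (∀ j, j ≠ i → a j = b j) := by
      intro m
      refine forall_congr' fun j => forall_congr' fun hj => ?_
      rw [Function.update_of_ne hj]
    simp only [ancOp_apply, h, Function.update_self]
    split_ifs <;> simp [Matrix.mul_apply]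
  map_zero' := by
    ext a b
    simp [ancOp_apply]
  map_add' o o' := by
    ext a b
    simp only [ancOp_apply, Matrix.add_apply]
    split_ifs <;> simp
  commutes' c := by
    ext a b
    simp only [ancOp_apply, Algebra.algebraMap_eq_smul_one, Matrix.smul_apply, smul_eq_mul]
    by_cases h : a = b
    · subst h
      simp
    · rw [Matrix.one_apply_ne h]
      by_cases h' : ∀ j, j ≠ i → a j = b j
      · rw [if_pos h', Matrix.one_apply_ne]
        intro hi
        refine h (funext fun j => ?_)
        by_cases hj : j = i
        · rw [hj, hi]
        · exact h' j hj
      · rw [if_neg h', mul_zero]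
  map_star' o := by
    ext a b
    simp only [ancOp_apply, Matrix.star_apply, eq_comm (a := a _)]
    split_ifs <;> simp

lemma ancOp_mul (i : Fin n) (o o' : Matrix (Fin 5) (Fin 5) ℂ) :
    ancOp i o * ancOp i o' = ancOp i (o * o') :=
  (map_mul (ancHom i) o o').symm

lemma ancOp_conjTranspose (i : Fin n) (o : Matrix (Fin 5) (Fin 5) ℂ) :
    (ancOp i o)ᴴ = ancOp i oᴴ :=
  (map_star (ancHom i) o).symm

lemma norm_ancOp_le (i : Fin n) (o : Matrix (Fin 5) (Fin 5) ℂ) : ‖ancOp i o‖ ≤ ‖o‖ :=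
  NonUnitalStarAlgHom.norm_apply_le (ancHom i) o

lemma ancOp_smul (i : Fin n) (c : ℂ) (o : Matrix (Fin 5) (Fin 5) ℂ) :
    ancOp i (c • o) = c • ancOp i o :=
  map_smul (ancHom i) c o

lemma ancOp_commute {i j : Fin n} (hij : i ≠ j) (o o' : Matrix (Fin 5) (Fin 5) ℂ) :
    ancOp i o * ancOp j o' = ancOp j o' * ancOp i o := by
  have key : ∀ {i j : Fin n}, i ≠ j → ∀ (o o' : Matrix (Fin 5) (Fin 5) ℂ) (a b : Anc n),
      (ancOp i o * ancOp j o') a b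
        = if ∀ l, l ≠ i → l ≠ j → a l = b l then o (a i) (b i) * o' (a j) (b j) else 0 := by
    intro i j hij o o' a b
    rw [ancOp_mul_apply, Finset.sum_eq_single (b i)]
    · rw [ancOp_apply, Function.update_of_ne hij.symm]
      by_cases h : ∀ l, l ≠ i → l ≠ j → a l = b l
      · rw [if_pos h, if_pos]
        intro l hl
        by_cases hli : l = i
        · rw [hli, Function.update_self]
        · rw [Function.update_of_ne hli, h l hli hl]
      · rw [if_neg h, if_neg, mul_zero]
        intro h'
        refine h fun l hli hlj => ?_
        have := h' l hlj
        rwa [Function.update_of_ne hli] at this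
    · intro m _ hm
      rw [ancOp_apply, if_neg, mul_zero]
      intro h
      have := h i hij
      rw [Function.update_self] at this
      exact hm this
    · intro h
      exact absurd (Finset.mem_univ _) h
  ext a b
  rw [key hij, key hij.symm]
  have : (∀ l, l ≠ i → l ≠ j → a l = b l) ↔ (∀ l, l ≠ j → l ≠ i → a l = b l) :=
    forall_congr' fun l => forall_comm
  by_cases h : ∀ l, l ≠ i → l ≠ j → a l = b l
  · rw [if_pos h, if_pos (this.1 h), mul_comm]
  · rw [if_neg h, if_neg fun h' => h (this.2 h')]

lemma vac_apply (a b : Anc n) : vac n a b = if a = 0 ∧ b = 0 then 1 else 0 := by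
  rw [vac, Matrix.single_apply]
  congr 1
  rw [eq_iff_iff]
  constructor
  · rintro ⟨h, h'⟩
    exact ⟨h.symm, h'.symm⟩
  · rintro ⟨h, h'⟩
    exact ⟨h.symm, h'.symm⟩

lemma vac_mul_vac : vac n * vac n = vac n := by
  rw [vac, Matrix.single_mul_single_same, mul_one]

lemma vac_conjTranspose : (vac n)ᴴ = vac n := by
  rw [vac, Matrix.conjTranspose_single, star_one]

end Ancillas

section Trace

variable {n : ℕ}

lemma traceAnc_apply (M : JointOp n) (s t : Sys n) :
    traceAnc n M s t = ∑ a, M (s, a) (t, a) := rfl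

lemma traceAnc_kronecker_one_mul (X : SysOp n) (M : JointOp n) :
    traceAnc n ((X ⊗ₖ (1 : Matrix (Anc n) (Anc n) ℂ)) * M) = X * traceAnc n M := by
  ext s t
  simp only [traceAnc_apply, Matrix.mul_apply, Fintype.sum_prod_type, Matrix.kronecker_apply,
    Matrix.one_apply, mul_ite, mul_one, mul_zero, ite_mul, zero_mul, Finset.sum_ite_eq,
    Finset.mem_univ, if_true, Finset.mul_sum]
  rw [Finset.sum_comm]

lemma traceAnc_mul_kronecker_one (X : SysOp n) (M : JointOp n) :
    traceAnc n (M * (X ⊗ₖ (1 : Matrix (Anc n) (Anc n) ℂ))) = traceAnc n M * X := by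
  ext s t
  simp only [traceAnc_apply, Matrix.mul_apply, Fintype.sum_prod_type, Matrix.kronecker_apply,
    Matrix.one_apply, mul_ite, mul_one, mul_zero, Finset.sum_ite_eq',
    Finset.mem_univ, if_true, Finset.sum_mul]
  rw [Finset.sum_comm]

lemma one_kronecker_mul_apply (o : Matrix (Anc n) (Anc n) ℂ) (M : JointOp n) (s : Sys n)
    (a : Anc n) (q : Sys n × Anc n) :
    (((1 : SysOp n) ⊗ₖ o) * M) (s, a) q = ∑ b, o a b * M (s, b) q := by
  rw [Matrix.mul_apply, Fintype.sum_prod_type, Finset.sum_eq_single s]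
  · simp
  · intro t _ ht
    simp [Matrix.one_apply_ne ht.symm]
  · simp

lemma mul_one_kronecker_apply (o : Matrix (Anc n) (Anc n) ℂ) (M : JointOp n) (t : Sys n)
    (b : Anc n) (p : Sys n × Anc n) :
    (M * ((1 : SysOp n) ⊗ₖ o)) p (t, b) = ∑ a, M p (t, a) * o a b := by
  rw [Matrix.mul_apply, Fintype.sum_prod_type, Finset.sum_eq_single t]
  · simp
  · intro s _ hs
    simp [Matrix.one_apply_ne hs]
  · simp

lemma traceAnc_one_kronecker_mul (o : Matrix (Anc n) (Anc n) ℂ) (M : JointOp n) :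
    traceAnc n (((1 : SysOp n) ⊗ₖ o) * M) = traceAnc n (M * ((1 : SysOp n) ⊗ₖ o)) := by
  ext s t
  simp only [traceAnc_apply, one_kronecker_mul_apply, mul_one_kronecker_apply]
  rw [Finset.sum_comm]
  exact Finset.sum_congr rfl fun a _ => Finset.sum_congr rfl fun b _ => mul_comm _ _

lemma traceAnc_kronecker (X : SysOp n) (o : Matrix (Anc n) (Anc n) ℂ) :
    traceAnc n (X ⊗ₖ o) = o.trace • X := by
  ext s t
  simp only [traceAnc_apply, Matrix.kronecker_apply, Matrix.smul_apply, smul_eq_mul, Matrix.trace,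
    Matrix.diag_apply, Finset.sum_mul]
  exact Finset.sum_congr rfl fun a _ => mul_comm _ _

/-- The superoperator `ρ ↦ Tr_E (X (ρ ⊗ |Vac⟩⟨Vac|) Y)`. -/
def sandwich (X Y : JointOp n) : SuperOp (Sys n) :=
  LinearMap.toContinuousLinearMap
    (traceAnc n ∘ₗ LinearMap.mulLeftRight ℂ (X, Y) ∘ₗ adjoinVac n)

lemma sandwich_apply (X Y : JointOp n) (ρ : SysOp n) :
    sandwich X Y ρ = traceAnc n (X * (ρ ⊗ₖ vac n) * Y) := by
  simp [sandwich, adjoinVac]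

lemma reducedEvolution_eq (H : JointOp n) (τ : ℝ) :
    reducedEvolution H τ = sandwich (NormedSpace.exp (-(Complex.I * (τ : ℂ)) • H))
        (NormedSpace.exp ((Complex.I * (τ : ℂ)) • H)) := rfl

/-- `sandwich` as a continuous bilinear map. -/
def sandwichBilin (n : ℕ) : JointOp n →L[ℂ] JointOp n →L[ℂ] SuperOp (Sys n) :=
  LinearMap.toContinuousBilinearMap <| LinearMap.mk₂ ℂ sandwich
    (fun X X' Y => by ext1 ρ; simp [sandwich_apply, add_mul])
    (fun c X Y => by ext1 ρ; simp [sandwich_apply])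
    (fun X Y Y' => by ext1 ρ; simp [sandwich_apply, mul_add])
    (fun c X Y => by ext1 ρ; simp [sandwich_apply])

end Trace


/-! ### The diamond norm of a dilated evolution -/

section SandwichNorm

variable {n : ℕ}

/-- `U ⊗ 1` for `U` acting on the system and a reference `κ`, with the ancillas in between. -/
def kronMid (n : ℕ) (κ : Type) [Fintype κ] [DecidableEq κ] :
    Matrix (Sys n × κ) (Sys n × κ) ℂ →⋆ₐ[ℂ]
      Matrix ((Sys n × Anc n) × κ) ((Sys n × Anc n) × κ) ℂ where
  toFun U := Matrix.of fun p q =>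
    if p.1.2 = q.1.2 then U (p.1.1, p.2) (q.1.1, q.2) else 0
  map_one' := by
    ext ⟨⟨s, a⟩, p⟩ ⟨⟨t, b⟩, q⟩
    simp only [Matrix.of_apply, Matrix.one_apply, Prod.mk.injEq]
    by_cases h1 : s = t <;> by_cases h2 : a = b <;> by_cases h3 : p = q <;> simp [h1, h2, h3]
  map_mul' U V := by
    ext ⟨⟨s, a⟩, p⟩ ⟨⟨t, b⟩, q⟩
    simp only [Matrix.of_apply, Matrix.mul_apply, Fintype.sum_prod_type, ite_mul, zero_mul,
      mul_ite, mul_zero]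
    by_cases h : a = b
    · subst h
      simp only [if_true]
      refine Finset.sum_congr rfl fun r _ => ?_
      rw [Finset.sum_eq_single a]
      · simp
      · intro c _ hc
        simp [hc]
      · simp
    · rw [if_neg h]
      symm
      refine Finset.sum_eq_zero fun r _ => Finset.sum_eq_zero fun c _ =>
        Finset.sum_eq_zero fun l _ => ?_
      by_cases h1 : c = b
      · rw [if_pos h1, if_neg fun h2 => h (h2.trans h1)]
      · rw [if_neg h1]
  map_zero' := by
    ext
    simp
  map_add' U V := by
    ext p q
    simp only [Matrix.of_apply, Matrix.add_apply]
    split_ifs <;> simp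
  commutes' c := by
    ext ⟨⟨s, a⟩, p⟩ ⟨⟨t, b⟩, q⟩
    simp only [Algebra.algebraMap_eq_smul_one, Matrix.of_apply, Matrix.smul_apply,
      Matrix.one_apply, Prod.mk.injEq]
    by_cases h1 : s = t <;> by_cases h2 : a = b <;> by_cases h3 : p = q <;> simp [h1, h2, h3]
  map_star' U := by
    ext p q
    simp only [Matrix.of_apply, Matrix.star_apply, eq_comm (a := p.1.2)]
    split_ifs <;> simp

/-- The isometry that puts the ancillas in level `0`. -/
def vacIsometry (n : ℕ) (κ : Type) [Fintype κ] [DecidableEq κ] :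
    Matrix ((Sys n × Anc n) × κ) (Sys n × κ) ℂ :=
  Matrix.of fun p q => if p.1.1 = q.1 ∧ p.2 = q.2 ∧ p.1.2 = 0 then 1 else 0

variable {κ : Type} [Fintype κ] [DecidableEq κ]

lemma vacIsometry_mul_apply {γ : Type} (Z : Matrix (Sys n × κ) γ ℂ) (s : Sys n) (a : Anc n)
    (p : κ) (r : γ) :
    (vacIsometry n κ * Z) ((s, a), p) r = if a = 0 then Z (s, p) r else 0 := by
  rw [Matrix.mul_apply, Finset.sum_eq_single (s, p)]
  · simp [vacIsometry]
  · rintro ⟨t, q⟩ _ hne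
    rw [vacIsometry, Matrix.of_apply, if_neg, zero_mul]
    rintro ⟨h1, h2, -⟩
    exact hne (Prod.ext h1.symm h2.symm)
  · simp

lemma norm_vacIsometry_le : ‖vacIsometry n κ‖ ≤ 1 := by
  have h1 : (vacIsometry n κ)ᴴ * vacIsometry n κ = 1 := by
    ext ⟨s, p⟩ ⟨t, q⟩
    rw [Matrix.mul_apply, Finset.sum_eq_single ((s, 0), p)]
    · simp only [Matrix.conjTranspose_apply, vacIsometry, Matrix.of_apply, Matrix.one_apply,
        Prod.mk.injEq]
      by_cases h1 : s = t <;> by_cases h2 : p = q <;> simp [h1, h2]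
    · rintro ⟨⟨u, a⟩, r⟩ _ hne
      rw [Matrix.conjTranspose_apply, vacIsometry, Matrix.of_apply, if_neg, star_zero, zero_mul]
      rintro ⟨rfl, rfl, rfl⟩
      exact hne rfl
    · simp
  have h := Matrix.l2_opNorm_conjTranspose_mul_self (vacIsometry n κ)
  rw [h1] at h
  nlinarith [norm_nonneg (vacIsometry n κ), norm_one_matrix_le (ι := Sys n × κ)]

/-- With `V` the vacuum isometry, `(sandwich X Y ⊗ id) Z` is the partial trace of
`X V Z V† Y` over the ancillas. -/
lemma ampliate_sandwich_apply (X Y : JointOp n) (k : ℕ)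
    (Z : Matrix (Sys n × Fin k) (Sys n × Fin k) ℂ) (p q : Sys n × Fin k) :
    ampliate (sandwich X Y) k Z p q
      = ∑ a, (kronLeft (Sys n × Anc n) (Fin k) X * (vacIsometry n (Fin k) * Z *
          (vacIsometry n (Fin k))ᴴ) * kronLeft (Sys n × Anc n) (Fin k) Y)
            ((p.1, a), p.2) ((q.1, a), q.2) := by
  rw [ampliate, Matrix.of_apply, sandwich_apply, traceAnc_apply]
  refine Finset.sum_congr rfl fun a _ => ?_
  have hW : ∀ (s t : Sys n) (a b : Anc n) (u v : Fin k),
      (vacIsometry n (Fin k) * Z * (vacIsometry n (Fin k))ᴴ) ((s, a), u) ((t, b), v)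
        = Z (s, u) (t, v) * vac n a b := by
    intro s t a b u v
    rw [Matrix.mul_assoc, vacIsometry_mul_apply, vac_apply]
    have h2 : (Z * (vacIsometry n (Fin k))ᴴ) (s, u) ((t, b), v)
        = star ((vacIsometry n (Fin k) * Zᴴ) ((t, b), v) (s, u)) := by
      rw [← Matrix.conjTranspose_apply, Matrix.conjTranspose_mul,
        Matrix.conjTranspose_conjTranspose]
    rw [h2, vacIsometry_mul_apply]
    by_cases ha : a = 0 <;> by_cases hb : b = 0 <;> simp [ha, hb]
  have hX : ∀ (M : Matrix ((Sys n × Anc n) × Fin k) ((Sys n × Anc n) × Fin k) ℂ)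
      (r : Sys n × Anc n) (u : Fin k) (w),
      (kronLeft (Sys n × Anc n) (Fin k) X * M) (r, u) w = ∑ r', X r r' * M (r', u) w := by
    intro M r u w
    change ((X ⊗ₖ (1 : Matrix (Fin k) (Fin k) ℂ)) * M) (r, u) w = _
    rw [Matrix.mul_apply, Fintype.sum_prod_type]
    refine Finset.sum_congr rfl fun r' _ => ?_
    rw [Finset.sum_eq_single u]
    · simp
    · intro v _ hv
      simp [Matrix.one_apply_ne hv.symm]
    · simp
  have hY : ∀ (M : Matrix ((Sys n × Anc n) × Fin k) ((Sys n × Anc n) × Fin k) ℂ)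
      (r : Sys n × Anc n) (u : Fin k) (w),
      (M * kronLeft (Sys n × Anc n) (Fin k) Y) w (r, u) = ∑ r', M w (r', u) * Y r' r := by
    intro M r u w
    change (M * (Y ⊗ₖ (1 : Matrix (Fin k) (Fin k) ℂ))) w (r, u) = _
    rw [Matrix.mul_apply, Fintype.sum_prod_type]
    refine Finset.sum_congr rfl fun r' _ => ?_
    rw [Finset.sum_eq_single u]
    · simp
    · intro v _ hv
      simp [Matrix.one_apply_ne hv]
    · simp
  rw [hY, Matrix.mul_apply]
  refine Finset.sum_congr rfl fun r _ => ?_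
  rw [hX, Matrix.mul_apply]
  congr 1
  refine Finset.sum_congr rfl fun r' _ => ?_
  obtain ⟨s, b⟩ := r
  obtain ⟨s', b'⟩ := r'
  rw [hW, Matrix.kronecker_apply, Matrix.of_apply]

/-- By trace duality the partial trace over the ancillas becomes the embedding `U ↦ U ⊗ 1`, so that
every factor is estimated in operator norm, uniformly in the reference system. -/
lemma diamondLE_sandwich (X Y : JointOp n) : DiamondLE (sandwich X Y) (‖X‖ * ‖Y‖) := by
  intro k Z
  refine traceNorm_le_of_forall fun U hU => ?_
  set V := vacIsometry n (Fin k)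
  set X' := kronLeft (Sys n × Anc n) (Fin k) X
  set Y' := kronLeft (Sys n × Anc n) (Fin k) Y
  set U' := kronMid n (Fin k) U with hU'
  have htr : (U * ampliate (sandwich X Y) k Z).trace = ((Vᴴ * Y' * U' * X' * V) * Z).trace := by
    have h1 : ((Vᴴ * Y' * U' * X' * V) * Z).trace = (U' * (X' * (V * Z * Vᴴ) * Y')).trace := by
      simp only [Matrix.mul_assoc]
      rw [Matrix.trace_mul_comm Vᴴ, Matrix.mul_assoc, Matrix.trace_mul_comm Y']
      simp only [Matrix.mul_assoc]
    rw [h1]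
    set M := X' * (V * Z * Vᴴ) * Y' with hM
    have h2 : ∀ s a p, (U' * M) ((s, a), p) ((s, a), p)
        = ∑ t, ∑ q, U (s, p) (t, q) * M ((t, a), q) ((s, a), p) := by
      intro s a p
      rw [Matrix.mul_apply, Fintype.sum_prod_type, Fintype.sum_prod_type]
      refine Finset.sum_congr rfl fun t _ => ?_
      rw [Finset.sum_eq_single a]
      · simp [hU', kronMid]
      · intro b _ hb
        simp [hU', kronMid, hb.symm]
      · simp
    have h3 : ∀ s p, (U * ampliate (sandwich X Y) k Z) (s, p) (s, p)
        = ∑ t, ∑ q, U (s, p) (t, q) * ∑ a, M ((t, a), q) ((s, a), p) := by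
      intro s p
      rw [Matrix.mul_apply, Fintype.sum_prod_type]
      simp only [ampliate_sandwich_apply]
      rfl
    simp only [Matrix.trace, Matrix.diag_apply, Fintype.sum_prod_type, h2, h3, Finset.mul_sum]
    refine Finset.sum_congr rfl fun s _ => ?_
    conv_rhs => rw [Finset.sum_comm]
    refine Finset.sum_congr rfl fun p _ => ?_
    conv_rhs => rw [Finset.sum_comm]
    exact Finset.sum_congr rfl fun t _ => Finset.sum_comm
  rw [htr]
  refine (norm_trace_mul_le _ _).trans (mul_le_mul_of_nonneg_right ?_ (traceNorm_nonneg Z))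
  have hV : ‖V‖ ≤ 1 := norm_vacIsometry_le
  have hV' : ‖Vᴴ‖ ≤ 1 := (Matrix.l2_opNorm_conjTranspose V).trans_le hV
  have hX : ‖X'‖ ≤ ‖X‖ := NonUnitalStarAlgHom.norm_apply_le _ X
  have hY : ‖Y'‖ ≤ ‖Y‖ := NonUnitalStarAlgHom.norm_apply_le _ Y
  have hUn : ‖U'‖ ≤ 1 := (NonUnitalStarAlgHom.norm_apply_le _ U).trans hU
  calc ‖Vᴴ * Y' * U' * X' * V‖ ≤ ‖Vᴴ‖ * ‖Y'‖ * ‖U'‖ * ‖X'‖ * ‖V‖ := by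
        refine (Matrix.l2_opNorm_mul _ _).trans ?_
        gcongr
        refine (Matrix.l2_opNorm_mul _ _).trans ?_
        gcongr
        refine (Matrix.l2_opNorm_mul _ _).trans ?_
        gcongr
        exact Matrix.l2_opNorm_mul _ _
    _ ≤ 1 * ‖Y‖ * 1 * ‖X‖ * 1 := by gcongr
    _ = ‖X‖ * ‖Y‖ := by ring

end SandwichNorm


/-! ### The ancilla ladder -/

section Ladder

/-- The annihilation operator of an oscillator truncated to the levels `0, 1, 2, 3`; it kills the
level `4`. -/
def lowering : Matrix (Fin 5) (Fin 5) ℂ :=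
  Matrix.of ![![0, 1, 0, 0, 0], ![0, 0, (Real.sqrt 2 : ℂ), 0, 0], ![0, 0, 0, (Real.sqrt 3 : ℂ), 0],
    ![0, 0, 0, 0, 0], ![0, 0, 0, 0, 0]]

/-- The transition `|4⟩⟨0|`. -/
def toFour : Matrix (Fin 5) (Fin 5) ℂ := Matrix.single 4 0 1

/-- The defect of the canonical commutation relation of `lowering`. It vanishes on the levels
`0, 1, 2`, so up to three excitations the ancillas cannot be told from oscillators. -/
def ccrDefect : Matrix (Fin 5) (Fin 5) ℂ := Matrix.diagonal ![0, 0, 0, 4, 1]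

lemma sqrt_two_mul_self : (Real.sqrt 2 : ℂ) * (Real.sqrt 2 : ℂ) = 2 := by
  rw [← Complex.ofReal_mul, Real.mul_self_sqrt (by norm_num)]
  norm_num

lemma sqrt_three_mul_self : (Real.sqrt 3 : ℂ) * (Real.sqrt 3 : ℂ) = 3 := by
  rw [← Complex.ofReal_mul, Real.mul_self_sqrt (by norm_num)]
  norm_num

lemma lowering_ccr : lowering * loweringᴴ = loweringᴴ * lowering + 1 - ccrDefect := by
  ext a b
  fin_cases a <;> fin_cases b <;>
    simp [lowering, ccrDefect, Matrix.mul_apply, Fin.sum_univ_five, sqrt_two_mul_self,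
      sqrt_three_mul_self] <;> norm_num

lemma lowering_apply_zero (m : Fin 5) : lowering m 0 = 0 := by
  fin_cases m <;> simp [lowering]

lemma ccrDefect_apply_zero (m : Fin 5) : ccrDefect m 0 = 0 := by
  fin_cases m <;> simp [ccrDefect]

lemma ccrDefect_raise_apply_zero (m : Fin 5) : (ccrDefect * loweringᴴ) m 0 = 0 := by
  fin_cases m <;> simp [ccrDefect, lowering]

lemma ccrDefect_raise_raise_apply_zero (m : Fin 5) :
    (ccrDefect * (loweringᴴ * loweringᴴ)) m 0 = 0 := by
  fin_cases m <;> simp [ccrDefect, lowering, Matrix.mul_apply, Fin.sum_univ_five]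

lemma toFour_conjTranspose : toFourᴴ = Matrix.single 0 4 1 := by
  rw [toFour, Matrix.conjTranspose_single, star_one]

lemma toFour_conj_apply_zero (m : Fin 5) : toFourᴴ m 0 = 0 := by
  rw [toFour_conjTranspose, Matrix.single_apply_of_col_ne _ _ (by decide)]

lemma toFour_conj_mul_raise : toFourᴴ * loweringᴴ = 0 := by
  rw [toFour_conjTranspose]
  ext a b
  fin_cases a <;> fin_cases b <;> simp [lowering, Matrix.mul_apply, Matrix.single_apply]

lemma toFour_conj_mul_toFour_sub_one_apply_zero (m : Fin 5) :
    (toFourᴴ * toFour - 1) m 0 = 0 := by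
  rw [toFour_conjTranspose, toFour, Matrix.single_mul_single_same]
  fin_cases m <;> simp

lemma lowering_mul_toFour : lowering * toFour = 0 := by
  rw [toFour]
  ext a b
  fin_cases a <;> fin_cases b <;> simp [lowering, Matrix.mul_apply, Matrix.single_apply]

variable {n : ℕ}

lemma ancOp_mul_vac_eq_zero {i : Fin n} {o : Matrix (Fin 5) (Fin 5) ℂ} (h : ∀ m, o m 0 = 0) :
    ancOp i o * vac n = 0 := by
  ext a b
  rw [ancOp_mul_apply]
  refine Finset.sum_eq_zero fun m _ => ?_
  rw [vac_apply]
  by_cases hm : Function.update a i m = 0 ∧ b = 0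
  · have : m = 0 := by simpa using congrFun hm.1 i
    rw [this, h, zero_mul]
  · rw [if_neg hm, mul_zero]

/-- The annihilation operator of the ancilla of bond `i`. -/
def lw (i : Fin n) : Matrix (Anc n) (Anc n) ℂ := ancOp i lowering

/-- The creation operator of the ancilla of bond `i`. -/
def cr (i : Fin n) : Matrix (Anc n) (Anc n) ℂ := ancOp i loweringᴴ

/-- The transition `|4⟩⟨0|` of the ancilla of bond `i`. -/
def ex (i : Fin n) : Matrix (Anc n) (Anc n) ℂ := ancOp i toFour

/-- The transition `|0⟩⟨4|` of the ancilla of bond `i`. -/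
def dx (i : Fin n) : Matrix (Anc n) (Anc n) ℂ := ancOp i toFourᴴ

lemma lw_conjTranspose (i : Fin n) : (lw i)ᴴ = cr i := ancOp_conjTranspose i _

lemma cr_conjTranspose (i : Fin n) : (cr i)ᴴ = lw i := by
  rw [← lw_conjTranspose, Matrix.conjTranspose_conjTranspose]

lemma ex_conjTranspose (i : Fin n) : (ex i)ᴴ = dx i := ancOp_conjTranspose i _

lemma dx_conjTranspose (i : Fin n) : (dx i)ᴴ = ex i := by
  rw [← ex_conjTranspose, Matrix.conjTranspose_conjTranspose]

lemma ancOp_commute_assoc {i j : Fin n} (hij : i ≠ j) (o o' : Matrix (Fin 5) (Fin 5) ℂ)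
    (M : Matrix (Anc n) (Anc n) ℂ) :
    ancOp i o * (ancOp j o' * M) = ancOp j o' * (ancOp i o * M) := by
  rw [← Matrix.mul_assoc, ancOp_commute hij, Matrix.mul_assoc]

lemma lw_mul_vac (i : Fin n) : lw i * vac n = 0 := ancOp_mul_vac_eq_zero lowering_apply_zero

lemma dx_mul_vac (i : Fin n) : dx i * vac n = 0 := ancOp_mul_vac_eq_zero toFour_conj_apply_zero

lemma ccrDefect_mul_vac (k : Fin n) : ancOp k ccrDefect * vac n = 0 :=
  ancOp_mul_vac_eq_zero ccrDefect_apply_zero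

lemma ccrDefect_mul_cr (k i : Fin n) : ancOp k ccrDefect * (cr i * vac n) = 0 := by
  by_cases h : k = i
  · subst h
    rw [cr, ← Matrix.mul_assoc, ancOp_mul]
    exact ancOp_mul_vac_eq_zero ccrDefect_raise_apply_zero
  · rw [cr, ancOp_commute_assoc h, ccrDefect_mul_vac, Matrix.mul_zero]

lemma ccrDefect_mul_cr_cr (k i j : Fin n) :
    ancOp k ccrDefect * (cr i * (cr j * vac n)) = 0 := by
  by_cases h : k = i
  · by_cases h' : i = j
    · subst h
      subst h'
      rw [cr, ← Matrix.mul_assoc (ancOp k loweringᴴ), ancOp_mul, ← Matrix.mul_assoc, ancOp_mul]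
      exact ancOp_mul_vac_eq_zero ccrDefect_raise_raise_apply_zero
    · rw [cr, cr, ancOp_commute_assoc h', ancOp_commute_assoc (h ▸ h')]
      change cr j * (ancOp k ccrDefect * (cr i * vac n)) = 0
      rw [ccrDefect_mul_cr, Matrix.mul_zero]
  · rw [cr, ancOp_commute_assoc h, ccrDefect_mul_cr, Matrix.mul_zero]

lemma lw_mul_cr (k i : Fin n) (M : Matrix (Anc n) (Anc n) ℂ) :
    lw k * (cr i * M) = cr i * (lw k * M) + if k = i then M - ancOp k ccrDefect * M else 0 := by
  by_cases h : k = i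
  · subst h
    rw [if_pos rfl, lw, cr, ← Matrix.mul_assoc, ancOp_mul, lowering_ccr]
    have h1 : ancOp k (loweringᴴ * lowering + 1 - ccrDefect)
        = ancOp k (loweringᴴ * lowering) + 1 - ancOp k ccrDefect := by
      change ancHom k _ = ancHom k _ + _ - ancHom k _
      rw [map_sub, map_add, map_one]
    rw [h1, ← ancOp_mul, Matrix.sub_mul, Matrix.add_mul, Matrix.one_mul, Matrix.mul_assoc]
    abel
  · rw [if_neg h, add_zero, lw, cr, ancOp_commute_assoc h]

lemma lw_cr_vac (k i : Fin n) : lw k * (cr i * vac n) = if k = i then vac n else 0 := by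
  rw [lw_mul_cr, lw_mul_vac, Matrix.mul_zero, zero_add, ccrDefect_mul_vac, sub_zero]

lemma lw_cr_cr_vac (k i j : Fin n) : lw k * (cr i * (cr j * vac n))
    = (if k = j then cr i * vac n else 0) + if k = i then cr j * vac n else 0 := by
  rw [lw_mul_cr, lw_cr_vac, ccrDefect_mul_cr, sub_zero, mul_ite, Matrix.mul_zero]

/-- Wick's rule for three excitations, where `ccrDefect` does not contribute yet. -/
lemma lw_cr_cr_cr_vac (k i j l : Fin n) : lw k * (cr i * (cr j * (cr l * vac n)))
    = (if k = l then cr i * (cr j * vac n) else 0) + (if k = j then cr i * (cr l * vac n) else 0)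
      + if k = i then cr j * (cr l * vac n) else 0 := by
  rw [lw_mul_cr, lw_cr_cr_vac, ccrDefect_mul_cr_cr, sub_zero, mul_add, mul_ite, mul_ite,
    Matrix.mul_zero]

lemma dx_mul_cr (k i : Fin n) (M : Matrix (Anc n) (Anc n) ℂ) :
    dx k * (cr i * M) = if k = i then 0 else cr i * (dx k * M) := by
  by_cases h : k = i
  · subst h
    rw [if_pos rfl, dx, cr, ← Matrix.mul_assoc, ancOp_mul, toFour_conj_mul_raise]
    change ancHom k 0 * M = 0
    rw [map_zero, Matrix.zero_mul]
  · rw [if_neg h, dx, cr, ancOp_commute_assoc h]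

lemma dx_cr_vac (k i : Fin n) : dx k * (cr i * vac n) = 0 := by
  rw [dx_mul_cr, dx_mul_vac, Matrix.mul_zero, ite_self]

lemma dx_cr_cr_vac (k i j : Fin n) : dx k * (cr i * (cr j * vac n)) = 0 := by
  rw [dx_mul_cr, dx_cr_vac, Matrix.mul_zero, ite_self]

lemma dx_cr_cr_cr_vac (k i j l : Fin n) : dx k * (cr i * (cr j * (cr l * vac n))) = 0 := by
  rw [dx_mul_cr, dx_cr_cr_vac, Matrix.mul_zero, ite_self]

lemma dx_ex_vac (k i : Fin n) : dx k * (ex i * vac n) = if k = i then vac n else 0 := by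
  by_cases h : k = i
  · subst h
    rw [if_pos rfl, ← sub_eq_zero, dx, ex, ← Matrix.mul_assoc, ancOp_mul]
    have h1 : ancOp k (toFourᴴ * toFour) * vac n - vac n
        = ancOp k (toFourᴴ * toFour - 1) * vac n := by
      change ancHom k _ * _ - _ = ancHom k _ * _
      rw [map_sub, map_one, Matrix.sub_mul, Matrix.one_mul]
    rw [h1]
    exact ancOp_mul_vac_eq_zero toFour_conj_mul_toFour_sub_one_apply_zero
  · rw [if_neg h, dx, ex, ancOp_commute_assoc h]
    change ancOp i toFour * (dx k * vac n) = 0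
    rw [dx_mul_vac, Matrix.mul_zero]

lemma lw_ex_vac (k i : Fin n) : lw k * (ex i * vac n) = 0 := by
  by_cases h : k = i
  · subst h
    rw [lw, ex, ← Matrix.mul_assoc, ancOp_mul, lowering_mul_toFour]
    change ancHom k 0 * _ = 0
    rw [map_zero, Matrix.zero_mul]
  · rw [lw, ex, ancOp_commute_assoc h]
    change ancOp i toFour * (lw k * vac n) = 0
    rw [lw_mul_vac, Matrix.mul_zero]

/-! Row versions of the relations above, obtained by taking adjoints. -/

lemma vac_mul_cr (k : Fin n) : vac n * cr k = 0 := by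
  have h := congrArg Matrix.conjTranspose (lw_mul_vac k)
  simpa [Matrix.conjTranspose_mul, vac_conjTranspose, lw_conjTranspose] using h

lemma vac_mul_ex (k : Fin n) : vac n * ex k = 0 := by
  have h := congrArg Matrix.conjTranspose (dx_mul_vac k)
  simpa [Matrix.conjTranspose_mul, vac_conjTranspose, dx_conjTranspose] using h

lemma vac_lw_cr (i k : Fin n) : vac n * lw i * cr k = if k = i then vac n else 0 := by
  have h := congrArg Matrix.conjTranspose (lw_cr_vac k i)
  simpa [Matrix.conjTranspose_mul, vac_conjTranspose, lw_conjTranspose, cr_conjTranspose,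
    apply_ite Matrix.conjTranspose] using h

lemma vac_lw_lw_cr (i j k : Fin n) : vac n * lw i * lw j * cr k
    = (if k = i then vac n * lw j else 0) + if k = j then vac n * lw i else 0 := by
  have h := congrArg Matrix.conjTranspose (lw_cr_cr_vac k j i)
  simpa [Matrix.conjTranspose_mul, vac_conjTranspose, lw_conjTranspose, cr_conjTranspose,
    apply_ite Matrix.conjTranspose] using h

lemma vac_lw_ex (i k : Fin n) : vac n * lw i * ex k = 0 := by
  have h := congrArg Matrix.conjTranspose (dx_cr_vac k i)
  simpa [Matrix.conjTranspose_mul, vac_conjTranspose, cr_conjTranspose, dx_conjTranspose] using h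

lemma vac_lw_lw_ex (i j k : Fin n) : vac n * lw i * lw j * ex k = 0 := by
  have h := congrArg Matrix.conjTranspose (dx_cr_cr_vac k j i)
  simpa [Matrix.conjTranspose_mul, vac_conjTranspose, cr_conjTranspose, dx_conjTranspose] using h

lemma trace_vac : (vac n).trace = 1 := by
  rw [vac, Matrix.trace_single_eq_same]

end Ladder


/-! ### Amplitudes of ancilla excitations -/

section Amplitudes

variable {n : ℕ}

/-- `X ⊗ 1`. -/
abbrev sysOp (X : SysOp n) : JointOp n := X ⊗ₖ (1 : Matrix (Anc n) (Anc n) ℂ)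

/-- `∑ i, T i ⊗ a_i†`: the operator `T i` is applied while the ancilla of bond `i` is excited. -/
def emit (T : Fin n → SysOp n) : JointOp n := ∑ i, T i ⊗ₖ cr i

/-- The adjoint of `emit T`. -/
def absorb (T : Fin n → SysOp n) : JointOp n := ∑ i, (T i)ᴴ ⊗ₖ lw i

/-- `∑ i, T i ⊗ |4⟩⟨0|_i`. -/
def emitFour (T : Fin n → SysOp n) : JointOp n := ∑ i, T i ⊗ₖ ex i

/-- The adjoint of `emitFour T`. -/
def absorbFour (T : Fin n → SysOp n) : JointOp n := ∑ i, (T i)ᴴ ⊗ₖ dx i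

/-- The operator `Tr_E ((1 ⊗ o) M)`. If `o = |Vac⟩⟨a|` and the range of `M` is extended from
`|Vac⟩`, this is the amplitude of `M` for the ancilla state `a`. -/
def amp (o : Matrix (Anc n) (Anc n) ℂ) : JointOp n →ₗ[ℂ] SysOp n :=
  traceAnc n ∘ₗ LinearMap.mulLeft ℂ ((1 : SysOp n) ⊗ₖ o)

lemma amp_apply (o : Matrix (Anc n) (Anc n) ℂ) (M : JointOp n) :
    amp o M = traceAnc n (((1 : SysOp n) ⊗ₖ o) * M) := rfl

lemma amp_zero_left (M : JointOp n) : amp (0 : Matrix (Anc n) (Anc n) ℂ) M = 0 := by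
  rw [amp_apply, Matrix.kronecker_zero, Matrix.zero_mul, map_zero]

lemma amp_add_left (o o' : Matrix (Anc n) (Anc n) ℂ) (M : JointOp n) :
    amp (o + o') M = amp o M + amp o' M := by
  rw [amp_apply, Matrix.kronecker_add, Matrix.add_mul, map_add]
  rfl

lemma amp_kronecker_mul (o p : Matrix (Anc n) (Anc n) ℂ) (X : SysOp n) (M : JointOp n) :
    amp o ((X ⊗ₖ p) * M) = X * amp (o * p) M := by
  rw [amp_apply, amp_apply, ← traceAnc_kronecker_one_mul, ← Matrix.mul_assoc, ← Matrix.mul_assoc,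
    ← Matrix.mul_kronecker_mul, ← Matrix.mul_kronecker_mul, Matrix.one_mul, Matrix.one_mul,
    Matrix.mul_one]

lemma amp_kronecker (o p : Matrix (Anc n) (Anc n) ℂ) (X : SysOp n) :
    amp o (X ⊗ₖ p) = (o * p).trace • X := by
  rw [amp_apply, ← Matrix.mul_kronecker_mul, Matrix.one_mul, traceAnc_kronecker]

lemma amp_sysOp_mul (o : Matrix (Anc n) (Anc n) ℂ) (X : SysOp n) (M : JointOp n) :
    amp o (sysOp X * M) = X * amp o M := by
  rw [amp_kronecker_mul, Matrix.mul_one]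

lemma amp_emit_mul (o : Matrix (Anc n) (Anc n) ℂ) (T : Fin n → SysOp n) (M : JointOp n) :
    amp o (emit T * M) = ∑ i, T i * amp (o * cr i) M := by
  simp only [emit, Finset.sum_mul, map_sum, amp_kronecker_mul]

lemma amp_absorb_mul (o : Matrix (Anc n) (Anc n) ℂ) (T : Fin n → SysOp n) (M : JointOp n) :
    amp o (absorb T * M) = ∑ i, (T i)ᴴ * amp (o * lw i) M := by
  simp only [absorb, Finset.sum_mul, map_sum, amp_kronecker_mul]

lemma amp_emitFour_mul (o : Matrix (Anc n) (Anc n) ℂ) (T : Fin n → SysOp n) (M : JointOp n) :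
    amp o (emitFour T * M) = ∑ i, T i * amp (o * ex i) M := by
  simp only [emitFour, Finset.sum_mul, map_sum, amp_kronecker_mul]

lemma amp_absorbFour_mul (o : Matrix (Anc n) (Anc n) ℂ) (T : Fin n → SysOp n) (M : JointOp n) :
    amp o (absorbFour T * M) = ∑ i, (T i)ᴴ * amp (o * dx i) M := by
  simp only [absorbFour, Finset.sum_mul, map_sum, amp_kronecker_mul]

/-- The amplitude for no excitation. -/
abbrev amp0 (M : JointOp n) : SysOp n := amp (vac n) M

/-- The amplitude for one excitation, at bond `i`. -/
abbrev amp1 (i : Fin n) (M : JointOp n) : SysOp n := amp (vac n * lw i) M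

/-- The amplitude for two excitations, at the bonds `i` and `j`. -/
abbrev amp2 (i j : Fin n) (M : JointOp n) : SysOp n := amp (vac n * lw i * lw j) M

/-- The amplitude for three excitations, at the bonds `i`, `j` and `k`. -/
abbrev amp3 (i j k : Fin n) (M : JointOp n) : SysOp n := amp (vac n * lw i * lw j * lw k) M

/-- The amplitude for level `4` at bond `i`. -/
abbrev amp4 (i : Fin n) (M : JointOp n) : SysOp n := amp (vac n * dx i) M

lemma amp0_emit (T : Fin n → SysOp n) (M : JointOp n) : amp0 (emit T * M) = 0 := by
  simp only [amp_emit_mul, vac_mul_cr, amp_zero_left, mul_zero, Finset.sum_const_zero]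

lemma amp0_emitFour (T : Fin n → SysOp n) (M : JointOp n) : amp0 (emitFour T * M) = 0 := by
  simp only [amp_emitFour_mul, vac_mul_ex, amp_zero_left, mul_zero, Finset.sum_const_zero]

lemma amp1_emitFour (i : Fin n) (T : Fin n → SysOp n) (M : JointOp n) :
    amp1 i (emitFour T * M) = 0 := by
  simp only [amp_emitFour_mul, vac_lw_ex, amp_zero_left, mul_zero, Finset.sum_const_zero]

lemma amp2_emitFour (i j : Fin n) (T : Fin n → SysOp n) (M : JointOp n) :
    amp2 i j (emitFour T * M) = 0 := by
  simp only [amp_emitFour_mul, vac_lw_lw_ex, amp_zero_left, mul_zero, Finset.sum_const_zero]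

lemma amp1_emit (i : Fin n) (T : Fin n → SysOp n) (M : JointOp n) :
    amp1 i (emit T * M) = T i * amp0 M := by
  rw [amp1, amp_emit_mul, Finset.sum_eq_single i]
  · rw [vac_lw_cr, if_pos rfl]
  · intro k _ hk
    rw [vac_lw_cr, if_neg hk, amp_zero_left, mul_zero]
  · simp

lemma amp2_emit (i j : Fin n) (T : Fin n → SysOp n) (M : JointOp n) :
    amp2 i j (emit T * M) = T i * amp1 j M + T j * amp1 i M := by
  have h : ∀ k, T k * amp (vac n * lw i * lw j * cr k) M
      = (if k = i then T k * amp1 j M else 0) + if k = j then T k * amp1 i M else 0 := by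
    intro k
    rw [vac_lw_lw_cr, amp_add_left, mul_add]
    split_ifs <;> simp [amp_zero_left]
  rw [amp2, amp_emit_mul]
  simp only [h, Finset.sum_add_distrib, Finset.sum_ite_eq', Finset.mem_univ, if_true]

lemma amp0_absorb (T : Fin n → SysOp n) (M : JointOp n) :
    amp0 (absorb T * M) = ∑ i, (T i)ᴴ * amp1 i M := amp_absorb_mul _ _ _

lemma amp1_absorb (i : Fin n) (T : Fin n → SysOp n) (M : JointOp n) :
    amp1 i (absorb T * M) = ∑ j, (T j)ᴴ * amp2 i j M := amp_absorb_mul _ _ _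

lemma amp2_absorb (i j : Fin n) (T : Fin n → SysOp n) (M : JointOp n) :
    amp2 i j (absorb T * M) = ∑ k, (T k)ᴴ * amp3 i j k M := amp_absorb_mul _ _ _

lemma amp0_absorbFour (T : Fin n → SysOp n) (M : JointOp n) :
    amp0 (absorbFour T * M) = ∑ i, (T i)ᴴ * amp4 i M := amp_absorbFour_mul _ _ _

/-- The vector without excitations and with amplitude `X`. -/
def sector0 (X : SysOp n) : JointOp n := X ⊗ₖ vac n

/-- The vector with one excitation and amplitudes `T i`. -/
def sector1 (T : Fin n → SysOp n) : JointOp n := ∑ i, T i ⊗ₖ (cr i * vac n)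

/-- The vector `∑ i j, T i j ⊗ a_i† a_j† |Vac⟩`. -/
def sector2 (T : Fin n → Fin n → SysOp n) : JointOp n :=
  ∑ i, ∑ j, T i j ⊗ₖ (cr i * (cr j * vac n))

/-- The vector `∑ i j k, T i j k ⊗ a_i† a_j† a_k† |Vac⟩`. -/
def sector3 (T : Fin n → Fin n → Fin n → SysOp n) : JointOp n :=
  ∑ i, ∑ j, ∑ k, T i j k ⊗ₖ (cr i * (cr j * (cr k * vac n)))

/-- The vector with level `4` at one bond and amplitudes `T i`. -/
def sector4 (T : Fin n → SysOp n) : JointOp n := ∑ i, T i ⊗ₖ (ex i * vac n)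

lemma sysOp_sector0 (X Y : SysOp n) : sysOp X * sector0 Y = sector0 (X * Y) := by
  rw [sector0, sector0, ← Matrix.mul_kronecker_mul, Matrix.one_mul]

lemma sysOp_sector1 (X : SysOp n) (T : Fin n → SysOp n) :
    sysOp X * sector1 T = sector1 fun i => X * T i := by
  simp only [sector1, Finset.mul_sum, ← Matrix.mul_kronecker_mul, Matrix.one_mul]

lemma emit_sector0 (T : Fin n → SysOp n) (X : SysOp n) :
    emit T * sector0 X = sector1 fun i => T i * X := by
  simp only [emit, sector0, sector1, Finset.sum_mul, ← Matrix.mul_kronecker_mul]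

lemma emit_sector1 (T U : Fin n → SysOp n) :
    emit T * sector1 U = sector2 fun i j => T i * U j := by
  simp only [emit, sector1, sector2, Finset.sum_mul, Finset.mul_sum, ← Matrix.mul_kronecker_mul]
  exact Finset.sum_comm

lemma emit_sector2 (T : Fin n → SysOp n) (U : Fin n → Fin n → SysOp n) :
    emit T * sector2 U = sector3 fun i j k => T i * U j k := by
  rw [emit, sector3, Finset.sum_mul]
  refine Finset.sum_congr rfl fun i _ => ?_
  simp only [sector2, Finset.mul_sum, ← Matrix.mul_kronecker_mul]

lemma emitFour_sector0 (T : Fin n → SysOp n) (X : SysOp n) :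
    emitFour T * sector0 X = sector4 fun i => T i * X := by
  simp only [emitFour, sector0, sector4, Finset.sum_mul, ← Matrix.mul_kronecker_mul]

lemma absorb_sector0 (T : Fin n → SysOp n) (X : SysOp n) : absorb T * sector0 X = 0 := by
  simp only [absorb, sector0, Finset.sum_mul, ← Matrix.mul_kronecker_mul, lw_mul_vac,
    Matrix.kronecker_zero, Finset.sum_const_zero]

lemma absorb_sector1 (T U : Fin n → SysOp n) :
    absorb T * sector1 U = sector0 (∑ i, (T i)ᴴ * U i) := by
  have h : ∀ i k, ((T k)ᴴ * U i) ⊗ₖ (lw k * (cr i * vac n))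
      = if k = i then ((T k)ᴴ * U i) ⊗ₖ vac n else 0 := by
    intro i k
    rw [lw_cr_vac]
    split_ifs <;> simp
  have hs : ∀ s : Finset (Fin n), ∑ i ∈ s, ((T i)ᴴ * U i) ⊗ₖ vac n
      = (∑ i ∈ s, (T i)ᴴ * U i) ⊗ₖ vac n := fun s =>
    (map_sum (adjoinVac n) (fun i => (T i)ᴴ * U i) s).symm
  simp only [absorb, sector0, sector1, Finset.sum_mul, Finset.mul_sum, ← Matrix.mul_kronecker_mul,
    h, Finset.sum_ite_eq', Finset.mem_univ, if_true, hs]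

lemma absorb_sector2 (T : Fin n → SysOp n) (U : Fin n → Fin n → SysOp n) :
    absorb T * sector2 U = sector1 fun i => ∑ j, (T j)ᴴ * (U i j + U j i) := by
  have h : ∀ i j k, ((T k)ᴴ * U i j) ⊗ₖ (lw k * (cr i * (cr j * vac n)))
      = (if k = j then ((T k)ᴴ * U i j) ⊗ₖ (cr i * vac n) else 0)
        + if k = i then ((T k)ᴴ * U i j) ⊗ₖ (cr j * vac n) else 0 := by
    intro i j k
    rw [lw_cr_cr_vac, Matrix.kronecker_add]
    split_ifs <;> simp
  have hs : ∀ (f : Fin n → SysOp n) (o : Matrix (Anc n) (Anc n) ℂ),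
      (∑ i, f i) ⊗ₖ o = ∑ i, f i ⊗ₖ o := fun f o =>
    map_sum (⟨⟨fun X => X ⊗ₖ o, Matrix.zero_kronecker o⟩, fun X Y => Matrix.add_kronecker X Y o⟩ :
      SysOp n →+ JointOp n) f Finset.univ
  simp only [absorb, sector2, sector1, Finset.sum_mul, Finset.mul_sum, ← Matrix.mul_kronecker_mul,
    h, hs, mul_add, Matrix.add_kronecker, Finset.sum_add_distrib]
  congr 1
  · simp only [Finset.sum_ite_eq', Finset.mem_univ, if_true]
  · simp only [Finset.sum_ite_eq', Finset.mem_univ, if_true]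
    exact Finset.sum_comm

lemma absorbFour_sector0 (T : Fin n → SysOp n) (X : SysOp n) : absorbFour T * sector0 X = 0 := by
  simp only [absorbFour, sector0, Finset.sum_mul, ← Matrix.mul_kronecker_mul, dx_mul_vac,
    Matrix.kronecker_zero, Finset.sum_const_zero]

lemma absorbFour_sector1 (T U : Fin n → SysOp n) : absorbFour T * sector1 U = 0 := by
  simp only [absorbFour, sector1, Finset.sum_mul, Finset.mul_sum, ← Matrix.mul_kronecker_mul,
    dx_cr_vac, Matrix.kronecker_zero, Finset.sum_const_zero]

lemma absorbFour_sector2 (T : Fin n → SysOp n) (U : Fin n → Fin n → SysOp n) :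
    absorbFour T * sector2 U = 0 := by
  simp only [absorbFour, sector2, Finset.sum_mul, Finset.mul_sum, ← Matrix.mul_kronecker_mul,
    dx_cr_cr_vac, Matrix.kronecker_zero, Finset.sum_const_zero]

lemma amp0_sector0 (X : SysOp n) : amp0 (sector0 X) = X := by
  rw [amp0, sector0, amp_kronecker, vac_mul_vac, trace_vac, one_smul]

lemma amp0_sector2 (T : Fin n → Fin n → SysOp n) : amp0 (sector2 T) = 0 := by
  simp only [sector2, map_sum, amp_kronecker, ← Matrix.mul_assoc, vac_mul_cr, Matrix.zero_mul,
    Matrix.trace_zero, zero_smul, Finset.sum_const_zero]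

lemma amp1_sector1 (i : Fin n) (T : Fin n → SysOp n) : amp1 i (sector1 T) = T i := by
  have h : ∀ k, (vac n * lw i * (cr k * vac n)).trace • T k = if i = k then T k else 0 := by
    intro k
    rw [Matrix.mul_assoc, lw_cr_vac]
    split_ifs <;> simp [vac_mul_vac, trace_vac]
  simp only [sector1, map_sum, amp_kronecker, h, Finset.sum_ite_eq, Finset.mem_univ, if_true]

lemma amp1_sector3 (i : Fin n) (T : Fin n → Fin n → Fin n → SysOp n) :
    amp1 i (sector3 T) = 0 := by
  have h : ∀ k l m, (vac n * lw i * (cr k * (cr l * (cr m * vac n)))).trace = 0 := by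
    intro k l m
    rw [← Matrix.mul_assoc, vac_lw_cr]
    split_ifs <;> simp [← Matrix.mul_assoc, vac_mul_cr]
  simp only [sector3, map_sum, amp_kronecker, h, zero_smul, Finset.sum_const_zero]

lemma amp1_sector4 (i : Fin n) (T : Fin n → SysOp n) : amp1 i (sector4 T) = 0 := by
  simp only [sector4, map_sum, amp_kronecker, ← Matrix.mul_assoc, vac_lw_ex, Matrix.zero_mul,
    Matrix.trace_zero, zero_smul, Finset.sum_const_zero]

lemma amp2_sector0 (i j : Fin n) (X : SysOp n) : amp2 i j (sector0 X) = 0 := by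
  rw [amp2, sector0, amp_kronecker, Matrix.mul_assoc, lw_mul_vac, Matrix.mul_zero,
    Matrix.trace_zero, zero_smul]

lemma trace_vac_lw_cr_vac (i k : Fin n) :
    (vac n * (lw i * (cr k * vac n))).trace = if i = k then 1 else 0 := by
  rw [lw_cr_vac]
  split_ifs <;> simp [vac_mul_vac, trace_vac]

lemma amp2_sector2 (i j : Fin n) (T : Fin n → Fin n → SysOp n) :
    amp2 i j (sector2 T) = T i j + T j i := by
  have h : ∀ k l, (vac n * lw i * lw j * (cr k * (cr l * vac n))).trace • T k l
      = (if j = l then (if i = k then T k l else 0) else 0)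
        + if j = k then (if i = l then T k l else 0) else 0 := by
    intro k l
    simp only [Matrix.mul_assoc, lw_cr_cr_vac, mul_add, Matrix.trace_add, add_smul]
    congr 1 <;> split_ifs <;> simp_all [trace_vac_lw_cr_vac]
  simp only [sector2, map_sum, amp_kronecker, h, Finset.sum_add_distrib]
  congr 1
  · simp
  · rw [Finset.sum_comm]
    simp

lemma amp3_sector1 (i j k : Fin n) (T : Fin n → SysOp n) : amp3 i j k (sector1 T) = 0 := by
  have h : ∀ l, (vac n * lw i * lw j * lw k * (cr l * vac n)).trace = 0 := by
    intro l
    rw [Matrix.mul_assoc, lw_cr_vac]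
    split_ifs <;> simp [Matrix.mul_assoc, lw_mul_vac]
  simp only [sector1, map_sum, amp_kronecker, h, zero_smul, Finset.sum_const_zero]

lemma trace_vac_lw_lw_cr_cr_vac (i j k l : Fin n) :
    (vac n * (lw i * (lw j * (cr k * (cr l * vac n))))).trace
      = (if j = l then (if i = k then 1 else 0) else 0)
        + if j = k then (if i = l then 1 else 0) else 0 := by
  simp only [lw_cr_cr_vac, mul_add, Matrix.trace_add]
  congr 1 <;> split_ifs <;> simp_all [trace_vac_lw_cr_vac]

lemma amp3_sector3 (i j k : Fin n) (T : Fin n → Fin n → Fin n → SysOp n) :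
    amp3 i j k (sector3 T)
      = T i j k + T j i k + T i k j + T j k i + T k i j + T k j i := by
  have h : ∀ a b c, (vac n * lw i * lw j * lw k * (cr a * (cr b * (cr c * vac n)))).trace • T a b c
      = (if k = c then (if j = b then (if i = a then T a b c else 0) else 0) else 0)
        + (if k = c then (if j = a then (if i = b then T a b c else 0) else 0) else 0)
        + (if k = b then (if j = c then (if i = a then T a b c else 0) else 0) else 0)
        + (if k = b then (if j = a then (if i = c then T a b c else 0) else 0) else 0)
        + (if k = a then (if j = c then (if i = b then T a b c else 0) else 0) else 0)
        + (if k = a then (if j = b then (if i = c then T a b c else 0) else 0) else 0) := by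
    intro a b c
    have h1 : ∀ (p : Prop) [Decidable p] (M : Matrix (Anc n) (Anc n) ℂ),
        (vac n * (lw i * (lw j * (if p then M else 0)))).trace
          = if p then (vac n * (lw i * (lw j * M))).trace else 0 := by
      intro p _ M
      split_ifs <;> simp
    have h2 : ∀ (p : Prop) [Decidable p] (z : ℂ) (X : SysOp n),
        (if p then z else 0) • X = if p then z • X else 0 := by
      intro p _ z X
      split_ifs <;> simp
    have h3 : ∀ (p : Prop) [Decidable p] (X Y : SysOp n),
        (if p then X + Y else 0) = (if p then X else 0) + if p then Y else 0 := by
      intro p _ X Y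
      split_ifs <;> simp
    simp only [Matrix.mul_assoc, lw_cr_cr_cr_vac, mul_add, Matrix.trace_add, h1,
      trace_vac_lw_lw_cr_cr_vac, add_smul, h2, h3, one_smul]
    abel
  simp only [sector3, map_sum, amp_kronecker, h, Finset.sum_add_distrib]
  simp only [Finset.sum_ite_eq, Finset.mem_univ, if_true, Finset.sum_ite_irrel,
    Finset.sum_const_zero]

lemma amp3_sector4 (i j k : Fin n) (T : Fin n → SysOp n) : amp3 i j k (sector4 T) = 0 := by
  simp only [sector4, map_sum, amp_kronecker, Matrix.mul_assoc, lw_ex_vac, Matrix.mul_zero,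
    Matrix.trace_zero, zero_smul, Finset.sum_const_zero]

lemma amp4_sector1 (i : Fin n) (T : Fin n → SysOp n) : amp4 i (sector1 T) = 0 := by
  simp only [sector1, map_sum, amp_kronecker, Matrix.mul_assoc, dx_cr_vac, Matrix.mul_zero,
    Matrix.trace_zero, zero_smul, Finset.sum_const_zero]

lemma amp4_sector3 (i : Fin n) (T : Fin n → Fin n → Fin n → SysOp n) :
    amp4 i (sector3 T) = 0 := by
  simp only [sector3, map_sum, amp_kronecker, Matrix.mul_assoc, dx_cr_cr_cr_vac, Matrix.mul_zero,
    Matrix.trace_zero, zero_smul, Finset.sum_const_zero]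

lemma amp4_sector4 (i : Fin n) (T : Fin n → SysOp n) : amp4 i (sector4 T) = T i := by
  have h : ∀ k, (vac n * dx i * (ex k * vac n)).trace • T k = if i = k then T k else 0 := by
    intro k
    rw [Matrix.mul_assoc, dx_ex_vac]
    split_ifs <;> simp [vac_mul_vac, trace_vac]
  simp only [sector4, map_sum, amp_kronecker, h, Finset.sum_ite_eq, Finset.mem_univ, if_true]

/-- `sandwich u w†` in terms of the amplitudes of `u`, if `w |Vac⟩` is known. -/
lemma sandwich_conjTranspose_eq (u w : JointOp n) (ρ : SysOp n) :
    sandwich u wᴴ ρ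
      = traceAnc n (u * sector0 1 * sysOp ρ * (w * sector0 1)ᴴ) := by
  have h : (sector0 1 : JointOp n) * sysOp ρ * (sector0 1)ᴴ = ρ ⊗ₖ vac n := by
    rw [sector0, Matrix.conjTranspose_kronecker, Matrix.conjTranspose_one, vac_conjTranspose,
      ← Matrix.mul_kronecker_mul, ← Matrix.mul_kronecker_mul, Matrix.mul_one, Matrix.mul_one,
      Matrix.one_mul, vac_mul_vac]
  rw [sandwich_apply, Matrix.conjTranspose_mul, ← h]
  simp only [Matrix.mul_assoc]

lemma traceAnc_mul_kronecker_conjTranspose (M : JointOp n) (ρ X : SysOp n)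
    (p : Matrix (Anc n) (Anc n) ℂ) :
    traceAnc n (M * sysOp ρ * (X ⊗ₖ p)ᴴ) = amp pᴴ M * ρ * Xᴴ := by
  have h : sysOp ρ * (X ⊗ₖ p)ᴴ = ((1 : SysOp n) ⊗ₖ pᴴ) * (sysOp ρ * sysOp Xᴴ) := by
    rw [Matrix.conjTranspose_kronecker, ← Matrix.mul_kronecker_mul, ← Matrix.mul_kronecker_mul,
      ← Matrix.mul_kronecker_mul]
    simp
  rw [Matrix.mul_assoc, h, ← Matrix.mul_assoc, ← Matrix.mul_assoc, traceAnc_mul_kronecker_one,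
    traceAnc_mul_kronecker_one, ← traceAnc_one_kronecker_mul, amp_apply]

lemma traceAnc_sector0 (M : JointOp n) (ρ X : SysOp n) :
    traceAnc n (M * sysOp ρ * (sector0 X)ᴴ) = amp0 M * ρ * Xᴴ := by
  rw [sector0, traceAnc_mul_kronecker_conjTranspose, vac_conjTranspose]

lemma traceAnc_sector1 (M : JointOp n) (ρ : SysOp n) (T : Fin n → SysOp n) :
    traceAnc n (M * sysOp ρ * (sector1 T)ᴴ) = ∑ i, amp1 i M * ρ * (T i)ᴴ := by
  simp only [sector1, Matrix.conjTranspose_sum, Finset.mul_sum, map_sum,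
    traceAnc_mul_kronecker_conjTranspose, Matrix.conjTranspose_mul, vac_conjTranspose,
    cr_conjTranspose]

lemma traceAnc_sector2 (M : JointOp n) (ρ : SysOp n) (T : Fin n → Fin n → SysOp n) :
    traceAnc n (M * sysOp ρ * (sector2 T)ᴴ) = ∑ i, ∑ j, amp2 j i M * ρ * (T i j)ᴴ := by
  simp only [sector2, Matrix.conjTranspose_sum, Finset.mul_sum, map_sum,
    traceAnc_mul_kronecker_conjTranspose, Matrix.conjTranspose_mul, vac_conjTranspose,
    cr_conjTranspose]

lemma traceAnc_sector3 (M : JointOp n) (ρ : SysOp n) (T : Fin n → Fin n → Fin n → SysOp n) :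
    traceAnc n (M * sysOp ρ * (sector3 T)ᴴ)
      = ∑ i, ∑ j, ∑ k, amp3 k j i M * ρ * (T i j k)ᴴ := by
  simp only [sector3, Matrix.conjTranspose_sum, Finset.mul_sum, map_sum,
    traceAnc_mul_kronecker_conjTranspose, Matrix.conjTranspose_mul, vac_conjTranspose,
    cr_conjTranspose]

lemma traceAnc_sector4 (M : JointOp n) (ρ : SysOp n) (T : Fin n → SysOp n) :
    traceAnc n (M * sysOp ρ * (sector4 T)ᴴ) = ∑ i, amp4 i M * ρ * (T i)ᴴ := by
  simp only [sector4, Matrix.conjTranspose_sum, Finset.mul_sum, map_sum,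
    traceAnc_mul_kronecker_conjTranspose, Matrix.conjTranspose_mul, vac_conjTranspose,
    ex_conjTranspose]

end Amplitudes


/-! ### The corrected generator -/

section Generator

variable {n : ℕ}

/-- `∑ i, J i† J i`. -/
def numOp (J : Fin n → SysOp n) : SysOp n := ∑ i, (J i)ᴴ * J i

/-- `[J i†, J i]`. -/
def selfComm (J : Fin n → SysOp n) (i : Fin n) : SysOp n := (J i)ᴴ * J i - J i * (J i)ᴴ

/-- `X ↦ ∑ i, J i† X J i`. -/
def jumpDual (J : Fin n → SysOp n) : SysOp n →ₗ[ℂ] SysOp n :=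
  ∑ i, LinearMap.mulLeftRight ℂ ((J i)ᴴ, J i)

/-- The dissipator in the Heisenberg picture. -/
def heisenberg (J : Fin n → SysOp n) : SysOp n →ₗ[ℂ] SysOp n :=
  jumpDual J - (1 / 2 : ℂ) • (LinearMap.mulLeft ℂ (numOp J) + LinearMap.mulRight ℂ (numOp J))

/-- The correction of order `3` to the emission amplitude. For commuting jumps it equals
`[N, J i] / 12` with `N = numOp J`, and it symmetrizes the amplitude of one excitation at order `3`; see
`JumpsCommute.expVec_three`. -/
def emit3 (J : Fin n → SysOp n) (i : Fin n) : SysOp n := (1 / 12 : ℂ) • (selfComm J i * J i)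

/-- The amplitude of the transition to level `4`, up to the factor `1 / √12`; here `K = -i H`. For
commuting jumps it equals `[A, J i]` with `A = K - N / 2`. -/
def emitW (K : SysOp n) (J : Fin n → SysOp n) (i : Fin n) : SysOp n :=
  (K * J i - J i * K) - (1 / 2 : ℂ) • (selfComm J i * J i)

/-- The amplitude of the transition to level `4`. -/
def scaledW (K : SysOp n) (J : Fin n → SysOp n) (i : Fin n) : SysOp n :=
  ((Real.sqrt 12 : ℂ)⁻¹) • emitW K J i

/-- The correction of order `4` to the Hamiltonian part `K = -i H`, fixed by the vacuum amplitude of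
order `4`. -/
def ham4 (K : SysOp n) (J : Fin n → SysOp n) : SysOp n := (1 / 6 : ℂ) • heisenberg J K

/-- The correction of order `5` to the emission amplitude, fixed by the amplitude of one excitation
at order `5`. Apart from `K`, only operators of bond `i` occur, which shows that the correction is
local; see `JumpsCommute.emit5_eq` for the form in terms of `numOp J`. -/
def emit5 (K : SysOp n) (J : Fin n → SysOp n) (i : Fin n) : SysOp n :=
  (1 / 360 : ℂ) • ((2 : ℂ) • ((J i)ᴴ * selfComm J i * J i * J i
        - J i * ((J i)ᴴ * selfComm J i * J i))
      + ((J i)ᴴ * J i * (selfComm J i * J i) - selfComm J i * J i * ((J i)ᴴ * J i))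
      - (6 : ℂ) • (selfComm J i * (selfComm J i * J i)))
    + (1 / 24 : ℂ) • (selfComm J i * (K * J i - J i * K))

/-- The correction of order `6` to the Hamiltonian part `K = -i H`, fixed by the vacuum amplitude of
order `6`. -/
def ham6 (K : SysOp n) (J : Fin n → SysOp n) : SysOp n :=
  (1 / 90 : ℂ) • (heisenberg J (heisenberg J K)
    + ∑ i, ((K * (J i)ᴴ - (J i)ᴴ * K) * (selfComm J i * J i)
      + (J i)ᴴ * selfComm J i * (J i * K - K * J i)))

/-- The coefficient of `x ^ m` in `-i x² H_dia(x)`. -/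
def genCoeff (K : SysOp n) (J : Fin n → SysOp n) : ℕ → JointOp n
  | 1 => emit J - absorb J
  | 2 => sysOp K
  | 3 => emit (emit3 J) - absorb (emit3 J) + (emitFour (scaledW K J) - absorbFour (scaledW K J))
  | 4 => sysOp (ham4 K J)
  | 5 => emit (emit5 K J) - absorb (emit5 K J)
  | 6 => sysOp (ham6 K J)
  | _ => 0

lemma jumpDual_apply (J : Fin n → SysOp n) (X : SysOp n) :
    jumpDual J X = ∑ i, (J i)ᴴ * X * J i := by
  simp [jumpDual]

lemma heisenberg_apply (J : Fin n → SysOp n) (X : SysOp n) :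
    heisenberg J X = jumpDual J X - (1 / 2 : ℂ) • (numOp J * X + X * numOp J) := by
  simp [heisenberg]

lemma numOp_conjTranspose (J : Fin n → SysOp n) : (numOp J)ᴴ = numOp J := by
  simp [numOp, Matrix.conjTranspose_sum]

lemma selfComm_conjTranspose (J : Fin n → SysOp n) (i : Fin n) :
    (selfComm J i)ᴴ = selfComm J i := by
  simp [selfComm]

lemma jumpDual_conjTranspose (J : Fin n → SysOp n) (X : SysOp n) :
    (jumpDual J X)ᴴ = jumpDual J Xᴴ := by
  simp [jumpDual_apply, Matrix.conjTranspose_sum, Matrix.mul_assoc]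

/-- The jump operators commute with each other and with each other's adjoints. -/
def JumpsCommute (J : Fin n → SysOp n) : Prop :=
  ∀ i j, i ≠ j → Commute (J i) (J j) ∧ Commute (J i) (J j)ᴴ

variable {J : Fin n → SysOp n}

lemma JumpsCommute.mul_comm (hJ : JumpsCommute J) (i j : Fin n) : J i * J j = J j * J i := by
  by_cases h : i = j
  · rw [h]
  · exact (hJ i j h).1

lemma JumpsCommute.conj_mul (hJ : JumpsCommute J) (i j : Fin n) :
    (J j)ᴴ * J i = J i * (J j)ᴴ + if j = i then selfComm J i else 0 := by
  by_cases h : j = i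
  · subst h
    rw [if_pos rfl, selfComm]
    abel
  · rw [if_neg h, add_zero]
    exact ((hJ i j (Ne.symm h)).2).symm

lemma sum_conj_mul_mul (J : Fin n → SysOp n) (X Y : SysOp n) :
    ∑ i, (J i)ᴴ * (X * (J i * Y)) = jumpDual J X * Y := by
  rw [jumpDual_apply, Finset.sum_mul]
  exact Finset.sum_congr rfl fun i _ => by noncomm_ring

lemma jumpDual_one (J : Fin n → SysOp n) : jumpDual J 1 = numOp J := by
  simp [jumpDual_apply, numOp]

/-- `J i` can be pulled out of the sum to the left, and only the term of bond `i` leaves a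
commutator. -/
lemma JumpsCommute.sum_conj_mul (hJ : JumpsCommute J) (i : Fin n) (X Y : SysOp n) :
    ∑ j, (J j)ᴴ * (J i * (X * (J j * Y)))
      = J i * (jumpDual J X * Y) + selfComm J i * (X * (J i * Y)) := by
  have h : ∀ j, (J j)ᴴ * (J i * (X * (J j * Y)))
      = J i * ((J j)ᴴ * (X * (J j * Y))) + if j = i then selfComm J i * (X * (J i * Y)) else 0 := by
    intro j
    rw [← mul_assoc, hJ.conj_mul, add_mul, mul_assoc]
    split_ifs with hij
    · rw [hij]
    · rw [zero_mul]
  simp only [h, Finset.sum_add_distrib, ← Finset.mul_sum, sum_conj_mul_mul, Finset.sum_ite_eq',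
    Finset.mem_univ, if_true]

/-- Only bond `i` contributes to the commutator of `J i` with the global operator `numOp J`; this is
the reason why the corrections are local. -/
lemma JumpsCommute.selfComm_mul (hJ : JumpsCommute J) (i : Fin n) :
    selfComm J i * J i = numOp J * J i - J i * numOp J := by
  have h := hJ.sum_conj_mul i 1 1
  simp only [one_mul, mul_one, jumpDual_one] at h
  rw [eq_sub_iff_add_eq, add_comm, ← h, numOp, Finset.sum_mul]
  exact Finset.sum_congr rfl fun j _ => by rw [hJ.mul_comm i j, mul_assoc]

lemma JumpsCommute.conj_mul_selfComm (hJ : JumpsCommute J) (i : Fin n) :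
    (J i)ᴴ * selfComm J i = (J i)ᴴ * numOp J - numOp J * (J i)ᴴ := by
  have h := congrArg Matrix.conjTranspose (hJ.selfComm_mul i)
  simpa [numOp_conjTranspose, selfComm_conjTranspose] using h

lemma JumpsCommute.sum_conj_mul_selfComm (hJ : JumpsCommute J) (X Y : SysOp n) :
    ∑ i, (J i)ᴴ * (selfComm J i * (X * (J i * Y)))
      = jumpDual J (numOp J * X) * Y - numOp J * (jumpDual J X * Y) := by
  have h : ∀ i, (J i)ᴴ * (selfComm J i * (X * (J i * Y)))
      = (J i)ᴴ * ((numOp J * X) * (J i * Y)) - numOp J * ((J i)ᴴ * (X * (J i * Y))) := by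
    intro i
    rw [← mul_assoc, hJ.conj_mul_selfComm]
    noncomm_ring
  simp only [h, Finset.sum_sub_distrib, sum_conj_mul_mul, ← Finset.mul_sum]

end Generator

/-! ### Amplitudes of the powers of the generator -/

section Powers

variable {n : ℕ} {K : SysOp n} {J : Fin n → SysOp n}

lemma JumpsCommute.commute_selfComm (hJ : JumpsCommute J) {i j : Fin n} (h : j ≠ i) :
    Commute (J j) (selfComm J i) :=
  ((hJ j i h).2.mul_right (hJ j i h).1).sub_right ((hJ j i h).1.mul_right (hJ j i h).2)

lemma JumpsCommute.commute_conj_selfComm (hJ : JumpsCommute J) {i j : Fin n} (h : j ≠ i) :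
    Commute (J j)ᴴ (selfComm J i) := by
  have h1 : Commute (J j)ᴴ (J i) := (hJ i j h.symm).2.symm
  have h2 : Commute (J j)ᴴ (J i)ᴴ := by
    have := (hJ i j h.symm).1
    rw [commute_iff_eq] at this ⊢
    simpa using congrArg Matrix.conjTranspose this
  exact (h2.mul_right h1).sub_right (h1.mul_right h2)

/-- The commutator of a sum with an operator that commutes with all but one term. -/
lemma sum_commutator_eq {T : Fin n → SysOp n} {X : SysOp n} {i : Fin n}
    (h : ∀ j, j ≠ i → Commute (T j) X) :
    (∑ j, T j) * X - X * ∑ j, T j = T i * X - X * T i := by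
  rw [Finset.sum_mul, Finset.mul_sum, ← Finset.sum_sub_distrib, Finset.sum_eq_single i]
  · intro j _ hj
    rw [(h j hj).eq, sub_self]
  · simp

/-- `jumpDual J N - N ^ 2` is a sum of terms of single bonds, so its commutator with `J i` is
local. -/
lemma JumpsCommute.commutator_jumpDual (hJ : JumpsCommute J) (i : Fin n) :
    (J i)ᴴ * selfComm J i * J i * J i - J i * ((J i)ᴴ * selfComm J i * J i)
      = (jumpDual J (numOp J) - numOp J * numOp J) * J i
        - J i * (jumpDual J (numOp J) - numOp J * numOp J) := by
  have h : jumpDual J (numOp J) - numOp J * numOp J = ∑ j, (J j)ᴴ * selfComm J j * J j := by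
    have h1 := hJ.sum_conj_mul_selfComm 1 1
    simp only [mul_one, one_mul, jumpDual_one] at h1
    rw [← h1]
    exact Finset.sum_congr rfl fun j _ => by rw [mul_assoc]
  rw [h, sum_commutator_eq]
  intro j hj
  exact (((hJ i j hj.symm).2.symm).mul_left (hJ.commute_selfComm hj.symm).symm).mul_left
    (hJ j i hj).1

lemma JumpsCommute.commutator_numOp (hJ : JumpsCommute J) (i : Fin n) :
    (J i)ᴴ * J i * (selfComm J i * J i) - selfComm J i * J i * ((J i)ᴴ * J i)
      = numOp J * (selfComm J i * J i) - selfComm J i * J i * numOp J := by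
  rw [numOp, sum_commutator_eq (T := fun j => (J j)ᴴ * J j)]
  intro j hj
  exact ((hJ.commute_conj_selfComm hj).mul_right (hJ i j hj.symm).2.symm).mul_left
    ((hJ.commute_selfComm hj).mul_right (hJ j i hj).1)

/-- The global form of `emit5`, in which sums over the bonds can be evaluated. -/
lemma JumpsCommute.emit5_eq (hJ : JumpsCommute J) (i : Fin n) :
    emit5 K J i = (1 / 360 : ℂ) • ((2 : ℂ) • ((jumpDual J (numOp J) - numOp J * numOp J) * J i
        - J i * (jumpDual J (numOp J) - numOp J * numOp J))
      + (numOp J * (selfComm J i * J i) - selfComm J i * J i * numOp J)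
      - (6 : ℂ) • (selfComm J i * (selfComm J i * J i)))
    + (1 / 24 : ℂ) • (selfComm J i * (K * J i - J i * K)) := by
  rw [emit5, hJ.commutator_jumpDual, hJ.commutator_numOp]

lemma JumpsCommute.selfComm_mul_assoc (hJ : JumpsCommute J) (i : Fin n) (X : SysOp n) :
    selfComm J i * (J i * X) = numOp J * (J i * X) - J i * (numOp J * X) := by
  rw [← mul_assoc, hJ.selfComm_mul, sub_mul, mul_assoc, mul_assoc]

/-- The coefficient of `x ^ p` in the `k`-th power of the generator, applied to `|Vac⟩`. -/
def powVec (K : SysOp n) (J : Fin n → SysOp n) (k p : ℕ) : JointOp n :=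
  powCoeff (genCoeff K J) k p * sector0 1

lemma powVec_zero_zero : powVec K J 0 0 = sector0 1 := by
  rw [powVec, powCoeff, if_pos rfl, one_mul]

lemma powVec_zero_of_ne {p : ℕ} (h : p ≠ 0) : powVec K J 0 p = 0 := by
  rw [powVec, powCoeff, if_neg h, zero_mul]

lemma powVec_of_lt {k p : ℕ} (h : p < k) : powVec K J k p = 0 := by
  rw [powVec, powCoeff_eq_zero rfl h, zero_mul]

lemma powVec_succ (k p : ℕ) : powVec K J (k + 1) p
    = ∑ m ∈ Finset.range (p + 1), genCoeff K J m * powVec K J k (p - m) := by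
  simp only [powVec, powCoeff, Finset.sum_mul, mul_assoc]

lemma powVec_one (p : ℕ) : powVec K J 1 p = genCoeff K J p * sector0 1 := by
  rw [powVec_succ, Finset.sum_eq_single p]
  · rw [Nat.sub_self, powVec_zero_zero]
  · intro m hm hmp
    rw [powVec_zero_of_ne, mul_zero]
    have := Finset.mem_range.1 hm
    omega
  · simp

lemma powVec_one_one : powVec K J 1 1 = sector1 J := by
  simp only [powVec_one, genCoeff, sub_mul, emit_sector0, absorb_sector0, mul_one, sub_zero]

lemma powVec_one_two : powVec K J 1 2 = sector0 K := by
  simp only [powVec_one, genCoeff, sysOp_sector0, mul_one]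

lemma powVec_one_three : powVec K J 1 3 = sector1 (emit3 J) + sector4 (scaledW K J) := by
  simp only [powVec_one, genCoeff, sub_mul, add_mul, emit_sector0, absorb_sector0,
    emitFour_sector0, absorbFour_sector0, mul_one, sub_zero]

lemma powVec_one_four : powVec K J 1 4 = sector0 (ham4 K J) := by
  simp only [powVec_one, genCoeff, sysOp_sector0, mul_one]

lemma powVec_one_five : powVec K J 1 5 = sector1 (emit5 K J) := by
  simp only [powVec_one, genCoeff, sub_mul, emit_sector0, absorb_sector0, mul_one, sub_zero]

lemma powVec_one_six : powVec K J 1 6 = sector0 (ham6 K J) := by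
  simp only [powVec_one, genCoeff, sysOp_sector0, mul_one]

lemma powVec_two_two :
    powVec K J 2 2 = sector2 (fun i j => J i * J j) - sector0 (numOp J) := by
  simp only [powVec_succ 1, Finset.sum_range_succ, Finset.sum_range_zero, powVec_of_lt,
    powVec_one_one, genCoeff, sub_mul, emit_sector1, absorb_sector1, numOp, mul_zero, zero_mul,
    zero_add, add_zero, Nat.sub_self, Nat.zero_lt_one, Nat.reduceSub]

lemma powVec_two_three :
    powVec K J 2 3 = sector1 (fun i => J i * K + K * J i) := by
  simp only [powVec_succ 1, Finset.sum_range_succ, Finset.sum_range_zero, powVec_of_lt,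
    powVec_one_one, powVec_one_two, genCoeff, sub_mul, emit_sector0, absorb_sector0, mul_zero,
    sysOp_sector1, zero_mul, zero_add, add_zero, Nat.sub_self, Nat.zero_lt_one, Nat.reduceSub,
    sub_zero]
  simp only [sector1, Matrix.add_kronecker, Finset.sum_add_distrib]

lemma sector0_sub (X Y : SysOp n) : sector0 (X - Y) = sector0 X - sector0 Y :=
  map_sub (adjoinVac n) X Y

lemma sector1_sub (T U : Fin n → SysOp n) :
    sector1 (fun i => T i - U i) = sector1 T - sector1 U := by
  simp only [sector1, ← Finset.sum_sub_distrib]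
  refine Finset.sum_congr rfl fun i _ => ?_
  ext
  simp [sub_mul]

lemma sector1_add (T U : Fin n → SysOp n) :
    sector1 (fun i => T i + U i) = sector1 T + sector1 U := by
  simp only [sector1, Matrix.add_kronecker, Finset.sum_add_distrib]

lemma JumpsCommute.powVec_three_three (hJ : JumpsCommute J) :
    powVec K J 3 3 = sector3 (fun i j k => J i * (J j * J k))
      - sector1 (fun i => (2 : ℂ) • (numOp J * J i) + J i * numOp J) := by
  have h : (fun i => ∑ j, (J j)ᴴ * (J i * J j + J j * J i))
      = fun i => (2 : ℂ) • (numOp J * J i) := by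
    ext1 i
    have h1 : ∀ j, (J j)ᴴ * (J i * J j + J j * J i) = (2 : ℂ) • ((J j)ᴴ * J j * J i) := by
      intro j
      rw [hJ.mul_comm i j, mul_assoc, two_smul, mul_add]
    simp only [h1, numOp, ← Finset.smul_sum, Finset.sum_mul]
  simp only [powVec_succ 2, Finset.sum_range_succ, Finset.sum_range_zero, powVec_of_lt,
    powVec_two_two, genCoeff, sub_mul, mul_sub, emit_sector2, emit_sector0, absorb_sector2,
    absorb_sector0, mul_zero, zero_mul, zero_add, add_zero, Nat.reduceLT, Nat.reduceSub, sub_zero,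
    sector1_add, h]
  abel

lemma JumpsCommute.sum_conj_mul_emit3 (hJ : JumpsCommute J) :
    ∑ i, (J i)ᴴ * emit3 J i = (1 / 12 : ℂ) • (jumpDual J (numOp J) - numOp J * numOp J) := by
  have h := hJ.sum_conj_mul_selfComm 1 1
  simp only [mul_one, one_mul, jumpDual_one] at h
  simp only [emit3, mul_smul_comm, ← Finset.smul_sum, h]

lemma emit3_conj_mul (hJ : JumpsCommute J) (i : Fin n) (X : SysOp n) :
    (emit3 J i)ᴴ * X = (1 / 12 : ℂ) • ((J i)ᴴ * (numOp J * X) - numOp J * ((J i)ᴴ * X)) := by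
  rw [emit3, Matrix.conjTranspose_smul, Matrix.conjTranspose_mul, selfComm_conjTranspose,
    hJ.conj_mul_selfComm, smul_mul_assoc, sub_mul, mul_assoc, mul_assoc]
  simp

lemma JumpsCommute.sum_emit3_conj_mul (hJ : JumpsCommute J) (X Y : SysOp n) :
    ∑ i, (emit3 J i)ᴴ * (X * (J i * Y))
      = (1 / 12 : ℂ) • (jumpDual J (numOp J * X) * Y - numOp J * (jumpDual J X * Y)) := by
  have h : ∀ i, (J i)ᴴ * (numOp J * (X * (J i * Y))) = (J i)ᴴ * ((numOp J * X) * (J i * Y)) :=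
    fun i => by rw [mul_assoc (numOp J)]
  simp only [emit3_conj_mul hJ, ← Finset.smul_sum, Finset.sum_sub_distrib, ← Finset.mul_sum,
    sum_conj_mul_mul, h]

lemma JumpsCommute.sum_emit3_conj_mul_jump (hJ : JumpsCommute J) :
    ∑ i, (emit3 J i)ᴴ * J i = (1 / 12 : ℂ) • (jumpDual J (numOp J) - numOp J * numOp J) := by
  simpa [jumpDual_one] using hJ.sum_emit3_conj_mul 1 1

lemma sum_conj_mul_jump (J : Fin n → SysOp n) (X : SysOp n) :
    ∑ i, (J i)ᴴ * (X * J i) = jumpDual J X := by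
  simpa using sum_conj_mul_mul J X 1

lemma JumpsCommute.amp0_two_four (hJ : JumpsCommute J) : amp0 (powVec K J 2 4)
    = K * K - (1 / 6 : ℂ) • (jumpDual J (numOp J) - numOp J * numOp J) := by
  simp only [powVec_succ 1, Finset.sum_range_succ, Finset.sum_range_zero, powVec_of_lt,
    powVec_one_one, powVec_one_two, powVec_one_three, genCoeff, sub_mul, add_mul, map_add, map_sub,
    amp0_emit, amp0_absorb, amp0_emitFour, amp0_absorbFour, amp_sysOp_mul, amp0_sector0,
    amp1_sector1, amp1_sector4, amp4_sector1, hJ.sum_conj_mul_emit3, hJ.sum_emit3_conj_mul_jump,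
    mul_zero, zero_mul, zero_add, add_zero, Nat.reduceLT, Nat.reduceSub, sub_zero,
    Finset.sum_const_zero]
  module

lemma amp0_three_four : amp0 (powVec K J 3 4)
    = -(numOp J * K + jumpDual J K + K * numOp J) := by
  simp only [powVec_succ 2, Finset.sum_range_succ, Finset.sum_range_zero, powVec_of_lt,
    powVec_two_two, powVec_two_three, genCoeff, sub_mul, map_zero, map_add, map_sub,
    amp0_emit, amp0_absorb, amp_sysOp_mul, amp0_sector0, amp0_sector2,
    amp1_sector1, mul_zero, zero_mul, zero_add, Nat.reduceLT, Nat.reduceSub,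
    mul_add, Finset.sum_add_distrib, sum_conj_mul_jump]
  have h : ∑ i, (J i)ᴴ * (J i * K) = numOp J * K := by
    simp only [numOp, Finset.sum_mul, mul_assoc]
  rw [h]
  noncomm_ring

lemma JumpsCommute.amp0_four_four (hJ : JumpsCommute J) : amp0 (powVec K J 4 4)
    = (2 : ℂ) • jumpDual J (numOp J) + numOp J * numOp J := by
  have h : ∑ i, (J i)ᴴ * (J i * numOp J) = numOp J * numOp J := by
    rw [numOp, Finset.sum_mul]
    simp only [mul_assoc]
  simp only [powVec_succ 3, Finset.sum_range_succ, Finset.sum_range_zero, powVec_of_lt,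
    hJ.powVec_three_three, genCoeff, sub_mul, map_zero, map_add, map_sub,
    amp0_emit, amp0_absorb, amp1_sector1, amp1_sector3, mul_zero, zero_mul, zero_add,
    Nat.reduceLT, Nat.reduceSub, zero_sub, mul_neg, Finset.sum_neg_distrib,
    mul_add, Finset.sum_add_distrib, mul_smul_comm, ← Finset.smul_sum, sum_conj_mul_jump, h]
  abel

lemma amp2_two_four (i j : Fin n) : amp2 i j (powVec K J 2 4)
    = J i * emit3 J j + J j * emit3 J i + (emit3 J i * J j + emit3 J j * J i) := by
  simp only [powVec_succ 1, Finset.sum_range_succ, Finset.sum_range_zero, powVec_of_lt,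
    powVec_one_one, powVec_one_two, powVec_one_three, genCoeff, sub_mul, add_mul, map_add, map_sub,
    amp2_emit, amp2_absorb, amp2_emitFour, absorbFour_sector1, amp_sysOp_mul,
    amp2_sector0, amp1_sector1, amp1_sector4, amp3_sector1, amp3_sector4,
    mul_zero, zero_mul, zero_add, add_zero, Nat.reduceLT, Nat.reduceSub, sub_zero,
    Finset.sum_const_zero]

lemma JumpsCommute.amp2_three_four (hJ : JumpsCommute J) (i j : Fin n) :
    amp2 i j (powVec K J 3 4)
      = J i * (J j * K + K * J j) + J j * (J i * K + K * J i) + (2 : ℂ) • (K * (J i * J j)) := by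
  simp only [powVec_succ 2, Finset.sum_range_succ, Finset.sum_range_zero, powVec_of_lt,
    powVec_two_two, powVec_two_three, genCoeff, sub_mul, map_zero, map_add, map_sub,
    amp2_emit, amp2_absorb, amp_sysOp_mul, amp2_sector0, amp2_sector2,
    amp1_sector1, amp3_sector1, mul_zero, zero_mul, zero_add, Nat.reduceLT, Nat.reduceSub, sub_zero,
    Finset.sum_const_zero, hJ.mul_comm j i, mul_add]
  module

lemma JumpsCommute.amp2_four_four (hJ : JumpsCommute J) (i j : Fin n) :
    amp2 i j (powVec K J 4 4)
      = -(J i * ((2 : ℂ) • (numOp J * J j) + J j * numOp J)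
        + J j * ((2 : ℂ) • (numOp J * J i) + J i * numOp J)
        + (6 : ℂ) • (numOp J * (J i * J j))) := by
  have h : ∀ k, (J k)ᴴ * (J i * (J j * J k) + J j * (J i * J k) + J i * (J k * J j)
      + J j * (J k * J i) + J k * (J i * J j) + J k * (J j * J i))
      = (6 : ℂ) • ((J k)ᴴ * J k * (J i * J j)) := by
    intro k
    rw [hJ.mul_comm j k, hJ.mul_comm i k, hJ.mul_comm j i]
    simp only [← mul_assoc (J i) (J k), ← mul_assoc (J j) (J k), hJ.mul_comm i k, hJ.mul_comm j k]
    simp only [mul_assoc, hJ.mul_comm j i, mul_add]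
    module
  simp only [powVec_succ 3, Finset.sum_range_succ, Finset.sum_range_zero, powVec_of_lt,
    hJ.powVec_three_three, genCoeff, sub_mul, map_zero, map_add, map_sub,
    amp2_emit, amp2_absorb, amp1_sector1, amp1_sector3, amp3_sector1, amp3_sector3,
    mul_zero, zero_mul, zero_add, Nat.reduceLT, Nat.reduceSub, sub_zero, zero_sub, h,
    ← Finset.smul_sum, ← Finset.sum_mul]
  rw [numOp]
  noncomm_ring

end Powers

/-! ### Amplitudes of order five and six -/

section HighAmplitudes

variable {n : ℕ} {K : SysOp n} {J : Fin n → SysOp n}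

lemma amp1_two_five (i : Fin n) : amp1 i (powVec K J 2 5)
    = J i * ham4 K J + K * emit3 J i + emit3 J i * K + ham4 K J * J i := by
  simp only [powVec_succ 1, Finset.sum_range_succ, Finset.sum_range_zero, powVec_of_lt,
    powVec_one_one, powVec_one_two, powVec_one_three, powVec_one_four, genCoeff, sub_mul, add_mul,
    map_add, amp1_emit, amp1_emitFour, absorbFour_sector0,
    amp_sysOp_mul, amp0_sector0, amp1_sector1, amp1_sector4, absorb_sector0,
    mul_zero, zero_mul, zero_add, add_zero, Nat.reduceLT, Nat.reduceSub, sub_zero]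

lemma JumpsCommute.amp1_three_five (hJ : JumpsCommute J) (i : Fin n) : amp1 i (powVec K J 3 5)
    = J i * amp0 (powVec K J 2 4) - ∑ j, (J j)ᴴ * amp2 i j (powVec K J 2 4)
      + K * (J i * K + K * J i) - emit3 J i * numOp J
      - (2 : ℂ) • ∑ j, (emit3 J j)ᴴ * (J j * J i) := by
  simp only [powVec_succ 2, Finset.sum_range_succ, Finset.sum_range_zero, powVec_of_lt,
    powVec_two_two, powVec_two_three, genCoeff, sub_mul, add_mul, mul_sub,
    map_add, map_sub, amp1_emit, amp1_absorb, amp1_emitFour, absorbFour_sector0, map_zero,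
    absorbFour_sector2, amp0_sector2, amp2_sector2,
    amp_sysOp_mul, amp0_sector0, amp1_sector1, absorb_sector0,
    mul_zero, zero_mul, zero_add, Nat.reduceLT, Nat.reduceSub, sub_zero]
  have h : ∀ j, (emit3 J j)ᴴ * (J i * J j + J j * J i)
      = (2 : ℂ) • ((emit3 J j)ᴴ * (J j * J i)) := by
    intro j
    rw [hJ.mul_comm i j, two_smul, mul_add]
  simp only [h, ← Finset.smul_sum]
  abel

lemma JumpsCommute.amp1_four_five (hJ : JumpsCommute J) (i : Fin n) : amp1 i (powVec K J 4 5)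
    = J i * amp0 (powVec K J 3 4) - ∑ j, (J j)ᴴ * amp2 i j (powVec K J 3 4)
      - K * ((2 : ℂ) • (numOp J * J i) + J i * numOp J) := by
  rw [powVec_succ 3]
  simp only [Finset.sum_range_succ, Finset.sum_range_zero, powVec_of_lt,
    hJ.powVec_three_three, genCoeff, sub_mul, mul_sub,
    map_add, map_sub, amp1_emit, amp1_absorb, map_zero, amp1_sector3,
    amp_sysOp_mul, amp1_sector1, mul_zero, zero_mul, zero_add, Nat.reduceLT, Nat.reduceSub]
  abel

lemma amp1_five_five (i : Fin n) : amp1 i (powVec K J 5 5)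
    = J i * amp0 (powVec K J 4 4) - ∑ j, (J j)ᴴ * amp2 i j (powVec K J 4 4) := by
  rw [powVec_succ 4]
  simp only [Finset.sum_range_succ, Finset.sum_range_zero, powVec_of_lt, genCoeff, sub_mul,
    map_sub, amp1_emit, amp1_absorb, mul_zero, zero_mul, zero_add,
    add_zero, Nat.reduceLT, Nat.reduceSub]

lemma JumpsCommute.sum_conj_mul_jump' (hJ : JumpsCommute J) (i : Fin n) (X : SysOp n) :
    ∑ j, (J j)ᴴ * (J i * (X * J j)) = J i * jumpDual J X + selfComm J i * (X * J i) := by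
  simpa using hJ.sum_conj_mul i X 1

lemma JumpsCommute.sum_conj_mul_one (hJ : JumpsCommute J) (i : Fin n) (Y : SysOp n) :
    ∑ j, (J j)ᴴ * (J i * (J j * Y)) = numOp J * (J i * Y) := by
  simp only [← mul_assoc, hJ.mul_comm i]
  simp only [numOp, Finset.sum_mul, mul_assoc]

lemma sum_conj_mul_jump_mul (X : SysOp n) :
    ∑ j, (J j)ᴴ * (J j * X) = numOp J * X := by
  simp only [numOp, Finset.sum_mul, mul_assoc]


lemma JumpsCommute.emit3_eq (hJ : JumpsCommute J) (i : Fin n) :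
    emit3 J i = (1 / 12 : ℂ) • (numOp J * J i - J i * numOp J) := by
  rw [emit3, hJ.selfComm_mul]

lemma ham4_eq : ham4 K J
    = (1 / 6 : ℂ) • (jumpDual J K - (1 / 2 : ℂ) • (numOp J * K + K * numOp J)) := by
  rw [ham4, heisenberg_apply]

lemma JumpsCommute.amp1_one_five_eq (hJ : JumpsCommute J) (i : Fin n) :
    amp1 i (powVec K J 1 5)
      = (1 / 360 : ℂ) • ((2 : ℂ) • (jumpDual J (numOp J) * J i)
          - (2 : ℂ) • (J i * jumpDual J (numOp J)) - numOp J * (numOp J * J i)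
          + (4 : ℂ) • (numOp J * (J i * numOp J)) - (3 : ℂ) • (J i * (numOp J * numOp J))
          - (6 : ℂ) • (selfComm J i * (numOp J * J i)))
        + (1 / 24 : ℂ) • (selfComm J i * (K * J i) - numOp J * (J i * K)
          + J i * (numOp J * K)) := by
  rw [powVec_one_five, amp1_sector1, hJ.emit5_eq]
  simp only [hJ.selfComm_mul, hJ.selfComm_mul_assoc, mul_sub, sub_mul, mul_assoc]
  module

lemma JumpsCommute.amp1_two_five_eq (hJ : JumpsCommute J) (i : Fin n) :
    amp1 i (powVec K J 2 5)
      = (1 / 6 : ℂ) • (J i * jumpDual J K + jumpDual J K * J i)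
        + (1 / 12 : ℂ) • (numOp J * (J i * K) - (2 : ℂ) • (J i * (numOp J * K))
          - J i * (K * numOp J) - numOp J * (K * J i) - K * (J i * numOp J)) := by
  rw [amp1_two_five, hJ.emit3_eq, ham4_eq]
  simp only [mul_sub, sub_mul, mul_add, add_mul, mul_smul_comm, smul_mul_assoc, mul_assoc, smul_add,
    smul_sub]
  module

lemma JumpsCommute.amp1_three_five_eq (hJ : JumpsCommute J) (i : Fin n) :
    amp1 i (powVec K J 3 5)
      = J i * (K * K) + K * (J i * K) + K * (K * J i) - (1 / 6 : ℂ) • (J i * jumpDual J (numOp J))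
        - (1 / 3 : ℂ) • (jumpDual J (numOp J) * J i) + (1 / 4 : ℂ) • (J i * (numOp J * numOp J))
        + (1 / 12 : ℂ) • (numOp J * (J i * numOp J))
        + (1 / 6 : ℂ) • (numOp J * (numOp J * J i)) := by
  have h : ∑ j, (J j)ᴴ * amp2 i j (powVec K J 2 4)
      = (1 / 6 : ℂ) • (jumpDual J (numOp J) * J i - numOp J * (J i * numOp J)) := by
    simp only [amp2_two_four, hJ.emit3_eq, mul_sub, sub_mul, mul_add, mul_smul_comm,
      smul_mul_assoc, mul_assoc, hJ.mul_comm i, Finset.sum_add_distrib, Finset.sum_sub_distrib,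
      ← Finset.smul_sum, sum_conj_mul_mul, hJ.sum_conj_mul_jump', hJ.sum_conj_mul_one,
      sum_conj_mul_jump_mul]
    module
  have h2 : ∑ j, (emit3 J j)ᴴ * (J j * J i)
      = (1 / 12 : ℂ) • (jumpDual J (numOp J) * J i - numOp J * (numOp J * J i)) := by
    simpa [jumpDual_one] using hJ.sum_emit3_conj_mul 1 (J i)
  rw [hJ.amp1_three_five, h, h2, hJ.amp0_two_four, hJ.emit3_eq]
  simp only [mul_sub, sub_mul, mul_add, mul_smul_comm, smul_mul_assoc, mul_assoc]
  module

lemma JumpsCommute.amp1_four_five_eq (hJ : JumpsCommute J) (i : Fin n) :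
    amp1 i (powVec K J 4 5)
      = -(J i * (numOp J * K) + (2 : ℂ) • (J i * jumpDual J K) + J i * (K * numOp J)
        + (2 : ℂ) • (numOp J * (J i * K)) + numOp J * (K * J i) + selfComm J i * (K * J i)
        + (2 : ℂ) • (jumpDual J K * J i) + (2 : ℂ) • (K * (numOp J * J i))
        + K * (J i * numOp J)) := by
  have h : ∑ j, (J j)ᴴ * amp2 i j (powVec K J 3 4)
      = (2 : ℂ) • (numOp J * (J i * K)) + J i * jumpDual J K + selfComm J i * (K * J i)
        + numOp J * (K * J i) + (2 : ℂ) • (jumpDual J K * J i) := by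
    simp only [hJ.amp2_three_four, mul_add, mul_smul_comm, fun j => hJ.mul_comm i j,
      Finset.sum_add_distrib, ← Finset.smul_sum, sum_conj_mul_mul, hJ.sum_conj_mul_jump',
      hJ.sum_conj_mul_one, sum_conj_mul_jump_mul]
    module
  rw [hJ.amp1_four_five, h, amp0_three_four]
  simp only [mul_add, mul_neg, mul_smul_comm]
  module

lemma JumpsCommute.amp1_five_five_eq (hJ : JumpsCommute J) (i : Fin n) :
    amp1 i (powVec K J 5 5)
      = (4 : ℂ) • (J i * jumpDual J (numOp J)) + J i * (numOp J * numOp J)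
        + (2 : ℂ) • (selfComm J i * (numOp J * J i)) + (2 : ℂ) • (numOp J * (J i * numOp J))
        + (2 : ℂ) • (numOp J * (numOp J * J i)) + (6 : ℂ) • (jumpDual J (numOp J) * J i) := by
  have h : ∑ j, (J j)ᴴ * amp2 i j (powVec K J 4 4)
      = -((2 : ℂ) • (J i * jumpDual J (numOp J)) + (2 : ℂ) • (selfComm J i * (numOp J * J i))
        + (2 : ℂ) • (numOp J * (J i * numOp J)) + (2 : ℂ) • (numOp J * (numOp J * J i))
        + (6 : ℂ) • (jumpDual J (numOp J) * J i)) := by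
    simp only [hJ.amp2_four_four, mul_add, mul_neg, mul_smul_comm, fun j => hJ.mul_comm i j,
      Finset.sum_add_distrib, Finset.sum_neg_distrib, ← Finset.smul_sum, sum_conj_mul_mul,
      hJ.sum_conj_mul_jump', hJ.sum_conj_mul_one, sum_conj_mul_jump_mul]
    module
  rw [amp1_five_five, h, hJ.amp0_four_four]
  simp only [mul_add, mul_smul_comm]
  module

end HighAmplitudes

/-! ### The vacuum amplitude of order six -/

section SixthOrder

variable {n : ℕ} {K : SysOp n} {J : Fin n → SysOp n}

lemma amp0_two_six : amp0 (powVec K J 2 6)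
    = K * ham4 K J + ham4 K J * K - ∑ i, (J i)ᴴ * emit5 K J i - ∑ i, (emit3 J i)ᴴ * emit3 J i
      - ∑ i, (scaledW K J i)ᴴ * scaledW K J i - ∑ i, (emit5 K J i)ᴴ * J i := by
  simp only [powVec_succ 1, Finset.sum_range_succ, Finset.sum_range_zero, powVec_of_lt,
    powVec_one_one, powVec_one_two, powVec_one_three, powVec_one_four, powVec_one_five, genCoeff,
    sub_mul, add_mul, map_add, map_sub, amp0_emit, amp0_absorb, amp0_emitFour, amp0_absorbFour,
    amp_sysOp_mul, amp0_sector0, amp1_sector1, amp1_sector4, amp4_sector1, amp4_sector4,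
    mul_zero, zero_mul, zero_add, add_zero, Nat.reduceLT, Nat.reduceSub]
  abel

lemma amp0_three_six : amp0 (powVec K J 3 6)
    = K * amp0 (powVec K J 2 4) - ∑ i, (J i)ᴴ * amp1 i (powVec K J 2 5)
      - ∑ i, (emit3 J i)ᴴ * (J i * K + K * J i) - ham4 K J * numOp J := by
  rw [powVec_succ 2]
  simp only [Finset.sum_range_succ, Finset.sum_range_zero, powVec_of_lt,
    powVec_two_two, powVec_two_three, genCoeff, mul_sub,
    sub_mul, add_mul, map_add, map_sub, amp0_emit, amp0_absorb, amp0_emitFour, amp0_absorbFour,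
    amp_sysOp_mul, amp0_sector0, amp0_sector2, amp1_sector1, amp4_sector1,
    mul_zero, zero_mul, zero_add, add_zero, Nat.reduceLT, Nat.reduceSub, Finset.sum_const_zero]
  abel

lemma JumpsCommute.amp0_four_six (hJ : JumpsCommute J) : amp0 (powVec K J 4 6)
    = K * amp0 (powVec K J 3 4) - ∑ i, (J i)ᴴ * amp1 i (powVec K J 3 5)
      + ∑ i, (emit3 J i)ᴴ * ((2 : ℂ) • (numOp J * J i) + J i * numOp J) := by
  rw [powVec_succ 3]
  simp only [Finset.sum_range_succ, Finset.sum_range_zero, powVec_of_lt,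
    hJ.powVec_three_three, genCoeff, mul_sub, amp1_sector3, amp4_sector3,
    sub_mul, add_mul, map_add, map_sub, amp0_emit, amp0_absorb, amp0_emitFour, amp0_absorbFour,
    amp_sysOp_mul, amp1_sector1, amp4_sector1, sub_zero, zero_sub,
    mul_zero, zero_mul, zero_add, add_zero, Nat.reduceLT, Nat.reduceSub, Finset.sum_const_zero]
  abel

lemma amp0_five_six : amp0 (powVec K J 5 6)
    = K * amp0 (powVec K J 4 4) - ∑ i, (J i)ᴴ * amp1 i (powVec K J 4 5) := by
  rw [powVec_succ 4]
  simp only [Finset.sum_range_succ, Finset.sum_range_zero, powVec_of_lt, genCoeff,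
    sub_mul, map_add, map_sub, amp0_emit, amp0_absorb, amp_sysOp_mul, zero_sub,
    mul_zero, zero_mul, zero_add, add_zero, Nat.reduceLT, Nat.reduceSub]
  abel

lemma amp0_six_six : amp0 (powVec K J 6 6) = -∑ i, (J i)ᴴ * amp1 i (powVec K J 5 5) := by
  rw [powVec_succ 5]
  simp only [Finset.sum_range_succ, Finset.sum_range_zero, powVec_of_lt, genCoeff,
    sub_mul, map_sub, amp0_emit, amp0_absorb, zero_sub,
    mul_zero, zero_mul, zero_add, add_zero, Nat.reduceLT, Nat.reduceSub]

lemma sum_conj_mul₂ (X X' : SysOp n) :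
    ∑ i, (J i)ᴴ * (X * (X' * J i)) = jumpDual J (X * X') := by
  simpa [mul_assoc] using sum_conj_mul_mul J (X * X') 1

lemma JumpsCommute.sum_conj_mul_selfComm_mul (hJ : JumpsCommute J) (X : SysOp n) :
    ∑ i, (J i)ᴴ * (selfComm J i * (X * J i))
      = jumpDual J (numOp J * X) - numOp J * jumpDual J X := by
  simpa using hJ.sum_conj_mul_selfComm X 1

lemma JumpsCommute.sum_conj_mul_emit5 (hJ : JumpsCommute J) :
    ∑ i, (J i)ᴴ * emit5 K J i
      = (1 / 360 : ℂ) • ((2 : ℂ) • jumpDual J (jumpDual J (numOp J))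
          - (2 : ℂ) • (numOp J * jumpDual J (numOp J)) - (7 : ℂ) • jumpDual J (numOp J * numOp J)
          + (4 : ℂ) • (jumpDual J (numOp J) * numOp J)
          - (3 : ℂ) • (numOp J * (numOp J * numOp J))
          + (6 : ℂ) • (numOp J * jumpDual J (numOp J)))
        + (1 / 24 : ℂ) • (jumpDual J (numOp J * K) - numOp J * jumpDual J K
          - jumpDual J (numOp J) * K + numOp J * (numOp J * K)) := by
  have h := fun i => hJ.amp1_one_five_eq (K := K) i
  simp only [powVec_one_five, amp1_sector1] at h
  simp only [h, mul_add, mul_sub, mul_smul_comm, Finset.sum_add_distrib, Finset.sum_sub_distrib,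
    ← Finset.smul_sum, sum_conj_mul_mul, sum_conj_mul_jump, sum_conj_mul₂, sum_conj_mul_jump_mul,
    hJ.sum_conj_mul_selfComm_mul]
  module

lemma JumpsCommute.ham6_eq (hJ : JumpsCommute J) : ham6 K J
    = (1 / 90 : ℂ) • (jumpDual J (jumpDual J K)
      - (1 / 2 : ℂ) • (jumpDual J (numOp J * K) + jumpDual J (K * numOp J))
      - (1 / 2 : ℂ) • (numOp J * jumpDual J K + jumpDual J K * numOp J)
      + (1 / 4 : ℂ) • (numOp J * (numOp J * K) + (2 : ℂ) • (numOp J * (K * numOp J))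
        + K * (numOp J * numOp J))
      + (K * jumpDual J (numOp J) - K * (numOp J * numOp J) - jumpDual J (K * numOp J)
        + jumpDual J K * numOp J + jumpDual J (numOp J) * K - jumpDual J (numOp J * K)
        - numOp J * (numOp J * K) + numOp J * jumpDual J K)) := by
  have h : ∑ i, ((K * (J i)ᴴ - (J i)ᴴ * K) * (selfComm J i * J i)
        + (J i)ᴴ * selfComm J i * (J i * K - K * J i))
      = K * jumpDual J (numOp J) - K * (numOp J * numOp J) - jumpDual J (K * numOp J)
        + jumpDual J K * numOp J + jumpDual J (numOp J) * K - jumpDual J (numOp J * K)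
        - numOp J * (numOp J * K) + numOp J * jumpDual J K := by
    simp only [hJ.selfComm_mul, hJ.conj_mul_selfComm, mul_sub, sub_mul, mul_assoc,
      Finset.sum_add_distrib, Finset.sum_sub_distrib, ← Finset.mul_sum, sum_conj_mul_mul,
      sum_conj_mul_jump, sum_conj_mul₂, sum_conj_mul_jump_mul]
    module
  rw [ham6, h]
  simp only [heisenberg_apply, map_sub, map_add, map_smul,
    mul_assoc]
  module

lemma JumpsCommute.sum_emit3_conj_mul_emit3 (hJ : JumpsCommute J) :
    ∑ i, (emit3 J i)ᴴ * emit3 J i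
      = (1 / 144 : ℂ) • (jumpDual J (numOp J * numOp J) - jumpDual J (numOp J) * numOp J
        - numOp J * jumpDual J (numOp J) + numOp J * (numOp J * numOp J)) := by
  have h : ∀ i, (emit3 J i)ᴴ * emit3 J i = (1 / 12 : ℂ) • ((J i)ᴴ * (numOp J * emit3 J i)
      - numOp J * ((J i)ᴴ * emit3 J i)) := fun i => emit3_conj_mul hJ i _
  simp only [h]
  simp only [hJ.emit3_eq, mul_sub, mul_smul_comm, smul_sub,
    Finset.sum_sub_distrib, ← Finset.smul_sum, ← Finset.mul_sum, sum_conj_mul_mul,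
    sum_conj_mul_jump, sum_conj_mul₂, sum_conj_mul_jump_mul]
  module

lemma sqrt_twelve_inv_mul_self :
    (Real.sqrt 12 : ℂ)⁻¹ * (Real.sqrt 12 : ℂ)⁻¹ = 1 / 12 := by
  rw [← mul_inv, ← Complex.ofReal_mul, Real.mul_self_sqrt (by norm_num)]
  norm_num

lemma JumpsCommute.emitW_eq (hJ : JumpsCommute J) (i : Fin n) : emitW K J i
    = K * J i - J i * K - (1 / 2 : ℂ) • (numOp J * J i - J i * numOp J) := by
  rw [emitW, hJ.selfComm_mul]

lemma JumpsCommute.sum_scaledW_conj_mul_scaledW (hJ : JumpsCommute J) (hK : Kᴴ = -K) :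
    ∑ i, (scaledW K J i)ᴴ * scaledW K J i
      = (1 / 12 : ℂ) • (
          -jumpDual J (K * K) + (1 / 2 : ℂ) • (jumpDual J (K * numOp J) - jumpDual J (numOp J * K))
            + (1 / 4 : ℂ) • jumpDual J (numOp J * numOp J)
          + (jumpDual J K + (1 / 2 : ℂ) • jumpDual J (numOp J)) * (K - (1 / 2 : ℂ) • numOp J)
          + (K + (1 / 2 : ℂ) • numOp J) * (jumpDual J K - (1 / 2 : ℂ) • jumpDual J (numOp J))
          - (K + (1 / 2 : ℂ) • numOp J) * (numOp J * (K - (1 / 2 : ℂ) • numOp J))) := by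
  have h : ∀ i, (scaledW K J i)ᴴ * scaledW K J i
      = (1 / 12 : ℂ) • (((K + (1 / 2 : ℂ) • numOp J) * (J i)ᴴ
          - (J i)ᴴ * (K + (1 / 2 : ℂ) • numOp J))
        * (K * J i - J i * K - (1 / 2 : ℂ) • (numOp J * J i - J i * numOp J))) := by
    intro i
    rw [scaledW, Matrix.conjTranspose_smul, smul_mul_smul_comm, hJ.emitW_eq]
    congr 1
    · rw [← sqrt_twelve_inv_mul_self]
      simp
    · congr 1
      simp only [Matrix.conjTranspose_sub, Matrix.conjTranspose_mul, Matrix.conjTranspose_smul,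
        numOp_conjTranspose, hK, mul_add, add_mul, smul_mul_assoc, mul_smul_comm, neg_mul, mul_neg]
      have : star (1 / 2 : ℂ) = 1 / 2 := by simp
      rw [this]
      module
  simp only [h, mul_sub, sub_mul, mul_add, add_mul, mul_smul_comm, smul_mul_assoc, mul_assoc,
    smul_sub, smul_add, Finset.sum_add_distrib, Finset.sum_sub_distrib, ← Finset.smul_sum,
    ← Finset.mul_sum, sum_conj_mul_mul, sum_conj_mul_jump, sum_conj_mul₂, sum_conj_mul_jump_mul]
  module

lemma JumpsCommute.sum_emit5_conj_mul (hJ : JumpsCommute J) (hK : Kᴴ = -K) :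
    ∑ i, (emit5 K J i)ᴴ * J i
      = (1 / 360 : ℂ) • ((2 : ℂ) • jumpDual J (jumpDual J (numOp J))
          - (2 : ℂ) • (jumpDual J (numOp J) * numOp J) - (7 : ℂ) • jumpDual J (numOp J * numOp J)
          + (4 : ℂ) • (numOp J * jumpDual J (numOp J))
          - (3 : ℂ) • (numOp J * (numOp J * numOp J))
          + (6 : ℂ) • (jumpDual J (numOp J) * numOp J))
        - (1 / 24 : ℂ) • (jumpDual J (K * numOp J) - jumpDual J K * numOp J
          - K * jumpDual J (numOp J) + K * (numOp J * numOp J)) := by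
  have h := congrArg Matrix.conjTranspose (hJ.sum_conj_mul_emit5 (K := K))
  simp only [Matrix.conjTranspose_sum, Matrix.conjTranspose_mul, Matrix.conjTranspose_conjTranspose,
    Matrix.conjTranspose_add, Matrix.conjTranspose_sub, Matrix.conjTranspose_smul, hK,
    jumpDual_conjTranspose, numOp_conjTranspose, neg_mul, map_neg] at h
  rw [h]
  simp only [star_div₀, star_one, star_ofNat, mul_assoc]
  module

/-- The vacuum amplitude of order `6` is the third Taylor coefficient of `exp (x² A)` with
`A = K - N / 2`. -/
lemma JumpsCommute.amp0_six (hJ : JumpsCommute J) (hK : Kᴴ = -K) :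
    amp0 (powVec K J 1 6) + (1 / 2 : ℂ) • amp0 (powVec K J 2 6)
        + (1 / 6 : ℂ) • amp0 (powVec K J 3 6) + (1 / 24 : ℂ) • amp0 (powVec K J 4 6)
        + (1 / 120 : ℂ) • amp0 (powVec K J 5 6) + (1 / 720 : ℂ) • amp0 (powVec K J 6 6)
      = (1 / 6 : ℂ) • ((K - (1 / 2 : ℂ) • numOp J) * ((K - (1 / 2 : ℂ) • numOp J)
          * (K - (1 / 2 : ℂ) • numOp J))) := by
  rw [powVec_one_six, amp0_sector0, amp0_two_six, amp0_three_six, hJ.amp0_four_six, amp0_five_six,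
    amp0_six_six, hJ.ham6_eq, hJ.sum_conj_mul_emit5, hJ.sum_emit5_conj_mul hK,
    hJ.sum_emit3_conj_mul_emit3, hJ.sum_scaledW_conj_mul_scaledW hK, hJ.amp0_two_four,
    hJ.amp0_four_four, amp0_three_four]
  simp only [hJ.amp1_two_five_eq, hJ.amp1_three_five_eq, hJ.amp1_four_five_eq,
    hJ.amp1_five_five_eq, emit3_conj_mul hJ, ham4_eq, mul_sub, sub_mul,
    mul_add, add_mul, mul_neg, mul_smul_comm, smul_mul_assoc, mul_assoc,
    smul_sub, smul_add, Finset.sum_add_distrib, Finset.sum_sub_distrib, Finset.sum_neg_distrib,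
    ← Finset.smul_sum,
    ← Finset.mul_sum, sum_conj_mul_mul, sum_conj_mul_jump, sum_conj_mul₂,
    sum_conj_mul_jump_mul, hJ.sum_conj_mul_selfComm_mul]
  module

end SixthOrder

/-! ### Agreement with the Lindblad evolution up to third order -/

section Matching

variable {n : ℕ}

/-- `X ↦ ∑ i, J i X J i†`. -/
def jump (J : Fin n → SysOp n) : SysOp n →ₗ[ℂ] SysOp n :=
  ∑ i, LinearMap.mulLeftRight ℂ (J i, (J i)ᴴ)

/-- `K - N / 2`: the generator of the evolution without jumps. -/
def noJump (K : SysOp n) (J : Fin n → SysOp n) : SysOp n := K - (1 / 2 : ℂ) • numOp J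

/-- The coefficient of `x ^ p` in the exponential of the generator, applied to `|Vac⟩`. -/
def expVec (K : SysOp n) (J : Fin n → SysOp n) (p : ℕ) : JointOp n :=
  expCoeff (genCoeff K J) p * sector0 1

/-- The contribution of the orders `p` (ket) and `q` (bra) to the reduced evolution. -/
def pairing (K : SysOp n) (J : Fin n → SysOp n) (p q : ℕ) (ρ : SysOp n) : SysOp n :=
  traceAnc n (expVec K J p * sysOp ρ * (expVec K J q)ᴴ)

lemma jump_apply (J : Fin n → SysOp n) (X : SysOp n) : jump J X = ∑ i, J i * (X * (J i)ᴴ) := by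
  simp [jump, mul_assoc]

lemma jump_conjTranspose (J : Fin n → SysOp n) (X : SysOp n) : (jump J X)ᴴ = jump J Xᴴ := by
  simp [jump_apply, Matrix.conjTranspose_sum, Matrix.mul_assoc]

variable {K : SysOp n} {J : Fin n → SysOp n}

lemma expVec_eq (p : ℕ) : expVec K J p
    = ∑ k ∈ Finset.range (p + 1), ((k.factorial : ℂ)⁻¹) • powVec K J k p := by
  simp only [expVec, expCoeff, Finset.sum_mul, smul_mul_assoc, powVec]

lemma sandwich_expCoeff (p q : ℕ) (ρ : SysOp n) :
    sandwich (expCoeff (genCoeff K J) p) (expCoeff (genCoeff K J) q)ᴴ ρ = pairing K J p q ρ := by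
  rw [sandwich_conjTranspose_eq]
  rfl

lemma traceAnc_conjTranspose (M : JointOp n) : (traceAnc n M)ᴴ = traceAnc n Mᴴ := by
  ext s t
  simp [traceAnc_apply, Matrix.conjTranspose_apply]

lemma pairing_comm (p q : ℕ) (ρ : SysOp n) :
    pairing K J p q ρ = (pairing K J q p ρᴴ)ᴴ := by
  have h : (sysOp ρᴴ)ᴴ = sysOp ρ := by
    rw [Matrix.conjTranspose_kronecker, Matrix.conjTranspose_conjTranspose,
      Matrix.conjTranspose_one]
  rw [pairing, pairing, traceAnc_conjTranspose, Matrix.conjTranspose_mul, Matrix.conjTranspose_mul,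
    Matrix.conjTranspose_conjTranspose, h, Matrix.mul_assoc]

lemma expVec_zero : expVec K J 0 = sector0 1 := by
  simp [expVec_eq, powVec_zero_zero]

lemma expVec_one : expVec K J 1 = sector1 J := by
  simp [expVec_eq, Finset.sum_range_succ, powVec_zero_of_ne, powVec_one_one]

lemma expVec_two : expVec K J 2
    = (1 / 2 : ℂ) • sector2 (fun i j => J i * J j) + sector0 (noJump K J) := by
  have h : sector0 ((1 / 2 : ℂ) • numOp J) = (1 / 2 : ℂ) • sector0 (numOp J) :=
    map_smul (adjoinVac n) _ _
  rw [noJump, sector0_sub, h]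
  simp [expVec_eq, Finset.sum_range_succ, powVec_zero_of_ne, powVec_one_two, powVec_two_two,
    Nat.factorial]
  module

lemma sector1_smul (c : ℂ) (T : Fin n → SysOp n) :
    sector1 (fun i => c • T i) = c • sector1 T := by
  simp only [sector1, Matrix.smul_kronecker, Finset.smul_sum]

/-- At order `3` the amplitudes are those of jumps at uniformly distributed times, averaged: the
products of the factors `J` and `A = noJump K J` in all orders, divided by the factorial of their
number. Level `4` is excited in addition. -/
lemma JumpsCommute.expVec_three (hJ : JumpsCommute J) : expVec K J 3
    = (1 / 6 : ℂ) • sector3 (fun i j k => J i * (J j * J k))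
      + sector1 (fun i => (1 / 2 : ℂ) • (noJump K J * J i + J i * noJump K J))
      + sector4 (scaledW K J) := by
  have h : sector1 (fun i => (1 / 2 : ℂ) • (noJump K J * J i + J i * noJump K J))
      = sector1 (emit3 J) + (1 / 2 : ℂ) • sector1 (fun i => J i * K + K * J i)
        - (1 / 6 : ℂ) • sector1 (fun i => (2 : ℂ) • (numOp J * J i) + J i * numOp J) := by
    rw [← sector1_smul, ← sector1_smul, ← sector1_add, ← sector1_sub]
    congr 1
    ext1 i
    rw [hJ.emit3_eq, noJump]
    simp only [mul_sub, sub_mul, mul_smul_comm, smul_mul_assoc]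
    module
  rw [h]
  simp [expVec_eq, Finset.sum_range_succ, powVec_zero_of_ne, powVec_one_three, powVec_two_three,
    hJ.powVec_three_three, Nat.factorial]
  module

lemma amp_expVec (o : Matrix (Anc n) (Anc n) ℂ) (p : ℕ) : amp o (expVec K J p)
    = ∑ k ∈ Finset.range (p + 1), ((k.factorial : ℂ)⁻¹) • amp o (powVec K J k p) := by
  rw [expVec_eq, map_sum]
  simp only [map_smul]

lemma JumpsCommute.amp0_expVec_four (hJ : JumpsCommute J) : amp0 (expVec K J 4)
    = (1 / 2 : ℂ) • (noJump K J * noJump K J) := by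
  simp [amp_expVec, Finset.sum_range_succ, powVec_zero_of_ne, powVec_one_four, hJ.amp0_two_four,
    amp0_sector0, amp0_three_four, hJ.amp0_four_four, Nat.factorial, ham4_eq, noJump, mul_sub,
    sub_mul]
  module

/-- All orders of the three factors `A`, `J i`, `J j`, divided by `3!`. -/
lemma JumpsCommute.amp2_expVec_four (hJ : JumpsCommute J) (i j : Fin n) :
    amp2 i j (expVec K J 4)
      = (1 / 6 : ℂ) • ((2 : ℂ) • (noJump K J * (J i * J j)) + J i * (noJump K J * J j)
        + J j * (noJump K J * J i) + (2 : ℂ) • (J i * (J j * noJump K J))) := by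
  have h : ∀ X, J j * (J i * X) = J i * (J j * X) := fun X => by
    rw [← mul_assoc, hJ.mul_comm, mul_assoc]
  simp only [amp_expVec, Finset.sum_range_succ, Finset.sum_range_zero,
    powVec_zero_of_ne, powVec_one_four, ne_eq, OfNat.ofNat_ne_zero, not_false_eq_true, map_zero,
    amp2_sector0, amp2_two_four, hJ.amp2_three_four, hJ.amp2_four_four]
  simp only [noJump, mul_sub, sub_mul, hJ.emit3_eq, mul_add, mul_smul_comm, smul_mul_assoc,
    mul_assoc, hJ.mul_comm j i, h, Nat.factorial, smul_zero, zero_add]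
  push_cast
  module

/-- All orders of the three factors `A`, `A`, `J i`, divided by `3!`. -/
lemma JumpsCommute.amp1_expVec_five (hJ : JumpsCommute J) (i : Fin n) :
    amp1 i (expVec K J 5)
      = (1 / 6 : ℂ) • (noJump K J * (noJump K J * J i) + noJump K J * (J i * noJump K J)
        + J i * (noJump K J * noJump K J)) := by
  simp only [amp_expVec, Finset.sum_range_succ, Finset.sum_range_zero, map_zero,
    powVec_zero_of_ne, ne_eq, OfNat.ofNat_ne_zero, not_false_eq_true, hJ.amp1_one_five_eq,
    hJ.amp1_two_five_eq, hJ.amp1_three_five_eq, hJ.amp1_four_five_eq, hJ.amp1_five_five_eq, noJump,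
    mul_sub, sub_mul, mul_smul_comm, smul_mul_assoc, Nat.factorial, smul_zero]
  push_cast
  module

lemma JumpsCommute.amp0_expVec_six (hJ : JumpsCommute J) (hK : Kᴴ = -K) :
    amp0 (expVec K J 6)
      = (1 / 6 : ℂ) • (noJump K J * (noJump K J * noJump K J)) := by
  rw [noJump, ← hJ.amp0_six hK]
  simp only [amp_expVec, Finset.sum_range_succ, Finset.sum_range_zero, map_zero,
    powVec_zero_of_ne, ne_eq, OfNat.ofNat_ne_zero, not_false_eq_true, Nat.factorial, smul_zero]
  push_cast
  module

lemma pairing_zero (p : ℕ) (ρ : SysOp n) : pairing K J p 0 ρ = amp0 (expVec K J p) * ρ := by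
  rw [pairing, expVec_zero, traceAnc_sector0, Matrix.conjTranspose_one, mul_one]

lemma pairing_one (p : ℕ) (ρ : SysOp n) :
    pairing K J p 1 ρ = ∑ i, amp1 i (expVec K J p) * (ρ * (J i)ᴴ) := by
  rw [pairing, expVec_one, traceAnc_sector1]
  simp only [mul_assoc]

lemma JumpsCommute.pairing_two (hJ : JumpsCommute J) (p : ℕ) (ρ : SysOp n) :
    pairing K J p 2 ρ
      = (1 / 2 : ℂ) • ∑ i, ∑ j, amp2 i j (expVec K J p) * (ρ * ((J j)ᴴ * (J i)ᴴ))
        + amp0 (expVec K J p) * (ρ * (noJump K J)ᴴ) := by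
  rw [pairing, expVec_two, Matrix.conjTranspose_add, Matrix.conjTranspose_smul, mul_add, map_add,
    traceAnc_sector0, mul_smul_comm, map_smul, traceAnc_sector2, Finset.sum_comm]
  simp only [mul_assoc, ← Matrix.conjTranspose_mul, hJ.mul_comm]
  simp

/-- `ρ ↦ A ρ + ρ A† + ∑ i, J i ρ J i†`. -/
def lindbladMap (A : SysOp n) (J : Fin n → SysOp n) (ρ : SysOp n) : SysOp n :=
  A * ρ + ρ * Aᴴ + jump J ρ

lemma pairing_order_two (ρ : SysOp n) :
    pairing K J 2 0 ρ + pairing K J 1 1 ρ + pairing K J 0 2 ρ = lindbladMap (noJump K J) J ρ := by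
  rw [pairing_comm 0 2, pairing_zero, pairing_zero, pairing_one, expVec_two, expVec_one]
  simp only [map_add, map_smul, amp0_sector2, amp0_sector0, amp1_sector1, smul_zero, zero_add,
    Matrix.conjTranspose_mul, Matrix.conjTranspose_conjTranspose, lindbladMap, jump_apply]
  abel

lemma sum_sum_jump (Y Z : SysOp n) :
    ∑ i, ∑ j, J i * (Y * (J j * (Z * ((J j)ᴴ * (J i)ᴴ)))) = jump J (Y * jump J Z) := by
  simp only [jump_apply, Finset.mul_sum, Finset.sum_mul, mul_assoc]

lemma JumpsCommute.conj_mul_conj (hJ : JumpsCommute J) (i j : Fin n) :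
    (J i)ᴴ * (J j)ᴴ = (J j)ᴴ * (J i)ᴴ := by
  rw [← Matrix.conjTranspose_mul, hJ.mul_comm, Matrix.conjTranspose_mul]

lemma JumpsCommute.sum_sum_jump_swap (hJ : JumpsCommute J) (Y Z : SysOp n) :
    ∑ i, ∑ j, J j * (Y * (J i * (Z * ((J j)ᴴ * (J i)ᴴ)))) = jump J (Y * jump J Z) := by
  rw [← sum_sum_jump (J := J), Finset.sum_comm]
  simp only [fun i j => hJ.conj_mul_conj i j]

/-- The second Taylor coefficient of the Lindblad evolution. -/
lemma JumpsCommute.pairing_order_four (hJ : JumpsCommute J) (ρ : SysOp n) :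
    pairing K J 4 0 ρ + pairing K J 3 1 ρ + pairing K J 2 2 ρ + pairing K J 1 3 ρ
        + pairing K J 0 4 ρ
      = (1 / 2 : ℂ) • lindbladMap (noJump K J) J (lindbladMap (noJump K J) J ρ) := by
  have h31 : ∀ ρ, pairing K J 3 1 ρ
      = (1 / 2 : ℂ) • (noJump K J * jump J ρ + jump J (noJump K J * ρ)) := by
    intro ρ
    rw [pairing_one, hJ.expVec_three]
    simp only [map_add, map_smul, amp1_sector3, amp1_sector1, amp1_sector4, smul_zero, zero_add,
      add_zero, jump_apply, Finset.mul_sum, ← Finset.sum_add_distrib, Finset.smul_sum, add_mul,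
      smul_mul_assoc, mul_assoc]
  have h22 : pairing K J 2 2 ρ
      = (1 / 2 : ℂ) • jump J (jump J ρ) + noJump K J * (ρ * (noJump K J)ᴴ) := by
    rw [hJ.pairing_two, expVec_two]
    simp only [map_add, map_smul, amp2_sector2, amp2_sector0, amp0_sector2, amp0_sector0,
      smul_zero, zero_add, add_zero]
    congr 2
    have h := sum_sum_jump (J := J) 1 ρ
    simp only [one_mul] at h
    rw [← h]
    refine Finset.sum_congr rfl fun i _ => Finset.sum_congr rfl fun j _ => ?_
    rw [hJ.mul_comm j i, ← two_smul ℂ (J i * J j), smul_smul]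
    norm_num [mul_assoc]
  rw [pairing_comm 0 4, pairing_comm 1 3, h31, h31, h22, pairing_zero, pairing_zero,
    hJ.amp0_expVec_four]
  simp only [lindbladMap, Matrix.conjTranspose_mul, Matrix.conjTranspose_add,
    Matrix.conjTranspose_smul, Matrix.conjTranspose_conjTranspose, jump_conjTranspose, map_add,
    mul_add, add_mul, smul_mul_assoc, mul_assoc]
  have hs : star (1 / 2 : ℂ) = 1 / 2 := by simp
  rw [hs]
  module

/-- A jump at the time `s` has the amplitude
`(1 - s) A J + s J A = (A J + J A) / 2 + (1 / 2 - s) [A, J]` at this order. The average over `s` in `[0, 1]` of its sandwich with `ρ` contains, besides the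
sandwich of the mean, that of `[A, J]` with the variance `1 / 12` of `s`; the latter is supplied by
level `4`. -/
lemma JumpsCommute.pairing_three_three (hJ : JumpsCommute J) (ρ : SysOp n) :
    pairing K J 3 3 ρ
      = (1 / 6 : ℂ) • jump J (jump J (jump J ρ))
        + (1 / 3 : ℂ) • (noJump K J * (jump J ρ * (noJump K J)ᴴ)
          + jump J (noJump K J * (ρ * (noJump K J)ᴴ)))
        + (1 / 6 : ℂ) • (noJump K J * jump J (ρ * (noJump K J)ᴴ)
          + jump J (noJump K J * ρ) * (noJump K J)ᴴ) := by
  set A := noJump K J with hA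
  have hW : ∀ i, scaledW K J i = ((Real.sqrt 12 : ℂ)⁻¹) • (A * J i - J i * A) := by
    intro i
    rw [scaledW, hJ.emitW_eq, hA, noJump]
    simp only [sub_mul, mul_sub, smul_mul_assoc, mul_smul_comm, smul_sub]
    abel
  have h3 : ∑ i, ∑ j, ∑ k, amp3 k j i (expVec K J 3) * ρ * (J i * (J j * J k))ᴴ
      = jump J (jump J (jump J ρ)) := by
    simp only [jump_apply, Finset.mul_sum, Finset.sum_mul]
    refine Finset.sum_congr rfl fun i _ => Finset.sum_congr rfl fun j _ =>
      Finset.sum_congr rfl fun k _ => ?_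
    have h : amp3 k j i (expVec K J 3) = J i * (J j * J k) := by
      have h1 : ∀ a b c, J a * (J b * J c) = J b * (J a * J c) := fun a b c => by
        rw [← mul_assoc, hJ.mul_comm a b, mul_assoc]
      rw [hJ.expVec_three]
      simp only [map_add, map_smul, amp3_sector3, amp3_sector1, amp3_sector4, add_zero]
      rw [h1 k j i, h1 k i j, hJ.mul_comm k i, hJ.mul_comm k j, h1 j i k]
      module
    rw [h]
    simp only [Matrix.conjTranspose_mul, mul_assoc]
  rw [pairing]
  nth_rw 2 [hJ.expVec_three]
  rw [Matrix.conjTranspose_add, Matrix.conjTranspose_add, mul_add, mul_add, map_add, map_add,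
    traceAnc_sector1, traceAnc_sector4, Matrix.conjTranspose_smul, mul_smul_comm, map_smul,
    traceAnc_sector3, h3]
  have h1 : ∀ i, amp1 i (expVec K J 3) = (1 / 2 : ℂ) • (A * J i + J i * A) := by
    intro i
    rw [hJ.expVec_three]
    simp only [map_add, map_smul, amp1_sector3, amp1_sector1, amp1_sector4, smul_zero, zero_add,
      add_zero, hA]
  have h4 : ∀ i, amp4 i (expVec K J 3) = scaledW K J i := by
    intro i
    rw [hJ.expVec_three]
    simp only [map_add, map_smul, amp4_sector3, amp4_sector1, amp4_sector4, smul_zero, zero_add]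
  have hw : ∀ X Y : SysOp n, (((Real.sqrt 12 : ℂ)⁻¹) • X) * ρ * (((Real.sqrt 12 : ℂ)⁻¹) • Y)ᴴ
      = (1 / 12 : ℂ) • (X * (ρ * Yᴴ)) := by
    intro X Y
    rw [Matrix.conjTranspose_smul, mul_smul_comm, smul_mul_assoc, smul_mul_assoc, smul_smul,
      ← sqrt_twelve_inv_mul_self, mul_assoc]
    simp
  have hs2 : star (1 / 2 : ℂ) = 1 / 2 := by simp
  have hs6 : star (1 / 6 : ℂ) = 1 / 6 := by simp
  simp only [h1, h4, hW, hw]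
  simp only [hs6, ← hA, Matrix.conjTranspose_smul, Matrix.conjTranspose_add,
    Matrix.conjTranspose_sub, Matrix.conjTranspose_mul, hs2, jump_apply, mul_add, add_mul, mul_sub,
    sub_mul, smul_mul_assoc, mul_smul_comm, mul_assoc, Finset.sum_add_distrib,
    Finset.sum_sub_distrib, ← Finset.smul_sum, Finset.mul_sum, Finset.sum_mul, smul_add, smul_sub]
  module

/-- The third Taylor coefficient of the Lindblad evolution. -/
lemma JumpsCommute.pairing_order_six (hJ : JumpsCommute J) (hK : Kᴴ = -K) (ρ : SysOp n) :
    pairing K J 6 0 ρ + pairing K J 5 1 ρ + pairing K J 4 2 ρ + pairing K J 3 3 ρ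
        + pairing K J 2 4 ρ + pairing K J 1 5 ρ + pairing K J 0 6 ρ
      = (1 / 6 : ℂ) • lindbladMap (noJump K J) J
          (lindbladMap (noJump K J) J (lindbladMap (noJump K J) J ρ)) := by
  have h51 : ∀ ρ, pairing K J 5 1 ρ
      = (1 / 6 : ℂ) • (noJump K J * (noJump K J * jump J ρ)
        + noJump K J * jump J (noJump K J * ρ) + jump J (noJump K J * (noJump K J * ρ))) := by
    intro ρ
    rw [pairing_one]
    simp only [hJ.amp1_expVec_five, jump_apply, Finset.mul_sum, ← Finset.sum_add_distrib,
      Finset.smul_sum, add_mul, smul_mul_assoc, mul_assoc]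
  have h42 : ∀ ρ, pairing K J 4 2 ρ
      = (1 / 6 : ℂ) • (noJump K J * jump J (jump J ρ) + jump J (noJump K J * jump J ρ)
          + jump J (jump J (noJump K J * ρ)))
        + (1 / 2 : ℂ) • (noJump K J * (noJump K J * (ρ * (noJump K J)ᴴ))) := by
    intro ρ
    have h1 := sum_sum_jump (J := J) 1 ρ
    have h2 := sum_sum_jump (J := J) 1 (noJump K J * ρ)
    simp only [one_mul, mul_assoc] at h1 h2
    have h3 := sum_sum_jump (J := J) (noJump K J) ρ
    have h4 := hJ.sum_sum_jump_swap (noJump K J) ρ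
    rw [hJ.pairing_two, hJ.amp0_expVec_four]
    simp only [hJ.amp2_expVec_four]
    have h0 : ∑ i, ∑ j, noJump K J * (J i * (J j * (ρ * ((J j)ᴴ * (J i)ᴴ))))
        = noJump K J * jump J (jump J ρ) := by
      rw [← h1]
      simp only [Finset.mul_sum]
    simp only [add_mul, smul_mul_assoc, mul_assoc, smul_add, Finset.sum_add_distrib,
      ← Finset.smul_sum, h0, h2, h3, h4]
    module
  rw [pairing_comm 0 6, pairing_comm 1 5, pairing_comm 2 4, hJ.pairing_three_three, h51, h51, h42,
    h42, pairing_zero, pairing_zero, hJ.amp0_expVec_six hK]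
  have hs2 : star (1 / 2 : ℂ) = 1 / 2 := by simp
  have hs6 : star (1 / 6 : ℂ) = 1 / 6 := by simp
  simp only [lindbladMap, Matrix.conjTranspose_mul, Matrix.conjTranspose_add,
    Matrix.conjTranspose_smul, Matrix.conjTranspose_conjTranspose, jump_conjTranspose, map_add,
    mul_add, add_mul, smul_mul_assoc, mul_assoc, hs2, hs6]
  module

end Matching

/-! ### Parity of the ancilla excitations -/

section Parity

variable {n : ℕ}

/-- The parity of the number of excitations in a level; level `4` counts as odd. -/
def levelParity : Fin 5 → ZMod 2 := ![0, 1, 0, 1, 1]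

/-- The parity of an ancilla configuration. -/
def configParity (a : Anc n) : ZMod 2 := ∑ i, levelParity (a i)

/-- `X` changes the parity of the ancilla configuration by `p`. -/
def HasParity (p : ZMod 2) (X : JointOp n) : Prop :=
  ∀ s a t b, configParity a + configParity b ≠ p → X (s, a) (t, b) = 0

lemma HasParity.zero (p : ZMod 2) : HasParity p (0 : JointOp n) := fun _ _ _ _ _ => rfl

lemma HasParity.add {p : ZMod 2} {X Y : JointOp n} (hX : HasParity p X) (hY : HasParity p Y) :
    HasParity p (X + Y) := fun s a t b h => by
  rw [Matrix.add_apply, hX s a t b h, hY s a t b h, add_zero]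

lemma HasParity.sub {p : ZMod 2} {X Y : JointOp n} (hX : HasParity p X) (hY : HasParity p Y) :
    HasParity p (X - Y) := fun s a t b h => by
  rw [Matrix.sub_apply, hX s a t b h, hY s a t b h, sub_zero]

lemma HasParity.smul {p : ZMod 2} {X : JointOp n} (hX : HasParity p X) (c : ℂ) :
    HasParity p (c • X) := fun s a t b h => by
  rw [Matrix.smul_apply, hX s a t b h, smul_zero]

lemma HasParity.sum {α : Type*} {p : ZMod 2} {f : α → JointOp n} {s : Finset α}
    (h : ∀ i ∈ s, HasParity p (f i)) : HasParity p (∑ i ∈ s, f i) := by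
  classical
  induction s using Finset.induction_on with
  | empty => exact HasParity.zero p
  | insert i s hi ih =>
    rw [Finset.sum_insert hi]
    exact (h i (Finset.mem_insert_self i s)).add
      (ih fun j hj => h j (Finset.mem_insert_of_mem hj))

lemma HasParity.mul {p q : ZMod 2} {X Y : JointOp n} (hX : HasParity p X) (hY : HasParity q Y) :
    HasParity (p + q) (X * Y) := by
  intro s a t b h
  rw [Matrix.mul_apply]
  refine Finset.sum_eq_zero fun r _ => ?_
  obtain ⟨r, c⟩ := r
  by_cases h1 : configParity a + configParity c = p
  · rw [hY r c t b, mul_zero]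
    intro h2
    apply h
    rw [← h1, ← h2]
    have : configParity c + configParity c = 0 := CharTwo.add_self_eq_zero _
    linear_combination -this
  · rw [hX s a r c h1, zero_mul]

lemma HasParity.conjTranspose {p : ZMod 2} {X : JointOp n} (hX : HasParity p X) :
    HasParity p Xᴴ := fun s a t b h => by
  rw [Matrix.conjTranspose_apply, hX t b s a (by rwa [add_comm]), star_zero]

lemma hasParity_kronecker_one (X : SysOp n) : HasParity 0 (sysOp X) := by
  intro s a t b h
  change X s t * (1 : Matrix (Anc n) (Anc n) ℂ) a b = 0
  rw [Matrix.one_apply_ne, mul_zero]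
  rintro rfl
  exact h (CharTwo.add_self_eq_zero _)

lemma hasParity_kronecker_vac (X : SysOp n) : HasParity 0 (X ⊗ₖ vac n) := by
  intro s a t b h
  rw [Matrix.kronecker_apply, vac_apply, if_neg, mul_zero]
  rintro ⟨rfl, rfl⟩
  exact h (CharTwo.add_self_eq_zero _)

lemma hasParity_kronecker_ancOp {p : ZMod 2} {o : Matrix (Fin 5) (Fin 5) ℂ}
    (ho : ∀ k l, levelParity k + levelParity l ≠ p → o k l = 0) (X : SysOp n) (i : Fin n) :
    HasParity p (X ⊗ₖ ancOp i o) := by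
  intro s a t b h
  rw [Matrix.kronecker_apply, ancOp_apply]
  split_ifs with hab
  · rw [ho, mul_zero]
    intro hp
    apply h
    rw [configParity, configParity, ← Finset.sum_add_distrib, Finset.sum_eq_single i]
    · exact hp
    · intro j _ hj
      rw [hab j hj]
      exact CharTwo.add_self_eq_zero _
    · simp
  · rw [mul_zero]

lemma lowering_parity (k l : Fin 5) (h : levelParity k + levelParity l ≠ 1) :
    lowering k l = 0 := by
  fin_cases k <;> fin_cases l <;> first | rfl | exact absurd (by decide) h

lemma toFour_parity (k l : Fin 5) (h : levelParity k + levelParity l ≠ 1) : toFour k l = 0 := by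
  rw [toFour, Matrix.single_apply, if_neg]
  rintro ⟨rfl, rfl⟩
  exact h (by decide)

lemma hasParity_emit (T : Fin n → SysOp n) : HasParity 1 (emit T) :=
  HasParity.sum fun i _ => hasParity_kronecker_ancOp (fun k l h => by
    rw [Matrix.conjTranspose_apply, lowering_parity l k (by rwa [add_comm]), star_zero]) _ _

lemma hasParity_absorb (T : Fin n → SysOp n) : HasParity 1 (absorb T) :=
  HasParity.sum fun _ _ => hasParity_kronecker_ancOp lowering_parity _ _

lemma hasParity_emitFour (T : Fin n → SysOp n) : HasParity 1 (emitFour T) :=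
  HasParity.sum fun _ _ => hasParity_kronecker_ancOp toFour_parity _ _

lemma hasParity_absorbFour (T : Fin n → SysOp n) : HasParity 1 (absorbFour T) :=
  HasParity.sum fun i _ => hasParity_kronecker_ancOp (fun k l h => by
    rw [Matrix.conjTranspose_apply, toFour_parity l k (by rwa [add_comm]), star_zero]) _ _

variable (K : SysOp n) (J : Fin n → SysOp n)

lemma hasParity_genCoeff : ∀ m : ℕ, HasParity (m : ZMod 2) (genCoeff K J m)
  | 0 => HasParity.zero _
  | 1 => by
    rw [Nat.cast_one]
    exact (hasParity_emit J).sub (hasParity_absorb J)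
  | 2 => hasParity_kronecker_one _
  | 3 => ((hasParity_emit _).sub (hasParity_absorb _)).add
      ((hasParity_emitFour _).sub (hasParity_absorbFour _))
  | 4 => hasParity_kronecker_one _
  | 5 => (hasParity_emit _).sub (hasParity_absorb _)
  | 6 => hasParity_kronecker_one _
  | m + 7 => HasParity.zero _

lemma hasParity_powCoeff : ∀ k p : ℕ, HasParity (p : ZMod 2) (powCoeff (genCoeff K J) k p)
  | 0, p => by
    rw [powCoeff]
    split_ifs with h
    · rw [h, Nat.cast_zero]
      simpa using hasParity_kronecker_one (1 : SysOp n)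
    · exact HasParity.zero _
  | k + 1, p => by
    rw [powCoeff]
    refine HasParity.sum fun m hm => ?_
    have h := (hasParity_genCoeff K J m).mul (hasParity_powCoeff k (p - m))
    rwa [← Nat.cast_add, Nat.add_sub_cancel' (Nat.lt_succ_iff.1 (Finset.mem_range.1 hm))] at h

lemma hasParity_expCoeff (p : ℕ) : HasParity (p : ZMod 2) (expCoeff (genCoeff K J) p) :=
  HasParity.sum fun k _ => (hasParity_powCoeff K J k p).smul _

lemma traceAnc_eq_zero_of_odd {X : JointOp n} (h : HasParity 1 X) : traceAnc n X = 0 := by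
  ext s t
  rw [traceAnc_apply]
  refine Finset.sum_eq_zero fun a _ => h s a t a ?_
  rw [CharTwo.add_self_eq_zero]
  decide

end Parity

/-! ### Expansion of the reduced evolution -/

section Expansion

variable {n : ℕ} (K : SysOp n) (J : Fin n → SysOp n)

/-- The generator `∑ m, x ^ m G m`. -/
def genSum (x : ℝ) : JointOp n := ∑ m ∈ Finset.range 10, ((x : ℂ) ^ m) • genCoeff K J m

/-- The reduced evolution with the generator `genSum K J x`. -/
def reducedMap (x : ℝ) : SuperOp (Sys n) :=
  sandwich (NormedSpace.exp (genSum K J x)) (NormedSpace.exp (genSum K J x))ᴴ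

/-- The coefficient of `x ^ p` in `reducedMap K J x`. -/
def reducedCoeff (p : ℕ) : SuperOp (Sys n) :=
  ∑ m ∈ Finset.range (p + 1),
    sandwich (expCoeff (genCoeff K J) m) (expCoeff (genCoeff K J) (p - m))ᴴ

/-- `lindbladMap` as a superoperator. -/
def lindbladOp (A : SysOp n) (J : Fin n → SysOp n) : SuperOp (Sys n) :=
  LinearMap.toContinuousLinearMap (LinearMap.mulLeft ℂ A + LinearMap.mulRight ℂ Aᴴ + jump J)

variable {K J}

@[simp] lemma lindbladOp_apply (A : SysOp n) (J : Fin n → SysOp n) (ρ : SysOp n) :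
    lindbladOp A J ρ = lindbladMap A J ρ := by
  simp [lindbladOp, lindbladMap]

lemma HasJet.conjTranspose {f : ℝ → JointOp n} {a : ℕ → JointOp n} (h : HasJet f a) :
    HasJet (fun x => (f x)ᴴ) (fun p => (a p)ᴴ) := by
  refine (Asymptotics.isBigO_norm_left.1 ?_)
  have h1 := Asymptotics.isBigO_norm_left.2 h
  refine h1.congr_left fun x => ?_
  rw [← Matrix.l2_opNorm_conjTranspose, Matrix.conjTranspose_sub, Matrix.conjTranspose_sum]
  simp

lemma hasJet_genSum : HasJet (genSum K J) (genCoeff K J) := by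
  refine (Asymptotics.isBigO_zero _ _).congr_left fun x => ?_
  rw [genSum, sub_self]

lemma hasJet_reducedMap : HasJet (reducedMap K J) (reducedCoeff K J) := by
  have h := hasJet_genSum (K := K) (J := J) |>.exp rfl
  exact HasJet.bilin (H := SuperOp (Sys n)) h h.conjTranspose (sandwichBilin n)

lemma reducedCoeff_apply (p : ℕ) (ρ : SysOp n) :
    reducedCoeff K J p ρ = ∑ m ∈ Finset.range (p + 1), pairing K J m (p - m) ρ := by
  simp only [reducedCoeff, sum_apply, sandwich_expCoeff]

/-- At odd order the ket and the bra hold numbers of excitations of different parity, and their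
partial trace vanishes. -/
lemma reducedCoeff_of_odd {p : ℕ} (hp : Odd p) : reducedCoeff K J p = 0 := by
  refine Finset.sum_eq_zero fun m hm => ?_
  ext1 ρ
  rw [sandwich_apply]
  have h := (((hasParity_expCoeff K J m).mul (hasParity_kronecker_vac ρ)).mul
    (hasParity_expCoeff K J (p - m)).conjTranspose)
  rw [add_zero, ← Nat.cast_add,
    Nat.add_sub_cancel' (Nat.lt_succ_iff.1 (Finset.mem_range.1 hm)),
    (ZMod.natCast_eq_one_iff_odd).2 hp] at h
  exact traceAnc_eq_zero_of_odd h

/-- The reduced evolution agrees with `exp (x ^ 2 L)` up to the order `x ^ 6`. -/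
lemma JumpsCommute.reducedCoeff_eq (hJ : JumpsCommute J) (hK : Kᴴ = -K) {m : ℕ} (hm : m ≤ 3) :
    reducedCoeff K J (2 * m)
      = ((m.factorial : ℂ)⁻¹) • lindbladOp (noJump K J) J ^ m := by
  ext1 ρ
  rw [reducedCoeff_apply]
  interval_cases m
  · simp [pairing_zero, expVec_zero, amp0_sector0]
  · simp only [Nat.mul_one, Finset.sum_range_succ, Finset.sum_range_zero, zero_add, Nat.reduceSub,
      Nat.factorial, pow_one, smul_apply, lindbladOp_apply, ← pairing_order_two]
    simp only [Nat.cast_one, inv_one, one_smul]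
    abel
  · simp only [Nat.reduceMul, Finset.sum_range_succ, Finset.sum_range_zero, zero_add,
      Nat.reduceSub, Nat.factorial, smul_apply]
    have h : (lindbladOp (noJump K J) J ^ 2) ρ
        = lindbladMap (noJump K J) J (lindbladMap (noJump K J) J ρ) := by
      rw [pow_two, ContinuousLinearMap.mul_def, ContinuousLinearMap.comp_apply, lindbladOp_apply,
        lindbladOp_apply]
    have h1 := hJ.pairing_order_four (K := K) ρ
    rw [one_div] at h1
    rw [h]
    have h6 : ((((1 + 1) * (1 * 1) : ℕ) : ℂ)⁻¹) = 2⁻¹ := by norm_num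
    simp only [Nat.reduceAdd, Nat.reduceMul] at h6 ⊢
    rw [h6, ← h1]
    abel
  · simp only [Nat.reduceMul, Finset.sum_range_succ, Finset.sum_range_zero, zero_add,
      Nat.reduceSub, Nat.factorial, smul_apply]
    have h : (lindbladOp (noJump K J) J ^ 3) ρ = lindbladMap (noJump K J) J
        (lindbladMap (noJump K J) J (lindbladMap (noJump K J) J ρ)) := by
      rw [pow_three, ContinuousLinearMap.mul_def, ContinuousLinearMap.comp_apply,
        ContinuousLinearMap.mul_def, ContinuousLinearMap.comp_apply, lindbladOp_apply,
        lindbladOp_apply, lindbladOp_apply]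
    have h1 := hJ.pairing_order_six hK ρ
    rw [h]
    have h6 : ((((2 + 1) * ((1 + 1) * (1 * 1)) : ℕ) : ℂ)⁻¹) = 1 / 6 := by norm_num
    simp only [Nat.reduceAdd, Nat.reduceMul] at h6 ⊢
    rw [h6, ← h1]
    abel

/-- The coefficient of `x ^ 8` of the dilation error. -/
def errorCoeff (K : SysOp n) (J : Fin n → SysOp n) : SuperOp (Sys n) :=
  (24 : ℂ)⁻¹ • lindbladOp (noJump K J) J ^ 4 - reducedCoeff K J 8

/-- The error of the dilated evolution, as a function of `x = √τ`. -/
def errorMap (K : SysOp n) (J : Fin n → SysOp n) (x : ℝ) : SuperOp (Sys n) :=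
  NormedSpace.exp (((x : ℂ) ^ 2) • lindbladOp (noJump K J) J) - reducedMap K J x

lemma hasJet_single_two {E : Type*} [NormedAddCommGroup E] [NormedSpace ℂ E] (L : E) :
    HasJet (fun x : ℝ => ((x : ℂ) ^ 2) • L) (Pi.single 2 L) := by
  refine (Asymptotics.isBigO_zero _ _).congr_left fun x => ?_
  rw [Finset.sum_eq_single 2]
  · simp
  · intro p _ hp
    rw [Pi.single_eq_of_ne hp, smul_zero]
  · simp

lemma JumpsCommute.hasJet_errorMap (hJ : JumpsCommute J) (hK : Kᴴ = -K) :
    HasJet (errorMap K J) (Pi.single 8 (errorCoeff K J)) := by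
  have h1 : HasJet (fun x : ℝ => NormedSpace.exp (((x : ℂ) ^ 2) • lindbladOp (noJump K J) J))
      (expCoeff (Pi.single 2 (lindbladOp (noJump K J) J))) :=
    HasJet.exp (A := SuperOp (Sys n)) (hasJet_single_two _)
      (Pi.single_eq_of_ne (by norm_num) _)
  refine (h1.sub hasJet_reducedMap).congr fun p hp => ?_
  rcases Nat.even_or_odd' p with ⟨m, rfl | rfl⟩
  · rw [expCoeff_single_two]
    by_cases hm : m ≤ 3
    · rw [hJ.reducedCoeff_eq hK hm, sub_self, Pi.single_eq_of_ne (by omega)]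
    · have : m = 4 := by omega
      subst this
      rw [Pi.single_eq_same, errorCoeff]
      norm_num [Nat.factorial]
  · rw [expCoeff_single_two_of_odd _ ⟨m, rfl⟩, reducedCoeff_of_odd ⟨m, rfl⟩, sub_self,
      Pi.single_eq_of_ne (by omega)]

lemma JumpsCommute.errorMap_isBigO (hJ : JumpsCommute J) (hK : Kᴴ = -K) :
    errorMap K J =O[𝓝[>] (0 : ℝ)] (fun x : ℝ => x ^ 8) :=
  (hJ.hasJet_errorMap hK).isBigO_of_eq_zero (by norm_num)
    fun p hp => Pi.single_eq_of_ne (by omega) _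

lemma JumpsCommute.errorMap_sub_isBigO (hJ : JumpsCommute J) (hK : Kᴴ = -K) :
    (fun x : ℝ => errorMap K J x - ((x : ℂ) ^ 8) • errorCoeff K J)
      =O[𝓝[>] (0 : ℝ)] (fun x : ℝ => x ^ 10) := by
  refine (hJ.hasJet_errorMap hK).congr_left fun x => ?_
  rw [Finset.sum_eq_single 8]
  · rw [Pi.single_eq_same]
  · intro p _ hp
    rw [Pi.single_eq_of_ne hp, smul_zero]
  · simp

end Expansion

/-! ### The dilation -/

section Dilation

variable {n : ℕ}

/-- `-i H` for the Hamiltonian `H = ∑ k, H k`. -/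
def hamGen (H : Fin n → SysOp n) : SysOp n := -Complex.I • ∑ k, H k

/-- The third order dilation. The corrections of the Hamiltonian are linear in it, so they are
distributed over the terms `H k`. The factors of `O` carry the powers of `η = √τ`: as `H_dia` is
multiplied by `τ = η ^ 2`, the leading term is of order `η⁻¹`. -/
def dilation (H J : Fin n → SysOp n) : DilationData n 4 where
  h k η := H k + ((η : ℂ) ^ 2) • ham4 (H k) J + ((η : ℂ) ^ 4) • ham6 (H k) J
  S i := ![J i, emit3 J i, emit5 (hamGen H) J i, emitW (hamGen H) J i]
  O _ k η := ![(-Complex.I * (η : ℂ)⁻¹) • lowering, (-Complex.I * (η : ℂ)) • lowering,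
    (-Complex.I * (η : ℂ) ^ 3) • lowering,
    (-Complex.I * (η : ℂ) * (Real.sqrt 12 : ℂ)⁻¹) • toFourᴴ] k

variable {H J : Fin n → SysOp n}

lemma hamGen_conjTranspose (hH : ∀ i, (H i).IsHermitian) : (hamGen H)ᴴ = -hamGen H := by
  rw [hamGen, Matrix.conjTranspose_smul, Matrix.conjTranspose_sum]
  simp only [fun i => (hH i).eq, star_neg, Complex.star_def, Complex.conj_I]
  module

lemma ham4_sum (c : ℂ) : ham4 (c • ∑ k, H k) J = c • ∑ k, ham4 (H k) J := by
  simp only [ham4, map_smul, map_sum, Finset.smul_sum, smul_comm c]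

lemma exists_linearMap_ham6 (J : Fin n → SysOp n) :
    ∃ φ : SysOp n →ₗ[ℂ] SysOp n, ∀ X, ham6 X J = φ X := by
  refine ⟨(1 / 90 : ℂ) • (heisenberg J ∘ₗ heisenberg J
    + ∑ i, (LinearMap.mulRight ℂ (selfComm J i * J i)
        ∘ₗ (LinearMap.mulRight ℂ (J i)ᴴ - LinearMap.mulLeft ℂ (J i)ᴴ)
      + LinearMap.mulLeft ℂ ((J i)ᴴ * selfComm J i)
        ∘ₗ (LinearMap.mulLeft ℂ (J i) - LinearMap.mulRight ℂ (J i)))), fun X => ?_⟩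
  simp [ham6, mul_assoc]

lemma ham6_sum (c : ℂ) : ham6 (c • ∑ k, H k) J = c • ∑ k, ham6 (H k) J := by
  obtain ⟨φ, hφ⟩ := exists_linearMap_ham6 J
  simp only [hφ, map_smul, map_sum]

lemma heisenberg_conjTranspose (X : SysOp n) : (heisenberg J X)ᴴ = heisenberg J Xᴴ := by
  simp only [heisenberg_apply, Matrix.conjTranspose_sub, Matrix.conjTranspose_smul,
    Matrix.conjTranspose_add, Matrix.conjTranspose_mul, numOp_conjTranspose, jumpDual_conjTranspose]
  rw [add_comm]
  simp

lemma ham4_isHermitian {X : SysOp n} (hX : X.IsHermitian) : (ham4 X J).IsHermitian := by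
  rw [Matrix.IsHermitian, ham4, Matrix.conjTranspose_smul, heisenberg_conjTranspose, hX.eq]
  simp

lemma ham6_isHermitian {X : SysOp n} (hX : X.IsHermitian) : (ham6 X J).IsHermitian := by
  rw [Matrix.IsHermitian, ham6, Matrix.conjTranspose_smul, Matrix.conjTranspose_add,
    heisenberg_conjTranspose, heisenberg_conjTranspose, hX.eq, Matrix.conjTranspose_sum]
  congr 1
  · simp
  congr 1
  refine Finset.sum_congr rfl fun i _ => ?_
  simp only [Matrix.conjTranspose_add, Matrix.conjTranspose_mul, Matrix.conjTranspose_sub,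
    Matrix.conjTranspose_conjTranspose, selfComm_conjTranspose, hX.eq, mul_assoc]
  abel

lemma dilation_h_isHermitian (hH : ∀ i, (H i).IsHermitian) (i : Fin n) (η : ℝ) :
    ((dilation H J).h i η).IsHermitian := by
  have hs : ∀ (m : ℕ), IsSelfAdjoint ((η : ℂ) ^ m) := fun m => by
    rw [IsSelfAdjoint, star_pow, Complex.star_def, Complex.conj_ofReal]
  exact ((hH i).add ((ham4_isHermitian (hH i)).smul (hs 2))).add
    ((ham6_isHermitian (hH i)).smul (hs 4))

lemma hamiltonian_isHermitian (hH : ∀ i, (H i).IsHermitian) (η : ℝ) :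
    ((dilation H J).hamiltonian η).IsHermitian := by
  rw [Matrix.IsHermitian, DilationData.hamiltonian, Matrix.conjTranspose_add,
    Matrix.conjTranspose_kronecker, Matrix.conjTranspose_one, Matrix.conjTranspose_sum,
    Matrix.conjTranspose_sum]
  simp only [fun i => (dilation_h_isHermitian (J := J) hH i η).eq, Matrix.conjTranspose_add,
    Matrix.conjTranspose_conjTranspose]
  simp only [add_comm]

lemma emit_sub_absorb (T : Fin n → SysOp n) :
    emit T - absorb T = ∑ i, (T i ⊗ₖ cr i - (T i)ᴴ ⊗ₖ lw i) := by
  rw [emit, absorb, Finset.sum_sub_distrib]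

lemma dilation_coupling (η : ℝ) (i : Fin n) : (dilation H J).coupling η i
    = (-Complex.I * (η : ℂ)⁻¹) • ((J i)ᴴ ⊗ₖ lw i) + (-Complex.I * (η : ℂ)) • ((emit3 J i)ᴴ ⊗ₖ lw i)
      + (-Complex.I * (η : ℂ) ^ 3) • ((emit5 (hamGen H) J i)ᴴ ⊗ₖ lw i)
      + (-Complex.I * (η : ℂ)) • ((scaledW (hamGen H) J i)ᴴ ⊗ₖ dx i) := by
  have h : (scaledW (hamGen H) J i)ᴴ = (Real.sqrt 12 : ℂ)⁻¹ • (emitW (hamGen H) J i)ᴴ := by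
    rw [scaledW, Matrix.conjTranspose_smul]
    simp
  rw [DilationData.coupling, Fin.sum_univ_four, h, Matrix.smul_kronecker, smul_smul]
  simp only [dilation, Matrix.cons_val, ancOp_smul, Matrix.kronecker_smul]
  rfl

/-- In terms of `x = √τ`, the dilated evolution has the generator `genSum`. -/
lemma hamiltonian_eq_genSum {x : ℝ} (hx : x ≠ 0) :
    (-(Complex.I * ((x ^ 2 : ℝ) : ℂ))) • (dilation H J).hamiltonian x = genSum (hamGen H) J x := by
  have hx' : (x : ℂ) ≠ 0 := Complex.ofReal_ne_zero.2 hx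
  have h1 : genSum (hamGen H) J x = sysOp (((x : ℂ) ^ 2) • hamGen H
        + ((x : ℂ) ^ 4) • ham4 (hamGen H) J + ((x : ℂ) ^ 6) • ham6 (hamGen H) J)
      + ∑ i, (((x : ℂ)) • (J i ⊗ₖ cr i - (J i)ᴴ ⊗ₖ lw i)
        + ((x : ℂ) ^ 3) • (emit3 J i ⊗ₖ cr i - (emit3 J i)ᴴ ⊗ₖ lw i
          + (scaledW (hamGen H) J i ⊗ₖ ex i - (scaledW (hamGen H) J i)ᴴ ⊗ₖ dx i))
        + ((x : ℂ) ^ 5) • (emit5 (hamGen H) J i ⊗ₖ cr i - (emit5 (hamGen H) J i)ᴴ ⊗ₖ lw i)) := by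
    simp only [genSum, Finset.sum_range_succ, Finset.sum_range_zero, genCoeff, emit_sub_absorb,
      emitFour, absorbFour, ← Finset.sum_sub_distrib, Finset.sum_add_distrib, ← Finset.smul_sum,
      smul_zero, add_zero, zero_add, pow_one, Matrix.add_kronecker, Matrix.smul_kronecker]
    module
  have h2 : (-(Complex.I * ((x ^ 2 : ℝ) : ℂ))) • ∑ i, (dilation H J).h i x
      = ((x : ℂ) ^ 2) • hamGen H
        + ((x : ℂ) ^ 4) • ham4 (hamGen H) J + ((x : ℂ) ^ 6) • ham6 (hamGen H) J := by
    rw [hamGen, ham4_sum, ham6_sum]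
    simp only [dilation, Finset.sum_add_distrib, ← Finset.smul_sum]
    push_cast
    module
  rw [h1, ← h2, DilationData.hamiltonian, smul_add, ← Matrix.smul_kronecker]
  congr 1
  rw [Finset.smul_sum]
  refine Finset.sum_congr rfl fun i _ => ?_
  rw [dilation_coupling]
  simp only [Matrix.conjTranspose_add, Matrix.conjTranspose_smul, Matrix.conjTranspose_kronecker,
    Matrix.conjTranspose_conjTranspose, lw_conjTranspose, dx_conjTranspose]
  have hs : star (-Complex.I * (x : ℂ)⁻¹) = Complex.I * (x : ℂ)⁻¹ := by simp
  have hs1 : star (-Complex.I * (x : ℂ)) = Complex.I * (x : ℂ) := by simp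
  have hs3 : star (-Complex.I * (x : ℂ) ^ 3) = Complex.I * (x : ℂ) ^ 3 := by simp
  rw [hs, hs1, hs3]
  have e1 : -(Complex.I * ((x ^ 2 : ℝ) : ℂ)) * (-Complex.I * (x : ℂ)⁻¹) = -(x : ℂ) := by
    push_cast
    field_simp
    linear_combination Complex.I_sq
  have e1' : -(Complex.I * ((x ^ 2 : ℝ) : ℂ)) * (Complex.I * (x : ℂ)⁻¹) = (x : ℂ) := by
    linear_combination -e1
  have e3 : -(Complex.I * ((x ^ 2 : ℝ) : ℂ)) * (-Complex.I * (x : ℂ)) = -(x : ℂ) ^ 3 := by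
    push_cast
    linear_combination (x : ℂ) ^ 3 * Complex.I_sq
  have e3' : -(Complex.I * ((x ^ 2 : ℝ) : ℂ)) * (Complex.I * (x : ℂ)) = (x : ℂ) ^ 3 := by
    linear_combination -e3
  have e5 : -(Complex.I * ((x ^ 2 : ℝ) : ℂ)) * (-Complex.I * (x : ℂ) ^ 3) = -(x : ℂ) ^ 5 := by
    push_cast
    linear_combination (x : ℂ) ^ 5 * Complex.I_sq
  have e5' : -(Complex.I * ((x ^ 2 : ℝ) : ℂ)) * (Complex.I * (x : ℂ) ^ 3) = (x : ℂ) ^ 5 := by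
    linear_combination -e5
  simp only [smul_add, smul_smul, e1, e1', e3, e3', e5, e5']
  module

lemma lindbladian_eq (hH : ∀ i, (H i).IsHermitian) :
    lindbladian H J = lindbladOp (noJump (hamGen H) J) J := by
  ext1 ρ
  have h1 : lindbladian H J ρ = -Complex.I • ((∑ i, H i) * ρ - ρ * ∑ i, H i)
      + ∑ i, (J i * ρ * (J i)ᴴ - (1 / 2 : ℂ) • ((J i)ᴴ * J i * ρ + ρ * ((J i)ᴴ * J i))) := by
    simp [lindbladian, hamiltonianPart, dissipator, mul_assoc]
  rw [h1, lindbladOp_apply, lindbladMap, noJump, Matrix.conjTranspose_sub,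
    Matrix.conjTranspose_smul, numOp_conjTranspose, hamGen_conjTranspose hH, jump_apply, hamGen]
  have hs : star (1 / 2 : ℂ) = 1 / 2 := by simp
  simp only [hs, numOp, Finset.sum_sub_distrib, ← Finset.smul_sum, Finset.sum_add_distrib,
    sub_mul, mul_sub, mul_neg, smul_mul_assoc, mul_smul_comm, Finset.sum_mul, Finset.mul_sum,
    mul_assoc]
  module

lemma dilationError_sq (hH : ∀ i, (H i).IsHermitian) {x : ℝ} (hx : 0 < x) :
    dilationError H J (dilation H J) (x ^ 2) = errorMap (hamGen H) J x := by
  rw [dilationError, errorMap, lindbladian_eq hH, DilationData.channel, reducedEvolution_eq,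
    Real.sqrt_sq hx.le, reducedMap]
  congr 2
  · push_cast
    rfl
  · rw [hamiltonian_eq_genSum hx.ne']
  · rw [← Matrix.exp_conjTranspose, ← hamiltonian_eq_genSum hx.ne', Matrix.conjTranspose_smul,
      (hamiltonian_isHermitian hH x).eq]
    congr 2
    simp

end Dilation

/-! ### Supports -/

section ActsOn

variable {G : Type} [AddCommGroup G] {V W : AddSubgroup G} {A B : Matrix G G ℂ}

/-- The operator `A` shifts a configuration only by elements of `V`, and it is invariant under
simultaneous shifts by elements of `W`. If `V` consists of the configurations that vanish off a set
of sites and `W` of those that vanish on it, this means that `A` acts on these sites only. -/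
def ActsOn (V W : AddSubgroup G) (A : Matrix G G ℂ) : Prop :=
  (∀ s t, t - s ∉ V → A s t = 0) ∧ ∀ s t, ∀ d ∈ W, A (s + d) (t + d) = A s t

lemma ActsOn.mono {V' W' : AddSubgroup G} (hV : V ≤ V') (hW : W' ≤ W) (hA : ActsOn V W A) :
    ActsOn V' W' A :=
  ⟨fun s t h => hA.1 s t fun h' => h (hV h'), fun s t d h => hA.2 s t d (hW h)⟩

lemma actsOn_zero (V W : AddSubgroup G) : ActsOn V W (0 : Matrix G G ℂ) :=
  ⟨fun _ _ _ => rfl, fun _ _ _ _ => rfl⟩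

lemma actsOn_one [DecidableEq G] (V W : AddSubgroup G) : ActsOn V W (1 : Matrix G G ℂ) := by
  refine ⟨fun s t h => Matrix.one_apply_ne ?_, fun s t d _ => ?_⟩
  · rintro rfl
    exact h (by simp)
  · simp [Matrix.one_apply]

lemma ActsOn.add (hA : ActsOn V W A) (hB : ActsOn V W B) : ActsOn V W (A + B) := by
  refine ⟨fun s t h => ?_, fun s t d h => ?_⟩
  · rw [Matrix.add_apply, hA.1 s t h, hB.1 s t h, add_zero]
  · rw [Matrix.add_apply, Matrix.add_apply, hA.2 s t d h, hB.2 s t d h]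

lemma ActsOn.smul (hA : ActsOn V W A) (c : ℂ) : ActsOn V W (c • A) := by
  refine ⟨fun s t h => ?_, fun s t d h => ?_⟩
  · rw [Matrix.smul_apply, hA.1 s t h, smul_zero]
  · rw [Matrix.smul_apply, Matrix.smul_apply, hA.2 s t d h]

lemma ActsOn.conjTranspose (hA : ActsOn V W A) : ActsOn V W Aᴴ := by
  refine ⟨fun s t h => ?_, fun s t d h => ?_⟩
  · rw [Matrix.conjTranspose_apply, hA.1 t s, star_zero]
    rwa [← neg_sub, neg_mem_iff]
  · rw [Matrix.conjTranspose_apply, Matrix.conjTranspose_apply, hA.2 t s d h]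

lemma ActsOn.mul [Fintype G] (hA : ActsOn V W A) (hB : ActsOn V W B) : ActsOn V W (A * B) := by
  refine ⟨fun s t h => ?_, fun s t d h => ?_⟩
  · rw [Matrix.mul_apply]
    refine Finset.sum_eq_zero fun r _ => ?_
    by_cases h1 : r - s ∈ V
    · rw [hB.1 r t fun h2 => h (by simpa using add_mem h1 h2), mul_zero]
    · rw [hA.1 s r h1, zero_mul]
  · rw [Matrix.mul_apply, Matrix.mul_apply, ← Equiv.sum_comp (Equiv.addRight d)]
    refine Finset.sum_congr rfl fun r _ => ?_
    rw [Equiv.coe_addRight, hA.2 s r d h, hB.2 r t d h]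

/-- Operators on disjoint sets of sites commute. The sums over the intermediate configuration `r` in
the two products correspond to each other under `r ↦ s + t - r`. -/
lemma ActsOn.commute [Fintype G] {V' W' : AddSubgroup G} (hV : V ≤ W') (hV' : V' ≤ W)
    (hA : ActsOn V W A) (hB : ActsOn V' W' B) : Commute A B := by
  ext s t
  rw [Matrix.mul_apply, Matrix.mul_apply, ← Equiv.sum_comp (Equiv.subLeft (s + t))]
  refine Finset.sum_congr rfl fun r _ => ?_
  rw [Equiv.subLeft_apply]
  by_cases h1 : t - r ∈ V
  · by_cases h2 : r - s ∈ V'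
    · have e1 := hA.2 r t (s - r) (by simpa using neg_mem (hV' h2))
      have e2 := hB.2 s r (t - r) (hV h1)
      rw [show r + (s - r) = s by abel, show t + (s - r) = s + t - r by abel] at e1
      rw [show s + (t - r) = s + t - r by abel, show r + (t - r) = t by abel] at e2
      rw [e1, e2, mul_comm]
    · rw [hB.1 s r h2, zero_mul, hB.1 _ t, mul_zero]
      rwa [show t - (s + t - r) = r - s by abel]
  · rw [hA.1 r t h1, mul_zero, hA.1 s, zero_mul]
    rwa [show s + t - r - s = t - r by abel]

lemma ActsOn.kronecker {G' : Type} [AddCommGroup G'] {V' W' : AddSubgroup G'}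
    {B : Matrix G' G' ℂ} (hA : ActsOn V W A) (hB : ActsOn V' W' B) :
    ActsOn (V.prod V') (W.prod W') (A ⊗ₖ B) := by
  refine ⟨fun s t h => ?_, fun s t d h => ?_⟩
  · rw [Matrix.kronecker_apply]
    by_cases h1 : t.1 - s.1 ∈ V
    · rw [hB.1 s.2 t.2 fun h2 => h ⟨h1, h2⟩, mul_zero]
    · rw [hA.1 s.1 t.1 h1, zero_mul]
  · exact congrArg₂ (· * ·) (hA.2 s.1 t.1 d.1 h.1) (hB.2 s.2 t.2 d.2 h.2)

variable [Fintype G] [DecidableEq G]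

/-- The algebra of operators that act on given sites. -/
def actsOnAlgebra (V W : AddSubgroup G) : Subalgebra ℂ (Matrix G G ℂ) where
  carrier := {A | ActsOn V W A}
  mul_mem' := ActsOn.mul
  add_mem' := ActsOn.add
  algebraMap_mem' c := by
    rw [Algebra.algebraMap_eq_smul_one]
    exact (actsOn_one V W).smul c

lemma ActsOn.exp (hA : ActsOn V W A) : ActsOn V W (NormedSpace.exp A) :=
  NormedSpace.exp_mem (s := actsOnAlgebra V W)
    (Submodule.closed_of_finiteDimensional (Subalgebra.toSubmodule (actsOnAlgebra V W))) hA

lemma ActsOn.sum {α : Type*} {s : Finset α} {f : α → Matrix G G ℂ}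
    (h : ∀ i ∈ s, ActsOn V W (f i)) : ActsOn V W (∑ i ∈ s, f i) :=
  Subalgebra.sum_mem (actsOnAlgebra V W) h

lemma ActsOn.sub (hA : ActsOn V W A) (hB : ActsOn V W B) : ActsOn V W (A - B) :=
  Subalgebra.sub_mem (actsOnAlgebra V W) hA hB

end ActsOn

section Support

variable {n : ℕ}

/-- The configurations that vanish off `X`. -/
def zeroOff {ι α : Type} [AddCommGroup α] (X : Set ι) : AddSubgroup (ι → α) where
  carrier := {d | ∀ k, k ∉ X → d k = 0}
  zero_mem' _ _ := rfl
  add_mem' ha hb k hk := by rw [Pi.add_apply, ha k hk, hb k hk, add_zero]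
  neg_mem' ha k hk := by rw [Pi.neg_apply, ha k hk, neg_zero]

/-- The configurations that vanish on `X`. -/
def zeroOn {ι α : Type} [AddCommGroup α] (X : Set ι) : AddSubgroup (ι → α) where
  carrier := {d | ∀ k ∈ X, d k = 0}
  zero_mem' _ _ := rfl
  add_mem' ha hb k hk := by rw [Pi.add_apply, ha k hk, hb k hk, add_zero]
  neg_mem' ha k hk := by rw [Pi.neg_apply, ha k hk, neg_zero]

lemma zeroOff_le_zeroOn {ι α : Type} [AddCommGroup α] {X Y : Set ι} (h : Disjoint X Y) :
    (zeroOff X : AddSubgroup (ι → α)) ≤ zeroOn Y :=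
  fun _ hd k hk => hd k (Set.disjoint_right.1 h hk)

lemma zeroOff_mono {ι α : Type} [AddCommGroup α] {X Y : Set ι} (h : X ⊆ Y) :
    (zeroOff X : AddSubgroup (ι → α)) ≤ zeroOff Y :=
  fun _ hd k hk => hd k fun hk' => hk (h hk')

lemma zeroOn_anti {ι α : Type} [AddCommGroup α] {X Y : Set ι} (h : X ⊆ Y) :
    (zeroOn Y : AddSubgroup (ι → α)) ≤ zeroOn X :=
  fun _ hd k hk => hd k (h hk)

variable {X Y : Set (Fin (n + 1))} {A B : SysOp n}

lemma supportedOn_iff : SupportedOn X A ↔ ActsOn (zeroOff X) (zeroOn X) A := by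
  classical
  have hmem : ∀ s t : Sys n, t - s ∈ zeroOff X ↔ ∀ k, k ∉ X → s k = t k := fun s t =>
    forall₂_congr fun k _ => by rw [Pi.sub_apply, sub_eq_zero, eq_comm]
  constructor
  · rintro ⟨M, hM⟩
    refine ⟨fun s t h => (hM s t).2 (by rwa [← hmem]), fun s t d hd => ?_⟩
    by_cases h : ∀ k, k ∉ X → s k = t k
    · rw [(hM s t).1 h, (hM (s + d) (t + d)).1 fun k hk => by simp [h k hk]]
      congr 1 <;> ext k <;> simp [hd k k.2]
    · rw [(hM s t).2 h, (hM (s + d) (t + d)).2 fun h' => h fun k hk => by simpa using h' k hk]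
  · rintro ⟨h1, h2⟩
    refine ⟨Matrix.of fun u v => A (fun k => if hk : k ∈ X then u ⟨k, hk⟩ else 0)
      (fun k => if hk : k ∈ X then v ⟨k, hk⟩ else 0), fun s t => ⟨fun h => ?_, fun h =>
        h1 s t (by rwa [hmem])⟩⟩
    rw [Matrix.of_apply, ← h2 s t (fun k => if k ∈ X then 0 else -s k)
      fun k hk => by simp [hk]]
    congr 1 <;> ext k <;> by_cases hk : k ∈ X <;> simp [hk]
    simp [h k hk]

lemma SupportedOn.mono (h : X ⊆ Y) (hA : SupportedOn X A) : SupportedOn Y A :=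
  supportedOn_iff.2 ((supportedOn_iff.1 hA).mono (zeroOff_mono h) (zeroOn_anti h))

lemma SupportedOn.zero (X : Set (Fin (n + 1))) : SupportedOn X (0 : SysOp n) :=
  supportedOn_iff.2 (actsOn_zero _ _)

lemma SupportedOn.add (hA : SupportedOn X A) (hB : SupportedOn X B) : SupportedOn X (A + B) :=
  supportedOn_iff.2 ((supportedOn_iff.1 hA).add (supportedOn_iff.1 hB))

lemma SupportedOn.smul (hA : SupportedOn X A) (c : ℂ) : SupportedOn X (c • A) :=
  supportedOn_iff.2 ((supportedOn_iff.1 hA).smul c)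

lemma SupportedOn.sub (hA : SupportedOn X A) (hB : SupportedOn X B) : SupportedOn X (A - B) :=
  supportedOn_iff.2 ((supportedOn_iff.1 hA).sub (supportedOn_iff.1 hB))

lemma SupportedOn.conjTranspose (hA : SupportedOn X A) : SupportedOn X Aᴴ :=
  supportedOn_iff.2 (supportedOn_iff.1 hA).conjTranspose

lemma SupportedOn.mul (hA : SupportedOn X A) (hB : SupportedOn X B) : SupportedOn X (A * B) :=
  supportedOn_iff.2 ((supportedOn_iff.1 hA).mul (supportedOn_iff.1 hB))

lemma SupportedOn.sum {α : Type*} {s : Finset α} {f : α → SysOp n}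
    (h : ∀ i ∈ s, SupportedOn X (f i)) : SupportedOn X (∑ i ∈ s, f i) :=
  supportedOn_iff.2 (ActsOn.sum fun i hi => supportedOn_iff.1 (h i hi))

lemma SupportedOn.commute (h : Disjoint X Y) (hA : SupportedOn X A) (hB : SupportedOn Y B) :
    Commute A B :=
  (supportedOn_iff.1 hA).commute (zeroOff_le_zeroOn h) (zeroOff_le_zeroOn h.symm)
    (supportedOn_iff.1 hB)

lemma actsOn_ancOp {S : Set (Fin n)} {i : Fin n} (hi : i ∈ S) (o : Matrix (Fin 5) (Fin 5) ℂ) :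
    ActsOn (zeroOff S) (zeroOn S) (ancOp i o) := by
  refine ⟨fun a b h => ?_, fun a b d hd => ?_⟩
  · rw [ancOp_apply, if_neg]
    intro h'
    refine h fun k hk => ?_
    rw [Pi.sub_apply, h' k (fun hki => hk (hki ▸ hi)), sub_self]
  · simp [ancOp_apply, hd i hi]

end Support

section Locality

variable {n : ℕ}

/-- The bonds `i` and `k` differ by at most `r`. -/
def Near (r : ℕ) (i k : Fin n) : Prop := (i : ℕ) ≤ k + r ∧ (k : ℕ) ≤ i + r

lemma bondNhd_subset {r r' m : ℕ} {i k : Fin n} (h : Near m i k) (hr : r + m ≤ r') :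
    bondNhd r i ⊆ bondNhd r' k := by
  rintro l ⟨h1, h2⟩
  obtain ⟨h3, h4⟩ := h
  constructor <;> omega

lemma disjoint_bondNhd {r : ℕ} {i k : Fin n} (h : ¬ Near (r + 1) i k) :
    Disjoint (bondNhd 0 i) (bondNhd r k) := by
  refine Set.disjoint_left.2 ?_
  rintro l ⟨h1, h2⟩ ⟨h3, h4⟩
  refine h ⟨?_, ?_⟩ <;> omega

/-- A sum of local terms close to the bond `k`. -/
lemma norm_sum_near_le {f : Fin n → SysOp n} {k : Fin n} {r : ℕ} {B : ℝ}
    (h0 : ∀ i, ¬ Near r i k → f i = 0) (hB : ∀ i, ‖f i‖ ≤ B) :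
    ‖∑ i, f i‖ ≤ (2 * r + 1) * B := by
  classical
  have hB0 : 0 ≤ B := (norm_nonneg _).trans (hB k)
  have h1 : ∑ i, f i = ∑ i with Near r i k, f i := by
    rw [Finset.sum_filter]
    refine Finset.sum_congr rfl fun i _ => ?_
    split_ifs with h
    · rfl
    · exact h0 i h
  rw [h1]
  refine (norm_sum_le_of_le _ fun i _ => hB i).trans ?_
  rw [Finset.sum_const, nsmul_eq_mul]
  refine mul_le_mul_of_nonneg_right ?_ hB0
  have h2 : (Finset.univ.filter fun i : Fin n => Near r i k).card
      ≤ (Finset.Icc ((k : ℕ) - r) (k + r)).card := by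
    refine Finset.card_le_card_of_injOn (fun i => (i : ℕ)) (fun i hi => ?_)
      (fun i _ j _ h => Fin.ext h)
    obtain ⟨h3, h4⟩ := (Finset.mem_filter.1 hi).2
    simp only [Finset.coe_Icc, Set.mem_Icc]
    omega
  rw [Nat.card_Icc] at h2
  have h3 : (Finset.univ.filter fun i : Fin n => Near r i k).card ≤ 2 * r + 1 := by omega
  exact_mod_cast h3

lemma supportedOn_sum_near {f : Fin n → SysOp n} {k : Fin n} {r : ℕ} {X : Set (Fin (n + 1))}
    (h0 : ∀ i, ¬ Near r i k → f i = 0) (hs : ∀ i, Near r i k → SupportedOn X (f i)) :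
    SupportedOn X (∑ i, f i) := by
  refine SupportedOn.sum fun i _ => ?_
  by_cases h : Near r i k
  · exact hs i h
  · rw [h0 i h]
    exact SupportedOn.zero X

end Locality

/-! ### Locality of the dilation -/

section LocalBounds

variable {n : ℕ} {H J : Fin n → SysOp n} {b : ℝ}

lemma norm_smul_le_of_le {c : ℂ} {X : SysOp n} {x : ℝ} (hX : ‖X‖ ≤ x) : ‖c • X‖ ≤ ‖c‖ * x :=
  (norm_smul_le c X).trans (mul_le_mul_of_nonneg_left hX (norm_nonneg c))

lemma norm_conjTranspose_le {X : SysOp n} {x : ℝ} (hX : ‖X‖ ≤ x) : ‖Xᴴ‖ ≤ x :=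
  (Matrix.l2_opNorm_conjTranspose X).trans_le hX

lemma norm_selfComm_le {i : Fin n} (hJ : ‖J i‖ ≤ b) : ‖selfComm J i‖ ≤ 2 * b ^ 2 :=
  (norm_sub_le_of_le (norm_mul_le_of_le (norm_conjTranspose_le hJ) hJ)
    (norm_mul_le_of_le hJ (norm_conjTranspose_le hJ))).trans_eq (by ring)

lemma norm_commutator_le {X Y : SysOp n} {x y : ℝ} (hX : ‖X‖ ≤ x) (hY : ‖Y‖ ≤ y) :
    ‖X * Y - Y * X‖ ≤ 2 * x * y :=
  (norm_sub_le_of_le (norm_mul_le_of_le hX hY) (norm_mul_le_of_le hY hX)).trans_eq (by ring)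

lemma norm_selfComm_mul_le {i : Fin n} (hJ : ‖J i‖ ≤ b) : ‖selfComm J i * J i‖ ≤ 2 * b ^ 3 :=
  (norm_mul_le_of_le (norm_selfComm_le hJ) hJ).trans_eq (by ring)

lemma norm_emit3_le {i : Fin n} (hJ : ‖J i‖ ≤ b) : ‖emit3 J i‖ ≤ b ^ 3 := by
  refine (norm_smul_le_of_le (norm_selfComm_mul_le hJ)).trans ?_
  have : 0 ≤ b := (norm_nonneg _).trans hJ
  norm_num
  nlinarith [pow_nonneg this 3]

lemma norm_emitW_le {K : SysOp n} {i : Fin n} {κ : ℝ} (hJ : ‖J i‖ ≤ b)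
    (hK : ‖K * J i - J i * K‖ ≤ κ) : ‖emitW K J i‖ ≤ κ + b ^ 3 := by
  refine (norm_sub_le_of_le hK (norm_smul_le_of_le (norm_selfComm_mul_le hJ))).trans_eq ?_
  norm_num
  ring

lemma norm_emit5_le {K : SysOp n} {i : Fin n} {κ : ℝ} (hJ : ‖J i‖ ≤ b)
    (hK : ‖K * J i - J i * K‖ ≤ κ) : ‖emit5 K J i‖ ≤ b ^ 5 + b ^ 2 * κ := by
  have h0 : 0 ≤ b := (norm_nonneg _).trans hJ
  have hκ : 0 ≤ κ := (norm_nonneg _).trans hK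
  have hJ' := norm_conjTranspose_le hJ
  have hC := norm_selfComm_le hJ
  have hCJ := norm_selfComm_mul_le hJ
  have h1 := norm_sub_le_of_le
    (norm_mul_le_of_le (norm_mul_le_of_le (norm_mul_le_of_le hJ' hC) hJ) hJ)
    (norm_mul_le_of_le hJ (norm_mul_le_of_le (norm_mul_le_of_le hJ' hC) hJ))
  have h2 := norm_commutator_le (norm_mul_le_of_le hJ' hJ) hCJ
  have h3 := norm_mul_le_of_le hC hCJ
  refine (norm_add_le_of_le (norm_smul_le_of_le (norm_sub_le_of_le
    (norm_add_le_of_le (norm_smul_le_of_le h1) h2) (norm_smul_le_of_le h3)))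
    (norm_smul_le_of_le (norm_mul_le_of_le hC hK))).trans ?_
  norm_num
  nlinarith [pow_nonneg h0 5, mul_nonneg (pow_nonneg h0 2) hκ]

/-- The contribution of bond `i` to `heisenberg J X`. -/
def heisenbergTerm (J : Fin n → SysOp n) (X : SysOp n) (i : Fin n) : SysOp n :=
  (J i)ᴴ * X * J i - (1 / 2 : ℂ) • ((J i)ᴴ * J i * X + X * ((J i)ᴴ * J i))

lemma heisenberg_eq_sum (X : SysOp n) : heisenberg J X = ∑ i, heisenbergTerm J X i := by
  simp only [heisenberg_apply, jumpDual_apply, heisenbergTerm, numOp, Finset.sum_sub_distrib,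
    ← Finset.smul_sum, Finset.sum_add_distrib, Finset.sum_mul, Finset.mul_sum]

lemma norm_heisenbergTerm_le {X : SysOp n} {i : Fin n} {c : ℝ} (hJ : ‖J i‖ ≤ b) (hX : ‖X‖ ≤ c) :
    ‖heisenbergTerm J X i‖ ≤ 2 * b ^ 2 * c := by
  have hJ' := norm_conjTranspose_le hJ
  refine (norm_sub_le_of_le (norm_mul_le_of_le (norm_mul_le_of_le hJ' hX) hJ)
    (norm_smul_le_of_le (norm_add_le_of_le (norm_mul_le_of_le (norm_mul_le_of_le hJ' hJ) hX)
      (norm_mul_le_of_le hX (norm_mul_le_of_le hJ' hJ))))).trans_eq ?_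
  norm_num
  ring

lemma heisenbergTerm_eq_zero {X : SysOp n} {i : Fin n} (h : Commute (J i) X)
    (h' : Commute (J i)ᴴ X) : heisenbergTerm J X i = 0 := by
  have h2 : X * ((J i)ᴴ * J i) = (J i)ᴴ * J i * X := ((h'.mul_left h).eq).symm
  rw [heisenbergTerm, h2, mul_assoc _ X, ← h.eq, ← mul_assoc]
  module

/-- The operators `T i` act on the two sites of the bond `i`, with norms at most `b`. -/
def LocalTerms (b : ℝ) (T : Fin n → SysOp n) : Prop :=
  ∀ i, SupportedOn (bondNhd 0 i) (T i) ∧ ‖T i‖ ≤ b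

lemma LocalTerms.commute_of_far (hJ : LocalTerms b J) {X : SysOp n} {r : ℕ} {i k : Fin n}
    (hX : SupportedOn (bondNhd r k) X) (h : ¬ Near (r + 1) i k) :
    Commute (J i) X ∧ Commute (J i)ᴴ X :=
  ⟨(hJ i).1.commute (disjoint_bondNhd h) hX, (hJ i).1.conjTranspose.commute (disjoint_bondNhd h) hX⟩

lemma LocalTerms.supportedOn (hJ : LocalTerms b J) {i k : Fin n} {r : ℕ} (h : Near r i k) :
    SupportedOn (bondNhd r k) (J i) :=
  (hJ i).1.mono (bondNhd_subset h (zero_add r).le)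

lemma SupportedOn.commutator {X : Set (Fin (n + 1))} {A B : SysOp n} (hA : SupportedOn X A)
    (hB : SupportedOn X B) : SupportedOn X (A * B - B * A) :=
  (hA.mul hB).sub (hB.mul hA)

lemma SupportedOn.selfComm {X : Set (Fin (n + 1))} {i : Fin n} (h : SupportedOn X (J i)) :
    SupportedOn X (selfComm J i) :=
  h.conjTranspose.commutator h

lemma LocalTerms.heisenberg (hJ : LocalTerms b J) {X : SysOp n} {k : Fin n} {r : ℕ} {c : ℝ}
    (hX : SupportedOn (bondNhd r k) X) (hc : ‖X‖ ≤ c) :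
    SupportedOn (bondNhd (r + 1) k) (heisenberg J X) ∧
      ‖LindbladDilation.heisenberg J X‖ ≤ (2 * r + 3) * (2 * b ^ 2 * c) := by
  have h0 : ∀ i, ¬ Near (r + 1) i k → heisenbergTerm J X i = 0 := fun i hi =>
    heisenbergTerm_eq_zero (hJ.commute_of_far hX hi).1 (hJ.commute_of_far hX hi).2
  rw [heisenberg_eq_sum]
  refine ⟨supportedOn_sum_near h0 fun i hi => ?_, ?_⟩
  · have hJi := hJ.supportedOn hi
    have hJi' := hJi.conjTranspose
    have hX' : SupportedOn (bondNhd (r + 1) k) X :=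
      hX.mono (bondNhd_subset (m := 0) ⟨le_rfl, le_rfl⟩ (by omega))
    exact ((hJi'.mul hX').mul hJi).sub
      ((((hJi'.mul hJi).mul hX').add (hX'.mul (hJi'.mul hJi))).smul _)
  · refine (norm_sum_near_le h0 fun i => norm_heisenbergTerm_le (hJ i).2 hc).trans_eq ?_
    push_cast
    ring

lemma LocalTerms.ham4 (hJ : LocalTerms b J) (hH : LocalTerms b H) (k : Fin n) :
    SupportedOn (bondNhd 1 k) (ham4 (H k) J) ∧ ‖LindbladDilation.ham4 (H k) J‖ ≤ b ^ 3 := by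
  have h := hJ.heisenberg (hH k).1 (hH k).2
  refine ⟨h.1.smul _, (norm_smul_le_of_le h.2).trans_eq ?_⟩
  norm_num
  ring

lemma LocalTerms.ham6 (hJ : LocalTerms b J) (hH : LocalTerms b H) (k : Fin n) :
    SupportedOn (bondNhd 2 k) (ham6 (H k) J) ∧ ‖LindbladDilation.ham6 (H k) J‖ ≤ b ^ 5 := by
  have hb : 0 ≤ b := (norm_nonneg _).trans (hJ k).2
  have h := hJ.heisenberg (hH k).1 (hH k).2
  have h2 := hJ.heisenberg h.1 h.2
  set f : Fin n → SysOp n := fun i =>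
    (H k * (J i)ᴴ - (J i)ᴴ * H k) * (LindbladDilation.selfComm J i * J i)
      + (J i)ᴴ * LindbladDilation.selfComm J i * (J i * H k - H k * J i)
  have h0 : ∀ i, ¬ Near 1 i k → f i = 0 := by
    intro i hi
    obtain ⟨h3, h4⟩ := hJ.commute_of_far (hH k).1 hi
    simp only [f, h3.eq, h4.eq, sub_self, zero_mul, mul_zero, add_zero]
  have hs : SupportedOn (bondNhd 1 k) (∑ i, f i) := by
    refine supportedOn_sum_near h0 fun i hi => ?_
    have hJi := hJ.supportedOn hi
    have hJi' := hJi.conjTranspose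
    have hHk : SupportedOn (bondNhd 1 k) (H k) := hH.supportedOn ⟨by omega, by omega⟩
    exact ((hHk.commutator hJi').mul (hJi.selfComm.mul hJi)).add
      ((hJi'.mul hJi.selfComm).mul (hJi.commutator hHk))
  have hn : ∀ i, ‖f i‖ ≤ 8 * b ^ 5 := by
    intro i
    have hJi := (hJ i).2
    have hJi' := norm_conjTranspose_le hJi
    exact (norm_add_le_of_le
      (norm_mul_le_of_le (norm_commutator_le (hH k).2 hJi') (norm_selfComm_mul_le hJi))
      (norm_mul_le_of_le (norm_mul_le_of_le hJi' (norm_selfComm_le hJi))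
        (norm_commutator_le hJi (hH k).2))).trans_eq (by ring)
  refine ⟨(h2.1.add (hs.mono (bondNhd_subset (m := 1) ⟨by omega, by omega⟩ le_rfl))).smul _,
    (norm_smul_le_of_le (norm_add_le_of_le h2.2 (norm_sum_near_le h0 hn))).trans ?_⟩
  norm_num
  nlinarith [pow_nonneg hb 5]

lemma LocalTerms.commutator_hamGen (hJ : LocalTerms b J) (hH : LocalTerms b H) (i : Fin n) :
    SupportedOn (bondNhd 1 i) (hamGen H * J i - J i * hamGen H) ∧
      ‖hamGen H * J i - J i * hamGen H‖ ≤ 6 * b ^ 2 := by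
  have h : hamGen H * J i - J i * hamGen H = -Complex.I • ∑ k, (H k * J i - J i * H k) := by
    simp only [hamGen, smul_mul_assoc, mul_smul_comm, Finset.sum_mul, Finset.mul_sum,
      Finset.sum_sub_distrib, smul_sub]
  have h0 : ∀ k, ¬ Near 1 k i → H k * J i - J i * H k = 0 := fun k hk => by
    rw [(hH.commute_of_far (hJ i).1 hk).1.eq, sub_self]
  rw [h]
  refine ⟨(supportedOn_sum_near h0 fun k hk => (hH.supportedOn hk).commutator
    (hJ.supportedOn ⟨by omega, by omega⟩)).smul _, ?_⟩
  refine (norm_smul_le_of_le (norm_sum_near_le h0 fun k =>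
    norm_commutator_le (hH k).2 (hJ i).2)).trans_eq ?_
  simp
  ring

lemma LocalTerms.emit5 (hJ : LocalTerms b J) (hH : LocalTerms b H) (i : Fin n) :
    SupportedOn (bondNhd 1 i) (emit5 (hamGen H) J i) := by
  have hJi : SupportedOn (bondNhd 1 i) (J i) := hJ.supportedOn ⟨by omega, by omega⟩
  have hJi' := hJi.conjTranspose
  have hC := hJi.selfComm
  exact (((((((hJi'.mul hC).mul hJi).mul hJi).sub (hJi.mul ((hJi'.mul hC).mul hJi))).smul _).add
    ((hJi'.mul hJi).commutator (hC.mul hJi))).sub ((hC.mul (hC.mul hJi)).smul _)).smul _ |>.add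
    ((hC.mul (hJ.commutator_hamGen hH i).1).smul _)

lemma LocalTerms.dilation_h (hJ : LocalTerms b J) (hH : LocalTerms b H) (i : Fin n) (η : ℝ) :
    SupportedOn (bondNhd 2 i) ((dilation H J).h i η) :=
  ((hH.supportedOn ⟨by omega, by omega⟩).add
    (((hJ.ham4 hH i).1.mono (bondNhd_subset (m := 0) ⟨by omega, by omega⟩ (by omega))).smul _)).add
    ((hJ.ham6 hH i).1.smul _)

lemma LocalTerms.norm_dilation_h_sub_le (hJ : LocalTerms b J) (hH : LocalTerms b H) (i : Fin n)
    {η : ℝ} (h0 : 0 < η) (h1 : η ≤ 1) :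
    ‖(dilation H J).h i η - H i‖ ≤ (b ^ 3 + b ^ 5) * η ^ 2 := by
  have hb : 0 ≤ b := (norm_nonneg _).trans (hJ i).2
  have h : (dilation H J).h i η - H i
      = ((η : ℂ) ^ 2) • LindbladDilation.ham4 (H i) J
        + ((η : ℂ) ^ 4) • LindbladDilation.ham6 (H i) J := by
    simp only [dilation]
    abel
  rw [h]
  refine (norm_add_le_of_le (norm_smul_le_of_le (hJ.ham4 hH i).2)
    (norm_smul_le_of_le (hJ.ham6 hH i).2)).trans ?_
  rw [norm_pow, norm_pow, Complex.norm_real, Real.norm_of_nonneg h0.le]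
  have h4 : η ^ 4 ≤ η ^ 2 := pow_le_pow_of_le_one h0.le h1 (by norm_num)
  nlinarith [pow_nonneg hb 5]

lemma LocalTerms.dilation_S (hJ : LocalTerms b J) (hH : LocalTerms b H) (hb : 1 ≤ b) (i : Fin n)
    (k : Fin 4) : SupportedOn (bondNhd 2 i) ((dilation H J).S i k) ∧
      ‖(dilation H J).S i k‖ ≤ 7 * b ^ 5 := by
  have hsub : bondNhd 1 i ⊆ bondNhd 2 i := bondNhd_subset (m := 0) ⟨by omega, by omega⟩ (by omega)
  have hJi : SupportedOn (bondNhd 2 i) (J i) := hJ.supportedOn ⟨by omega, by omega⟩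
  have hK := hJ.commutator_hamGen hH i
  have p1 : b ≤ b ^ 5 := le_self_pow₀ hb (by norm_num)
  have p2 : b ^ 2 ≤ b ^ 5 := pow_le_pow_right₀ hb (by norm_num)
  have p3 : b ^ 3 ≤ b ^ 5 := pow_le_pow_right₀ hb (by norm_num)
  have p4 : b ^ 4 ≤ b ^ 5 := pow_le_pow_right₀ hb (by norm_num)
  have p5 : 0 ≤ b ^ 5 := by positivity
  fin_cases k
  · exact ⟨hJi, (hJ i).2.trans (by linarith)⟩
  · exact ⟨(hJi.selfComm.mul hJi).smul _, (norm_emit3_le (hJ i).2).trans (by linarith)⟩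
  · exact ⟨(hJ.emit5 hH i).mono hsub, (norm_emit5_le (hJ i).2 hK.2).trans (by nlinarith)⟩
  · exact ⟨(hK.1.mono hsub).sub ((hJi.selfComm.mul hJi).smul _),
      (norm_emitW_le (hJ i).2 hK.2).trans (by linarith)⟩

lemma norm_dilation_O_le (i : Fin n) (k : Fin 4) {η : ℝ} (h0 : 0 < η) (h1 : η ≤ 1) :
    ‖(dilation H J).O i k η‖ ≤ (‖lowering‖ + ‖toFourᴴ‖) * η⁻¹ := by
  have hη : ‖(η : ℂ)‖ = η := by rw [Complex.norm_real, Real.norm_of_nonneg h0.le]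
  have hinv : 1 ≤ η⁻¹ := (one_le_inv₀ h0).2 h1
  have hη3 : η ^ 3 ≤ 1 := pow_le_one₀ h0.le h1
  have hl := norm_nonneg lowering
  have ht := norm_nonneg toFourᴴ
  have hs : |√12|⁻¹ ≤ 1 := by
    refine inv_le_one_of_one_le₀ ?_
    rw [abs_of_nonneg (Real.sqrt_nonneg _)]
    exact Real.one_le_sqrt.2 (by norm_num)
  have key : ∀ (c : ℂ) (o : Matrix (Fin 5) (Fin 5) ℂ), ‖c‖ ≤ η⁻¹ →
      ‖o‖ ≤ ‖lowering‖ + ‖toFourᴴ‖ → ‖c • o‖ ≤ (‖lowering‖ + ‖toFourᴴ‖) * η⁻¹ := by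
    intro c o hc ho
    rw [norm_smul, mul_comm]
    exact mul_le_mul ho hc (norm_nonneg _) (by positivity)
  fin_cases k
  · refine key _ _ ?_ (by linarith)
    simp [abs_of_pos h0]
  · refine key _ _ ?_ (by linarith)
    simp only [norm_mul, norm_neg, Complex.norm_I, hη, one_mul]
    linarith
  · refine key _ _ ?_ (by linarith)
    simp only [norm_mul, norm_neg, Complex.norm_I, hη, one_mul, norm_pow]
    linarith
  · refine key _ _ ?_ (by linarith)
    simp only [norm_mul, norm_neg, Complex.norm_I, hη, one_mul, norm_inv, Complex.norm_real,
      Real.norm_eq_abs]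
    have : η * |√12|⁻¹ ≤ 1 * 1 := mul_le_mul h1 hs (by positivity) (by norm_num)
    linarith

end LocalBounds

/-! ### Dependence on the set of bonds -/

section SetDependence

variable {n : ℕ}

/-- The family `T` with the terms of the bonds outside `S` removed. -/
def restrict {M : Type*} [Zero M] (S : Finset (Fin n)) (T : Fin n → M) (i : Fin n) : M :=
  if i ∈ S then T i else 0

lemma lindbladOp_eq_sandwich (A : SysOp n) (J : Fin n → SysOp n) :
    lindbladOp A J = sandwich (sysOp A) 1 + sandwich 1 (sysOp Aᴴ)
      + ∑ i, sandwich (sysOp (J i)) (sysOp (J i)ᴴ) := by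
  ext1 ρ
  simp only [lindbladOp_apply, lindbladMap, add_apply, sum_apply, sandwich_apply, jump_apply,
    traceAnc_mul_kronecker_one, mul_one, one_mul, traceAnc_kronecker_one_mul, traceAnc_kronecker,
    trace_vac, one_smul, mul_assoc]

variable {J T : Finset (Fin n) → Fin n → SysOp n} {K X : Finset (Fin n) → SysOp n} {d d' : ℕ}

lemma HasDegree.conjTranspose {ι : Type} {X : Finset (Fin n) → Matrix ι ι ℂ}
    (hX : HasDegree d X) : HasDegree d (fun S => (X S)ᴴ) :=
  hX.map (Matrix.conjTransposeAddEquiv ι ι ℂ).toAddMonoidHom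

/-- `HasDegree.mul` for matrices. -/
lemma HasDegree.matrix_mul {ι : Type} [Fintype ι] {X Y : Finset (Fin n) → Matrix ι ι ℂ}
    (hX : HasDegree d X) (hY : HasDegree d' Y) : HasDegree (d + d') (fun S => X S * Y S) :=
  hX.bilin hY (AddMonoidHom.mk' (fun A => AddMonoidHom.mk' (fun B => A * B) (Matrix.mul_add A))
    fun A A' => by
      ext1 B
      exact Matrix.add_mul A A' B)

/-- `HasDegree.smul` for matrices. -/
lemma HasDegree.matrix_smul {ι : Type} {X : Finset (Fin n) → Matrix ι ι ℂ}
    (hX : HasDegree d X) (z : ℂ) : HasDegree d (fun S => z • X S) :=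
  hX.map (AddMonoidHom.mk' (fun A => z • A) (smul_add z))

lemma HasDegree.kronecker (hX : HasDegree d X) (o : Matrix (Anc n) (Anc n) ℂ) :
    HasDegree d (fun S => X S ⊗ₖ o) :=
  hX.map (AddMonoidHom.mk' (fun Y : SysOp n => Y ⊗ₖ o) fun Y Z => Matrix.add_kronecker Y Z o)

lemma HasDegree.sandwich {U W : Finset (Fin n) → JointOp n} (hU : HasDegree d U)
    (hW : HasDegree d' W) : HasDegree (d + d') (fun S => sandwich (U S) (W S)) :=
  hU.bilin hW (AddMonoidHom.mk'
    (fun Y => AddMonoidHom.mk' (LindbladDilation.sandwich Y) (map_add (sandwichBilin n Y)))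
    fun Y Y' => by
      ext1 Z
      exact DFunLike.congr_fun (map_add (sandwichBilin n) Y Y') Z)

lemma HasDegree.emit_sub_absorb (hT : ∀ i, HasDegree d (fun S => T S i)) :
    HasDegree d (fun S => emit (T S) - absorb (T S)) :=
  (HasDegree.sum fun i _ => (hT i).kronecker (cr i)).sub
    (HasDegree.sum fun i _ => (hT i).conjTranspose.kronecker (lw i))

lemma HasDegree.emitFour_sub_absorbFour (hT : ∀ i, HasDegree d (fun S => T S i)) :
    HasDegree d (fun S => emitFour (T S) - absorbFour (T S)) :=
  (HasDegree.sum fun i _ => (hT i).kronecker (ex i)).sub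
    (HasDegree.sum fun i _ => (hT i).conjTranspose.kronecker (dx i))

lemma HasDegree.commutator (hX : HasDegree d X) {Y : Finset (Fin n) → SysOp n}
    (hY : HasDegree d' Y) : HasDegree (d + d') (fun S => X S * Y S - Y S * X S) :=
  (hX.matrix_mul hY).sub ((hY.matrix_mul hX).mono (add_comm _ _).le)

lemma hasDegree_selfComm (hJ : ∀ i, HasDegree 1 (fun S => J S i)) (i : Fin n) :
    HasDegree 2 (fun S => selfComm (J S) i) := by
  unfold selfComm
  exact ((hJ i).conjTranspose.commutator (hJ i) :)

lemma hasDegree_selfComm_mul (hJ : ∀ i, HasDegree 1 (fun S => J S i)) (i : Fin n) :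
    HasDegree 3 (fun S => selfComm (J S) i * J S i) :=
  ((hasDegree_selfComm hJ i).matrix_mul (hJ i) :)

lemma hasDegree_heisenberg (hJ : ∀ i, HasDegree 1 (fun S => J S i)) (hX : HasDegree d X) :
    HasDegree (d + 2) (fun S => heisenberg (J S) (X S)) := by
  simp only [heisenberg_eq_sum, heisenbergTerm]
  refine HasDegree.sum fun i _ => ?_
  have hN : HasDegree 2 (fun S => (J S i)ᴴ * J S i) := ((hJ i).conjTranspose.matrix_mul (hJ i) :)
  have h1 : HasDegree (d + 2) (fun S => (J S i)ᴴ * X S * J S i) :=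
    HasDegree.mono (by omega) (((hJ i).conjTranspose.matrix_mul hX).matrix_mul (hJ i) :)
  have h2 : HasDegree (d + 2) (fun S => (J S i)ᴴ * J S i * X S) :=
    HasDegree.mono (by omega) (hN.matrix_mul hX :)
  exact h1.sub ((h2.add (hX.matrix_mul hN)).matrix_smul _)

lemma hasDegree_emit3 (hJ : ∀ i, HasDegree 1 (fun S => J S i)) (i : Fin n) :
    HasDegree 3 (fun S => emit3 (J S) i) := by
  unfold emit3
  exact ((hasDegree_selfComm_mul hJ i).matrix_smul _ :)

lemma hasDegree_scaledW (hJ : ∀ i, HasDegree 1 (fun S => J S i)) (hK : HasDegree 1 K)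
    (i : Fin n) : HasDegree 3 (fun S => scaledW (K S) (J S) i) := by
  unfold scaledW emitW
  have h := HasDegree.mono (show 1 + 1 ≤ 3 by norm_num) (hK.commutator (hJ i))
  exact ((h.sub ((hasDegree_selfComm_mul hJ i).matrix_smul _)).matrix_smul _ :)

lemma hasDegree_emit5 (hJ : ∀ i, HasDegree 1 (fun S => J S i)) (hK : HasDegree 1 K)
    (i : Fin n) : HasDegree 5 (fun S => emit5 (K S) (J S) i) := by
  have hC := hasDegree_selfComm hJ i
  have hCJ := hasDegree_selfComm_mul hJ i
  have hJ' := (hJ i).conjTranspose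
  have hJC : HasDegree 4 (fun S => (J S i)ᴴ * selfComm (J S) i * J S i) :=
    ((hJ'.matrix_mul hC).matrix_mul (hJ i) :)
  have hN : HasDegree 2 (fun S => (J S i)ᴴ * J S i) := (hJ'.matrix_mul (hJ i) :)
  have h1 : HasDegree 5 (fun S => (J S i)ᴴ * selfComm (J S) i * J S i * J S i
      - J S i * ((J S i)ᴴ * selfComm (J S) i * J S i)) := (hJC.commutator (hJ i) :)
  have h2 : HasDegree 5 (fun S => (J S i)ᴴ * J S i * (selfComm (J S) i * J S i)
      - selfComm (J S) i * J S i * ((J S i)ᴴ * J S i)) := (hN.commutator hCJ :)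
  have h3 : HasDegree 5 (fun S => selfComm (J S) i * (selfComm (J S) i * J S i)) :=
    (hC.matrix_mul hCJ :)
  have h4 : HasDegree 5 (fun S => selfComm (J S) i * (K S * J S i - J S i * K S)) :=
    HasDegree.mono (by norm_num) (hC.matrix_mul (hK.commutator (hJ i)) :)
  unfold emit5
  exact (((h1.matrix_smul _).add h2).sub (h3.matrix_smul _)).matrix_smul _ |>.add (h4.matrix_smul _)

lemma hasDegree_ham4 (hJ : ∀ i, HasDegree 1 (fun S => J S i)) (hK : HasDegree 1 K) :
    HasDegree 3 (fun S => ham4 (K S) (J S)) := by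
  unfold ham4
  exact (hasDegree_heisenberg hJ hK).matrix_smul _

lemma hasDegree_ham6 (hJ : ∀ i, HasDegree 1 (fun S => J S i)) (hK : HasDegree 1 K) :
    HasDegree 5 (fun S => ham6 (K S) (J S)) := by
  unfold ham6
  refine HasDegree.matrix_smul ((hasDegree_heisenberg hJ (hasDegree_heisenberg hJ hK)).add
    (HasDegree.sum fun i _ => ?_)) _
  have hC := hasDegree_selfComm hJ i
  have hJ' := (hJ i).conjTranspose
  have h1 : HasDegree 5 (fun S => (K S * (J S i)ᴴ - (J S i)ᴴ * K S) * (selfComm (J S) i * J S i)) :=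
    ((hK.commutator hJ').matrix_mul (hasDegree_selfComm_mul hJ i) :)
  have h2 : HasDegree 5 (fun S => (J S i)ᴴ * selfComm (J S) i * (J S i * K S - K S * J S i)) :=
    ((hJ'.matrix_mul hC).matrix_mul ((hJ i).commutator hK) :)
  exact h1.add h2

lemma hasDegree_genCoeff (hJ : ∀ i, HasDegree 1 (fun S => J S i)) (hK : HasDegree 1 K) :
    ∀ m, HasDegree 5 (fun S => genCoeff (K S) (J S) m)
  | 0 => HasDegree.zero 5
  | 1 => (HasDegree.emit_sub_absorb hJ).mono (by norm_num)
  | 2 => (hK.kronecker 1).mono (by norm_num)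
  | 3 => ((HasDegree.emit_sub_absorb (hasDegree_emit3 hJ)).add
      (HasDegree.emitFour_sub_absorbFour (hasDegree_scaledW hJ hK))).mono (by norm_num)
  | 4 => ((hasDegree_ham4 hJ hK).kronecker 1).mono (by norm_num)
  | 5 => HasDegree.emit_sub_absorb (hasDegree_emit5 hJ hK)
  | 6 => (hasDegree_ham6 hJ hK).kronecker 1
  | _ + 7 => HasDegree.zero 5

lemma hasDegree_lindbladOp (hJ : ∀ i, HasDegree 1 (fun S => J S i)) (hK : HasDegree 1 K) :
    HasDegree 2 (fun S => lindbladOp (noJump (K S) (J S)) (J S)) := by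
  have hA : HasDegree 2 (fun S => noJump (K S) (J S)) := by
    unfold noJump numOp
    refine (hK.mono (by norm_num)).sub (HasDegree.matrix_smul (HasDegree.sum fun i _ => ?_) _)
    exact ((hJ i).conjTranspose.matrix_mul (hJ i) :)
  have h1 := HasDegree.const (α := Fin n) 0 (1 : JointOp n)
  have e1 := (hA.kronecker 1).sandwich h1
  have e2 := h1.sandwich (hA.conjTranspose.kronecker 1)
  have e3 : ∀ i, HasDegree 2 (fun S => sandwich (sysOp (J S i)) (sysOp (J S i)ᴴ)) := fun i =>
    (((hJ i).kronecker 1).sandwich ((hJ i).conjTranspose.kronecker 1) :)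
  simp only [lindbladOp_eq_sandwich]
  exact (e1.add (e2.mono (by norm_num))).add (HasDegree.sum fun i _ => e3 i)

/-- Each of the coefficients of the generator has degree at most `5`, and a term of order `x ^ 8` is
a product of at most `8` of them. The degree is not optimal, but it does not depend on `n`. -/
lemma hasDegree_errorCoeff (hJ : ∀ i, HasDegree 1 (fun S => J S i)) (hK : HasDegree 1 K) :
    HasDegree 40 (fun S => errorCoeff (K S) (J S)) := by
  unfold errorCoeff reducedCoeff
  have h := HasDegree.expCoeff (fun m => hasDegree_genCoeff hJ hK m)
  refine ((((hasDegree_lindbladOp hJ hK).pow 4).mono (by norm_num)).smul _).sub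
    (HasDegree.sum fun m hm => ?_)
  refine ((h m).sandwich (h (8 - m)).conjTranspose).mono ?_
  have := Finset.mem_range.1 hm
  omega

end SetDependence

/-! ### Bounds for finitely many bonds -/

section FiniteBounds

lemma norm_powCoeff_le {A : Type*} [NormedRing A] (h1 : ‖(1 : A)‖ ≤ 1) {G : ℕ → A} {c : ℝ}
    (hc : 0 ≤ c) (hG : ∀ m, ‖G m‖ ≤ c) :
    ∀ k p : ℕ, ‖powCoeff G k p‖ ≤ ((p + 1) * c) ^ k
  | 0, p => by
    rw [powCoeff, pow_zero]
    split_ifs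
    · exact h1
    · simp
  | k + 1, p => by
    rw [powCoeff]
    have h : ∀ m ∈ Finset.range (p + 1), ‖G m * powCoeff G k (p - m)‖ ≤ c * ((p + 1) * c) ^ k := by
      intro m _
      refine norm_mul_le_of_le (hG m) ((norm_powCoeff_le h1 hc hG k (p - m)).trans ?_)
      have : ((p - m : ℕ) : ℝ) ≤ p := by exact_mod_cast Nat.sub_le p m
      gcongr
    refine (norm_sum_le_of_le _ h).trans_eq ?_
    rw [Finset.sum_const, Finset.card_range, nsmul_eq_mul]
    push_cast
    ring

lemma norm_expCoeff_le {A : Type*} [NormedRing A] [NormedAlgebra ℂ A] (h1 : ‖(1 : A)‖ ≤ 1)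
    {G : ℕ → A} {c : ℝ} (hc : 0 ≤ c) (hG : ∀ m, ‖G m‖ ≤ c) (p : ℕ) :
    ‖expCoeff G p‖ ≤ ∑ k ∈ Finset.range (p + 1), ((p + 1) * c) ^ k := by
  refine norm_sum_le_of_le _ fun k _ => ?_
  refine (norm_smul_le _ _).trans ?_
  have h : ‖((k.factorial : ℂ)⁻¹)‖ ≤ 1 := by
    rw [norm_inv, Complex.norm_natCast]
    exact inv_le_one_of_one_le₀ (by exact_mod_cast Nat.one_le_iff_ne_zero.2 k.factorial_ne_zero)
  exact (mul_le_of_le_one_left (norm_nonneg _) h).trans (norm_powCoeff_le h1 hc hG k p)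

variable {n : ℕ} {S : Finset (Fin n)} {d : ℕ}

lemma norm_sum_le_of_card_le {E : Type*} [SeminormedAddCommGroup E] (hS : S.card ≤ d)
    {f : Fin n → E} {B : ℝ} (hB : 0 ≤ B) (h0 : ∀ i, i ∉ S → f i = 0) (hf : ∀ i, ‖f i‖ ≤ B) :
    ‖∑ i, f i‖ ≤ d * B := by
  rw [← Finset.sum_subset (Finset.subset_univ S) fun i _ hi => h0 i hi]
  refine (norm_sum_le_of_le _ fun i _ => hf i).trans ?_
  rw [Finset.sum_const, nsmul_eq_mul]
  exact mul_le_mul_of_nonneg_right (by exact_mod_cast hS) hB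

lemma norm_sysOp_le (X : SysOp n) : ‖sysOp X‖ ≤ ‖X‖ :=
  (norm_kronecker_le X 1).trans (mul_le_of_le_one_right (norm_nonneg _) norm_one_matrix_le)

lemma norm_kronecker_ancOp_le {X : SysOp n} {t : ℝ} (hX : ‖X‖ ≤ t) (i : Fin n)
    (o : Matrix (Fin 5) (Fin 5) ℂ) : ‖X ⊗ₖ ancOp i o‖ ≤ t * ‖o‖ :=
  (norm_kronecker_le _ _).trans (mul_le_mul hX (norm_ancOp_le i o) (norm_nonneg _)
    ((norm_nonneg _).trans hX))

lemma norm_exchange_le (hS : S.card ≤ d) {T : Fin n → SysOp n} {t : ℝ} (ht : 0 ≤ t)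
    (h0 : ∀ i, i ∉ S → T i = 0) (hT : ∀ i, ‖T i‖ ≤ t) (o : Matrix (Fin 5) (Fin 5) ℂ) :
    ‖∑ i, T i ⊗ₖ ancOp i oᴴ - ∑ i, (T i)ᴴ ⊗ₖ ancOp i o‖ ≤ d * (2 * t * ‖o‖) := by
  rw [← Finset.sum_sub_distrib]
  refine norm_sum_le_of_card_le hS (by positivity) (fun i hi => ?_) fun i => ?_
  · rw [h0 i hi, Matrix.conjTranspose_zero, Matrix.zero_kronecker, Matrix.zero_kronecker, sub_zero]
  · refine (norm_sub_le_of_le (norm_kronecker_ancOp_le (hT i) i oᴴ)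
      (norm_kronecker_ancOp_le (norm_conjTranspose_le (hT i)) i o)).trans_eq ?_
    rw [Matrix.l2_opNorm_conjTranspose]
    ring

variable {J : Fin n → SysOp n} {K : SysOp n} {b κ : ℝ}

lemma norm_heisenberg_le (hS : S.card ≤ d) (h0 : ∀ i, i ∉ S → J i = 0) (hJ : ∀ i, ‖J i‖ ≤ b)
    {X : SysOp n} {c : ℝ} (hX : ‖X‖ ≤ c) : ‖heisenberg J X‖ ≤ d * (2 * b ^ 2 * c) := by
  have hc := (norm_nonneg _).trans hX
  rw [heisenberg_eq_sum]
  refine norm_sum_le_of_card_le hS (by positivity) (fun i hi => ?_)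
    fun i => norm_heisenbergTerm_le (hJ i) hX
  simp [heisenbergTerm, h0 i hi]

lemma norm_scaledW_le {i : Fin n} (hJ : ‖J i‖ ≤ b) (hK : ‖K‖ ≤ κ) :
    ‖scaledW K J i‖ ≤ 2 * κ * b + b ^ 3 := by
  refine (norm_smul_le _ _).trans ((mul_le_of_le_one_left (norm_nonneg _) ?_).trans
    (norm_emitW_le hJ (norm_commutator_le hK hJ)))
  rw [norm_inv, Complex.norm_real, Real.norm_of_nonneg (Real.sqrt_nonneg _)]
  exact inv_le_one_of_one_le₀ (Real.one_le_sqrt.2 (by norm_num))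

lemma norm_ham4_le (hS : S.card ≤ d) (h0 : ∀ i, i ∉ S → J i = 0) (hJ : ∀ i, ‖J i‖ ≤ b)
    (hK : ‖K‖ ≤ κ) : ‖ham4 K J‖ ≤ d * (2 * b ^ 2 * κ) := by
  refine (norm_smul_le _ _).trans ((mul_le_of_le_one_left (norm_nonneg _) ?_).trans
    (norm_heisenberg_le hS h0 hJ hK))
  norm_num

lemma norm_ham6_le (hS : S.card ≤ d) (h0 : ∀ i, i ∉ S → J i = 0) (hJ : ∀ i, ‖J i‖ ≤ b)
    (hK : ‖K‖ ≤ κ) :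
    ‖ham6 K J‖ ≤ d * (2 * b ^ 2 * (d * (2 * b ^ 2 * κ))) + d * (8 * κ * b ^ 4) := by
  have hκ := (norm_nonneg _).trans hK
  refine (norm_smul_le _ _).trans ((mul_le_of_le_one_left (norm_nonneg _) (by norm_num)).trans
    (norm_add_le_of_le (norm_heisenberg_le hS h0 hJ (norm_heisenberg_le hS h0 hJ hK))
      (norm_sum_le_of_card_le hS (by positivity) (fun i hi => ?_) fun i => ?_)))
  · simp [h0 i hi]
  · refine (norm_add_le_of_le
      (norm_mul_le_of_le (norm_commutator_le hK (norm_conjTranspose_le (hJ i)))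
        (norm_selfComm_mul_le (hJ i)))
      (norm_mul_le_of_le
        (norm_mul_le_of_le (norm_conjTranspose_le (hJ i)) (norm_selfComm_le (hJ i)))
        (norm_commutator_le (hJ i) hK))).trans_eq ?_
    ring

/-- The coefficients of the generator of at most `d` bonds are bounded, uniformly in `n`. -/
lemma exists_norm_genCoeff_le (d : ℕ) (hb : 0 ≤ b) (hκ : 0 ≤ κ) :
    ∃ c : ℝ, 0 ≤ c ∧ ∀ {n : ℕ} {S : Finset (Fin n)} {K : SysOp n} {J : Fin n → SysOp n},
      S.card ≤ d → (∀ i, i ∉ S → J i = 0) → (∀ i, ‖J i‖ ≤ b) → ‖K‖ ≤ κ →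
      ∀ m, ‖genCoeff K J m‖ ≤ c := by
  set c1 : ℝ := d * (2 * b * ‖lowering‖)
  set c3 : ℝ := d * (2 * b ^ 3 * ‖lowering‖) + d * (2 * (2 * κ * b + b ^ 3) * ‖toFourᴴ‖)
  set c4 : ℝ := d * (2 * b ^ 2 * κ)
  set c5 : ℝ := d * (2 * (b ^ 5 + b ^ 2 * (2 * κ * b)) * ‖lowering‖)
  set c6 : ℝ := d * (2 * b ^ 2 * (d * (2 * b ^ 2 * κ))) + d * (8 * κ * b ^ 4)
  have p1 : 0 ≤ c1 := by positivity
  have p3 : 0 ≤ c3 := by positivity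
  have p4 : 0 ≤ c4 := by positivity
  have p5 : 0 ≤ c5 := by positivity
  have p6 : 0 ≤ c6 := by positivity
  refine ⟨c1 + κ + c3 + c4 + c5 + c6, by positivity, fun {n S K J} hS h0 hJ hK m => ?_⟩
  have hC : ∀ i, i ∉ S → selfComm J i = 0 := fun i hi => by simp [selfComm, h0 i hi]
  match m with
  | 0 => exact (norm_zero (E := JointOp n)).trans_le (by positivity)
  | 1 =>
    refine (norm_exchange_le hS hb h0 hJ lowering).trans ?_
    linarith
  | 2 =>
    refine (norm_sysOp_le K).trans ?_
    linarith
  | 3 =>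
    have h1 := norm_exchange_le hS (by positivity)
      (fun i hi => show emit3 J i = 0 by simp [emit3, hC i hi])
      (fun i => norm_emit3_le (hJ i)) lowering
    have h2 := norm_exchange_le hS (by positivity)
      (fun i hi => show scaledW K J i = 0 by simp [scaledW, emitW, hC i hi, h0 i hi])
      (fun i => norm_scaledW_le (hJ i) hK) toFourᴴ
    rw [Matrix.conjTranspose_conjTranspose] at h2
    refine (norm_add_le_of_le h1 h2).trans ?_
    linarith
  | 4 =>
    refine (norm_sysOp_le _).trans ((norm_ham4_le hS h0 hJ hK).trans ?_)
    linarith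
  | 5 =>
    refine (norm_exchange_le hS (by positivity)
      (fun i hi => show emit5 K J i = 0 by simp [emit5, hC i hi, h0 i hi])
      (fun i => norm_emit5_le (hJ i) (norm_commutator_le hK (hJ i))) lowering).trans ?_
    linarith
  | 6 =>
    refine (norm_sysOp_le _).trans ((norm_ham6_le hS h0 hJ hK).trans ?_)
    linarith
  | m + 7 => exact (norm_zero (E := JointOp n)).trans_le (by positivity)

lemma diamondLE_lindbladOp (hS : S.card ≤ d) (h0 : ∀ i, i ∉ S → J i = 0) (hJ : ∀ i, ‖J i‖ ≤ b)
    {A : SysOp n} {a : ℝ} (hA : ‖A‖ ≤ a) :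
    DiamondLE (lindbladOp A J) (a + a + d * (b * b)) := by
  have h1 : ‖(1 : JointOp n)‖ ≤ 1 := norm_one_matrix_le
  have ha := (norm_nonneg _).trans hA
  rw [lindbladOp_eq_sandwich,
    ← Finset.sum_subset (Finset.subset_univ S) fun i _ hi => by
      rw [h0 i hi, sysOp, Matrix.zero_kronecker]
      ext1 ρ
      simp [sandwich_apply]]
  refine ((diamondLE_sandwich _ _).mono ?_).add ((diamondLE_sandwich _ _).mono ?_) |>.add
    ((DiamondLE.sum fun i _ => (diamondLE_sandwich _ _).mono (c' := b * b) ?_).mono ?_)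
  · exact (mul_le_mul ((norm_sysOp_le A).trans hA) h1 (norm_nonneg _) ha).trans_eq (mul_one a)
  · exact (mul_le_mul h1 ((norm_sysOp_le _).trans (norm_conjTranspose_le hA)) (norm_nonneg _)
      zero_le_one).trans_eq (one_mul a)
  · exact mul_le_mul ((norm_sysOp_le _).trans (hJ i))
      ((norm_sysOp_le _).trans (norm_conjTranspose_le (hJ i))) (norm_nonneg _)
      ((norm_nonneg _).trans (hJ i))
  · rw [Finset.sum_const, nsmul_eq_mul]
    exact mul_le_mul_of_nonneg_right (by exact_mod_cast hS) (mul_self_nonneg b)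

/-- The error coefficient of at most `d` bonds is bounded, uniformly in `n`. -/
lemma exists_diamondLE_errorCoeff (d : ℕ) (hb : 0 ≤ b) (hκ : 0 ≤ κ) :
    ∃ B : ℝ, 0 ≤ B ∧ ∀ {n : ℕ} {S : Finset (Fin n)} {K : SysOp n} {J : Fin n → SysOp n},
      S.card ≤ d → (∀ i, i ∉ S → J i = 0) → (∀ i, ‖J i‖ ≤ b) → ‖K‖ ≤ κ →
      DiamondLE (errorCoeff K J) B := by
  obtain ⟨c, hc, hgen⟩ := exists_norm_genCoeff_le d hb hκ
  set e : ℕ → ℝ := fun p => ∑ k ∈ Finset.range (p + 1), ((p + 1) * c) ^ k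
  set a : ℝ := κ + d * (b * b)
  set l : ℝ := a + a + d * (b * b)
  have he : ∀ p, 0 ≤ e p := fun p => Finset.sum_nonneg fun k _ => by positivity
  have ha : 0 ≤ a := by positivity
  have hl : 0 ≤ l := by positivity
  refine ⟨‖(24 : ℂ)⁻¹‖ * (l * (l * (l * l))) + ∑ m ∈ Finset.range 9, e m * e (8 - m),
    add_nonneg (by positivity) (Finset.sum_nonneg fun m _ => mul_nonneg (he _) (he _)),
    fun {n S K J} hS h0 hJ hK => ?_⟩
  have hA : ‖noJump K J‖ ≤ a := by
    refine norm_sub_le_of_le hK ((norm_smul_le _ _).trans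
      ((mul_le_of_le_one_left (norm_nonneg _) (by norm_num)).trans
        (norm_sum_le_of_card_le hS (by positivity) (fun i hi => ?_) fun i =>
          norm_mul_le_of_le (norm_conjTranspose_le (hJ i)) (hJ i))))
    simp [h0 i hi]
  have hL := diamondLE_lindbladOp hS h0 hJ hA
  have hexp := fun p => norm_expCoeff_le norm_one_matrix_le hc (hgen hS h0 hJ hK) p
  have hL4 : lindbladOp (noJump K J) J ^ 4 = lindbladOp (noJump K J) J
      * (lindbladOp (noJump K J) J * (lindbladOp (noJump K J) J * lindbladOp (noJump K J) J)) := by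
    rw [pow_succ', pow_three]
  rw [errorCoeff, hL4]
  refine ((hL.mul (hL.mul (hL.mul hL hl) hl) hl).smul _).sub (DiamondLE.sum fun m _ => ?_)
  refine (diamondLE_sandwich _ _).mono (mul_le_mul (hexp m) ?_ (norm_nonneg _) (he m))
  rw [Matrix.l2_opNorm_conjTranspose]
  exact hexp (8 - m)

end FiniteBounds

/-! ### Independence of distant bonds -/

section Independence

variable {n : ℕ}

/-- `K` and the `J i` act on the sites in `X`, and `J i` vanishes for the bonds `i` outside `S`. -/
structure Confined (X : Set (Fin (n + 1))) (S : Set (Fin n)) (K : SysOp n)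
    (J : Fin n → SysOp n) : Prop where
  ham : SupportedOn X K
  jumps : ∀ i, SupportedOn X (J i)
  eq_zero : ∀ i, i ∉ S → J i = 0

section Single

variable {X : Set (Fin (n + 1))} {S : Set (Fin n)} {K : SysOp n} {J T : Fin n → SysOp n}

lemma Confined.selfComm_mul (h : Confined X S K J) (i : Fin n) :
    SupportedOn X (selfComm J i * J i) :=
  (h.jumps i).selfComm.mul (h.jumps i)

lemma Confined.heisenberg (h : Confined X S K J) {A : SysOp n} (hA : SupportedOn X A) :
    SupportedOn X (heisenberg J A) := by
  rw [heisenberg_eq_sum]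
  refine SupportedOn.sum fun i _ => ?_
  have hi := h.jumps i
  have hi' := hi.conjTranspose
  exact ((hi'.mul hA).mul hi).sub ((((hi'.mul hi).mul hA).add (hA.mul (hi'.mul hi))).smul _)

lemma Confined.emit3 (h : Confined X S K J) (i : Fin n) : SupportedOn X (emit3 J i) :=
  (h.selfComm_mul i).smul _

lemma Confined.scaledW (h : Confined X S K J) (i : Fin n) : SupportedOn X (scaledW K J i) :=
  ((h.ham.commutator (h.jumps i)).sub ((h.selfComm_mul i).smul _)).smul _

lemma Confined.emit5 (h : Confined X S K J) (i : Fin n) : SupportedOn X (emit5 K J i) := by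
  have hi := h.jumps i
  have hi' := hi.conjTranspose
  have hC := hi.selfComm
  have hCJ := h.selfComm_mul i
  exact ((((((hi'.mul hC).mul hi).commutator hi).smul _).add
    ((hi'.mul hi).commutator hCJ)).sub ((hC.mul hCJ).smul _)).smul _ |>.add
    ((hC.mul (h.ham.commutator hi)).smul _)

lemma Confined.ham4 (h : Confined X S K J) : SupportedOn X (ham4 K J) :=
  (h.heisenberg h.ham).smul _

lemma Confined.ham6 (h : Confined X S K J) : SupportedOn X (ham6 K J) := by
  refine ((h.heisenberg (h.heisenberg h.ham)).add (SupportedOn.sum fun i _ => ?_)).smul _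
  have hi := h.jumps i
  have hi' := hi.conjTranspose
  exact ((h.ham.commutator hi').mul (h.selfComm_mul i)).add
    ((hi'.mul hi.selfComm).mul (hi.commutator h.ham))

lemma Confined.noJump (h : Confined X S K J) : SupportedOn X (noJump K J) :=
  h.ham.sub ((SupportedOn.sum fun i _ => (h.jumps i).conjTranspose.mul (h.jumps i)).smul _)

/-- Joint operators that act on the sites in `X` and on the ancillas in `S`. -/
abbrev ActsIn (X : Set (Fin (n + 1))) (S : Set (Fin n)) (A : JointOp n) : Prop :=
  ActsOn ((zeroOff X).prod (zeroOff S)) ((zeroOn X).prod (zeroOn S)) A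

lemma actsIn_sysOp (S : Set (Fin n)) {A : SysOp n} (hA : SupportedOn X A) :
    ActsIn X S (sysOp A) :=
  (supportedOn_iff.1 hA).kronecker (actsOn_one _ _)

lemma actsIn_sum_ancOp (hT : ∀ i, SupportedOn X (T i)) (h0 : ∀ i, i ∉ S → T i = 0)
    (o : Matrix (Fin 5) (Fin 5) ℂ) : ActsIn X S (∑ i, T i ⊗ₖ ancOp i o) := by
  refine ActsOn.sum fun i _ => ?_
  by_cases hi : i ∈ S
  · exact (supportedOn_iff.1 (hT i)).kronecker (actsOn_ancOp hi o)
  · rw [h0 i hi, Matrix.zero_kronecker]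
    exact actsOn_zero _ _

lemma actsIn_exchange (hT : ∀ i, SupportedOn X (T i)) (h0 : ∀ i, i ∉ S → T i = 0)
    (o : Matrix (Fin 5) (Fin 5) ℂ) :
    ActsIn X S (∑ i, T i ⊗ₖ ancOp i oᴴ - ∑ i, (T i)ᴴ ⊗ₖ ancOp i o) :=
  (actsIn_sum_ancOp hT h0 _).sub (actsIn_sum_ancOp (fun i => (hT i).conjTranspose)
    (fun i hi => by rw [h0 i hi, Matrix.conjTranspose_zero]) o)

lemma Confined.actsIn_genCoeff (h : Confined X S K J) : ∀ m, ActsIn X S (genCoeff K J m) := by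
  have h0 := h.eq_zero
  have hC : ∀ i, i ∉ S → selfComm J i = 0 := fun i hi => by simp [selfComm, h0 i hi]
  intro m
  match m with
  | 0 => exact actsOn_zero _ _
  | 1 => exact actsIn_exchange h.jumps h0 lowering
  | 2 => exact actsIn_sysOp S h.ham
  | 3 =>
    have h1 := actsIn_exchange (S := S) h.scaledW
      (fun i hi => by simp [LindbladDilation.scaledW, emitW, hC i hi, h0 i hi]) toFourᴴ
    rw [Matrix.conjTranspose_conjTranspose] at h1
    exact (actsIn_exchange h.emit3
      (fun i hi => by simp [LindbladDilation.emit3, hC i hi]) lowering).add h1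
  | 4 => exact actsIn_sysOp S h.ham4
  | 5 =>
    exact actsIn_exchange h.emit5
      (fun i hi => by simp [LindbladDilation.emit5, hC i hi, h0 i hi]) lowering
  | 6 => exact actsIn_sysOp S h.ham6
  | m + 7 => exact actsOn_zero _ _

lemma Confined.actsIn_genSum (h : Confined X S K J) (x : ℝ) : ActsIn X S (genSum K J x) :=
  ActsOn.sum fun m _ => (h.actsIn_genCoeff m).smul _

end Single

variable {X₁ X₂ : Set (Fin (n + 1))} {S₁ S₂ : Set (Fin n)} {K₁ K₂ A₁ A₂ : SysOp n}
  {J₁ J₂ : Fin n → SysOp n}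

lemma Confined.eq_zero_or (h₁ : Confined X₁ S₁ K₁ J₁) (h₂ : Confined X₂ S₂ K₂ J₂)
    (hS : Disjoint S₁ S₂) (i : Fin n) : J₁ i = 0 ∨ J₂ i = 0 := by
  by_cases hi : i ∈ S₁
  · exact Or.inr (h₂.eq_zero i (Set.disjoint_left.1 hS hi))
  · exact Or.inl (h₁.eq_zero i hi)

lemma Confined.heisenberg_add (h₁ : Confined X₁ S₁ K₁ J₁) (h₂ : Confined X₂ S₂ K₂ J₂)
    (hX : Disjoint X₁ X₂) (hS : Disjoint S₁ S₂) (hA₁ : SupportedOn X₁ A₁)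
    (hA₂ : SupportedOn X₂ A₂) :
    LindbladDilation.heisenberg (J₁ + J₂) (A₁ + A₂)
      = LindbladDilation.heisenberg J₁ A₁ + LindbladDilation.heisenberg J₂ A₂ := by
  simp only [heisenberg_eq_sum, ← Finset.sum_add_distrib]
  refine Finset.sum_congr rfl fun i _ => ?_
  have e : ∀ (J : Fin n → SysOp n), heisenbergTerm J (A₁ + A₂) i
      = heisenbergTerm J A₁ i + heisenbergTerm J A₂ i := fun J => by
    simp only [heisenbergTerm, mul_add, add_mul]
    module
  have e1 : heisenbergTerm J₁ A₂ i = 0 := heisenbergTerm_eq_zero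
    ((h₁.jumps i).commute hX hA₂) ((h₁.jumps i).conjTranspose.commute hX hA₂)
  have e2 : heisenbergTerm J₂ A₁ i = 0 := heisenbergTerm_eq_zero
    ((h₂.jumps i).commute hX.symm hA₁) ((h₂.jumps i).conjTranspose.commute hX.symm hA₁)
  have e3 : ∀ {J : Fin n → SysOp n} (A : SysOp n), J i = 0 → heisenbergTerm J A i = 0 :=
    fun A h => by simp [heisenbergTerm, h]
  rcases h₁.eq_zero_or h₂ hS i with h | h
  · have : heisenbergTerm (J₁ + J₂) (A₁ + A₂) i = heisenbergTerm J₂ (A₁ + A₂) i := by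
      simp [heisenbergTerm, h]
    rw [this, e, e2, e3 A₁ h]
  · have : heisenbergTerm (J₁ + J₂) (A₁ + A₂) i = heisenbergTerm J₁ (A₁ + A₂) i := by
      simp [heisenbergTerm, h]
    rw [this, e, e1, e3 A₂ h]

lemma selfComm_add {i : Fin n} (h : J₁ i = 0 ∨ J₂ i = 0) :
    selfComm (J₁ + J₂) i = selfComm J₁ i + selfComm J₂ i := by
  rcases h with h | h <;> simp [selfComm, h]

lemma emit3_add {i : Fin n} (h : J₁ i = 0 ∨ J₂ i = 0) :
    emit3 (J₁ + J₂) i = emit3 J₁ i + emit3 J₂ i := by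
  rcases h with h | h <;> simp [emit3, selfComm, h]

lemma Confined.commutator_add (h₁ : Confined X₁ S₁ K₁ J₁) (h₂ : Confined X₂ S₂ K₂ J₂)
    (hX : Disjoint X₁ X₂) (i : Fin n) : (K₁ + K₂) * (J₁ + J₂) i - (J₁ + J₂) i * (K₁ + K₂)
      = (K₁ * J₁ i - J₁ i * K₁) + (K₂ * J₂ i - J₂ i * K₂) := by
  have e1 := (h₁.ham.commute hX (h₂.jumps i)).eq
  have e2 := (h₂.ham.commute hX.symm (h₁.jumps i)).eq
  simp only [Pi.add_apply, add_mul, mul_add, e1, e2]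
  abel

lemma Confined.scaledW_add (h₁ : Confined X₁ S₁ K₁ J₁) (h₂ : Confined X₂ S₂ K₂ J₂)
    (hX : Disjoint X₁ X₂) (hS : Disjoint S₁ S₂) (i : Fin n) :
    LindbladDilation.scaledW (K₁ + K₂) (J₁ + J₂) i
      = LindbladDilation.scaledW K₁ J₁ i + LindbladDilation.scaledW K₂ J₂ i := by
  have e : selfComm (J₁ + J₂) i * (J₁ + J₂) i = selfComm J₁ i * J₁ i + selfComm J₂ i * J₂ i := by
    rcases h₁.eq_zero_or h₂ hS i with h | h <;> simp [selfComm, h]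
  rw [LindbladDilation.scaledW, emitW, h₁.commutator_add h₂ hX, e, LindbladDilation.scaledW,
    LindbladDilation.scaledW, emitW, emitW]
  module

lemma Confined.emit5_add (h₁ : Confined X₁ S₁ K₁ J₁) (h₂ : Confined X₂ S₂ K₂ J₂)
    (hX : Disjoint X₁ X₂) (hS : Disjoint S₁ S₂) (i : Fin n) :
    LindbladDilation.emit5 (K₁ + K₂) (J₁ + J₂) i
      = LindbladDilation.emit5 K₁ J₁ i + LindbladDilation.emit5 K₂ J₂ i := by
  have hz := h₁.eq_zero_or h₂ hS i
  rw [LindbladDilation.emit5, h₁.commutator_add h₂ hX, selfComm_add hz]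
  rcases hz with h | h <;> simp [LindbladDilation.emit5, selfComm, h]

lemma Confined.ham4_add (h₁ : Confined X₁ S₁ K₁ J₁) (h₂ : Confined X₂ S₂ K₂ J₂)
    (hX : Disjoint X₁ X₂) (hS : Disjoint S₁ S₂) :
    LindbladDilation.ham4 (K₁ + K₂) (J₁ + J₂)
      = LindbladDilation.ham4 K₁ J₁ + LindbladDilation.ham4 K₂ J₂ := by
  rw [LindbladDilation.ham4, h₁.heisenberg_add h₂ hX hS h₁.ham h₂.ham, smul_add]
  rfl

lemma Confined.ham6_add (h₁ : Confined X₁ S₁ K₁ J₁) (h₂ : Confined X₂ S₂ K₂ J₂)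
    (hX : Disjoint X₁ X₂) (hS : Disjoint S₁ S₂) :
    LindbladDilation.ham6 (K₁ + K₂) (J₁ + J₂)
      = LindbladDilation.ham6 K₁ J₁ + LindbladDilation.ham6 K₂ J₂ := by
  have e : ∀ i, ((K₁ + K₂) * ((J₁ + J₂) i)ᴴ - ((J₁ + J₂) i)ᴴ * (K₁ + K₂))
        * (selfComm (J₁ + J₂) i * (J₁ + J₂) i)
      + ((J₁ + J₂) i)ᴴ * selfComm (J₁ + J₂) i * ((J₁ + J₂) i * (K₁ + K₂) - (K₁ + K₂) * (J₁ + J₂) i)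
      = ((K₁ * (J₁ i)ᴴ - (J₁ i)ᴴ * K₁) * (selfComm J₁ i * J₁ i)
        + (J₁ i)ᴴ * selfComm J₁ i * (J₁ i * K₁ - K₁ * J₁ i))
      + ((K₂ * (J₂ i)ᴴ - (J₂ i)ᴴ * K₂) * (selfComm J₂ i * J₂ i)
        + (J₂ i)ᴴ * selfComm J₂ i * (J₂ i * K₂ - K₂ * J₂ i)) := by
    intro i
    have e1 := (h₁.ham.commute hX (h₂.jumps i)).eq
    have e2 := (h₂.ham.commute hX.symm (h₁.jumps i)).eq
    have e3 := (h₁.ham.commute hX (h₂.jumps i).conjTranspose).eq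
    have e4 := (h₂.ham.commute hX.symm (h₁.jumps i).conjTranspose).eq
    rw [selfComm_add (h₁.eq_zero_or h₂ hS i), Pi.add_apply]
    rcases h₁.eq_zero_or h₂ hS i with h | h
    · have hc : selfComm J₁ i = 0 := by simp [selfComm, h]
      simp only [h, hc, Matrix.conjTranspose_zero, zero_add, zero_mul, mul_zero, add_mul, mul_add,
        e1, e3, add_sub_add_left_eq_sub, sub_zero]
    · have hc : selfComm J₂ i = 0 := by simp [selfComm, h]
      simp only [h, hc, Matrix.conjTranspose_zero, add_zero, zero_mul, mul_zero, add_mul, mul_add,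
        e2, e4, add_sub_add_right_eq_sub, sub_zero]
  simp only [LindbladDilation.ham6, e, Finset.sum_add_distrib]
  rw [h₁.heisenberg_add h₂ hX hS h₁.ham h₂.ham,
    h₁.heisenberg_add h₂ hX hS (h₁.heisenberg h₁.ham) (h₂.heisenberg h₂.ham), ← smul_add]
  congr 1
  abel

lemma emit_sub_absorb_add (T T' : Fin n → SysOp n) : emit (T + T') - absorb (T + T')
    = (emit T - absorb T) + (emit T' - absorb T') := by
  simp only [emit, absorb, Pi.add_apply, Matrix.conjTranspose_add, Matrix.add_kronecker,
    Finset.sum_add_distrib]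
  abel

lemma emitFour_sub_absorbFour_add (T T' : Fin n → SysOp n) :
    emitFour (T + T') - absorbFour (T + T')
      = (emitFour T - absorbFour T) + (emitFour T' - absorbFour T') := by
  simp only [emitFour, absorbFour, Pi.add_apply, Matrix.conjTranspose_add, Matrix.add_kronecker,
    Finset.sum_add_distrib]
  abel

lemma Confined.genCoeff_add (h₁ : Confined X₁ S₁ K₁ J₁) (h₂ : Confined X₂ S₂ K₂ J₂)
    (hX : Disjoint X₁ X₂) (hS : Disjoint S₁ S₂) :
    ∀ m, genCoeff (K₁ + K₂) (J₁ + J₂) m = genCoeff K₁ J₁ m + genCoeff K₂ J₂ m := by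
  have e3 : LindbladDilation.emit3 (J₁ + J₂)
      = LindbladDilation.emit3 J₁ + LindbladDilation.emit3 J₂ :=
    funext fun i => emit3_add (h₁.eq_zero_or h₂ hS i)
  have eW : LindbladDilation.scaledW (K₁ + K₂) (J₁ + J₂)
      = LindbladDilation.scaledW K₁ J₁ + LindbladDilation.scaledW K₂ J₂ :=
    funext fun i => h₁.scaledW_add h₂ hX hS i
  have e5 : LindbladDilation.emit5 (K₁ + K₂) (J₁ + J₂)
      = LindbladDilation.emit5 K₁ J₁ + LindbladDilation.emit5 K₂ J₂ :=
    funext fun i => h₁.emit5_add h₂ hX hS i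
  intro m
  match m with
  | 0 => simp only [genCoeff, add_zero]
  | 1 => simp only [genCoeff, emit_sub_absorb_add]
  | 2 => simp only [genCoeff, sysOp, Matrix.add_kronecker]
  | 3 =>
    simp only [genCoeff, e3, eW, emit_sub_absorb_add, emitFour_sub_absorbFour_add]
    exact add_add_add_comm _ _ _ _
  | 4 => simp only [genCoeff, h₁.ham4_add h₂ hX hS, sysOp, Matrix.add_kronecker]
  | 5 => simp only [genCoeff, e5, emit_sub_absorb_add]
  | 6 => simp only [genCoeff, h₁.ham6_add h₂ hX hS, sysOp, Matrix.add_kronecker]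
  | m + 7 => simp only [genCoeff, add_zero]

lemma Confined.genSum_add (h₁ : Confined X₁ S₁ K₁ J₁) (h₂ : Confined X₂ S₂ K₂ J₂)
    (hX : Disjoint X₁ X₂) (hS : Disjoint S₁ S₂) (x : ℝ) :
    genSum (K₁ + K₂) (J₁ + J₂) x = genSum K₁ J₁ x + genSum K₂ J₂ x := by
  simp only [genSum, h₁.genCoeff_add h₂ hX hS, smul_add, Finset.sum_add_distrib]

end Independence

/-! ### Factorization over distant bonds -/

section Factorization

variable {n : ℕ}

/-- The Kraus operator `⟨a| u |Vac⟩` of the joint operator `u`. -/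
def krausOp (u : JointOp n) (a : Anc n) : SysOp n := Matrix.of fun s t => u (s, a) (t, 0)

lemma sandwich_eq_sum_krausOp (u w : JointOp n) (ρ : SysOp n) :
    sandwich u wᴴ ρ = ∑ a, krausOp u a * ρ * (krausOp w a)ᴴ := by
  ext s t
  simp only [sandwich_apply, traceAnc_apply, Matrix.sum_apply, Matrix.mul_apply,
    Fintype.sum_prod_type, Matrix.kronecker_apply, vac_apply, Matrix.conjTranspose_apply, krausOp,
    Matrix.of_apply]
  refine Finset.sum_congr rfl fun a _ => Finset.sum_congr rfl fun r _ => ?_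
  rw [Finset.sum_eq_single 0 _ (by simp)]
  · congr 1
    refine Finset.sum_congr rfl fun q _ => ?_
    rw [Finset.sum_eq_single 0 _ (by simp)]
    · simp
    · intro b _ hb
      simp [hb]
  · intro c _ hc
    simp [hc]

variable {X₁ X₂ : Set (Fin (n + 1))} {S₁ S₂ : Set (Fin n)} {u₁ u₂ : JointOp n}

lemma krausOp_eq_zero (h : ActsIn X₁ S₁ u₁) {a : Anc n} (ha : a ∉ zeroOff S₁) :
    krausOp u₁ a = 0 := by
  ext s t
  exact h.1 (s, a) (t, 0) fun h' => ha (by simpa using h'.2)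

/-- The excitations `a` split into `c`, created by `u₂`, and `a - c`, created by `u₁`; here the
subtraction is the one of `Fin 5`, and `u₁` does not depend on the levels of the ancillas off
`S₁`. -/
lemma krausOp_mul (h₁ : ActsIn X₁ S₁ u₁) (h₂ : ActsIn X₂ S₂ u₂) (hS : Disjoint S₁ S₂)
    (a : Anc n) : krausOp (u₁ * u₂) a = ∑ c, krausOp u₁ (a - c) * krausOp u₂ c := by
  ext s t
  simp only [krausOp, Matrix.of_apply, Matrix.mul_apply, Fintype.sum_prod_type, Matrix.sum_apply]
  rw [Finset.sum_comm]
  refine Finset.sum_congr rfl fun c _ => Finset.sum_congr rfl fun r _ => ?_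
  by_cases hc : c ∈ zeroOff S₂
  · have h := h₁.2 (s, a - c) (r, 0) (0, c) ⟨zero_mem _, zeroOff_le_zeroOn hS.symm hc⟩
    rw [Prod.mk_add_mk, Prod.mk_add_mk, add_zero, add_zero, sub_add_cancel, zero_add] at h
    rw [h]
  · have h : u₂ (r, c) (t, 0) = 0 := h₂.1 _ _ fun h' => hc (by simpa using h'.2)
    rw [h, mul_zero, mul_zero]

/-- The reduced evolution of two operators that act on different ancillas is a composition: the
outcomes of the two sets of ancillas are independent. -/
lemma sandwich_mul (h₁ : ActsIn X₁ S₁ u₁) (h₂ : ActsIn X₂ S₂ u₂) (hS : Disjoint S₁ S₂) :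
    sandwich (u₁ * u₂) (u₁ * u₂)ᴴ = sandwich u₁ u₁ᴴ * sandwich u₂ u₂ᴴ := by
  ext1 ρ
  rw [ContinuousLinearMap.mul_def, ContinuousLinearMap.comp_apply, sandwich_eq_sum_krausOp,
    sandwich_eq_sum_krausOp, sandwich_eq_sum_krausOp]
  have key : ∀ a, krausOp (u₁ * u₂) a * ρ * (krausOp (u₁ * u₂) a)ᴴ
      = ∑ c, krausOp u₁ (a - c) * (krausOp u₂ c * ρ * (krausOp u₂ c)ᴴ)
          * (krausOp u₁ (a - c))ᴴ := by
    intro a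
    rw [krausOp_mul h₁ h₂ hS, Matrix.conjTranspose_sum, Finset.sum_mul, Finset.sum_mul]
    refine Finset.sum_congr rfl fun c _ => ?_
    rw [Finset.mul_sum, Finset.sum_eq_single c _ (by simp)]
    · simp only [Matrix.conjTranspose_mul, mul_assoc]
    · -- two different decompositions of `a` cannot both contribute
      intro c' _ hc'
      by_cases e1 : a - c ∈ zeroOff S₁
      · by_cases e2 : c ∈ zeroOff S₂
        · by_cases e3 : a - c' ∈ zeroOff S₁
          · by_cases e4 : c' ∈ zeroOff S₂
            · refine absurd ?_ hc'
              ext1 k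
              by_cases hk : k ∈ S₂
              · have d1 : (a - c) k = 0 := e1 k (Set.disjoint_right.1 hS hk)
                have d2 : (a - c') k = 0 := e3 k (Set.disjoint_right.1 hS hk)
                rw [Pi.sub_apply, sub_eq_zero] at d1 d2
                rw [← d1, ← d2]
              · exact (e4 k hk).trans (e2 k hk).symm
            · rw [krausOp_eq_zero h₂ e4]
              simp
          · rw [krausOp_eq_zero h₁ e3]
            simp
        · rw [krausOp_eq_zero h₂ e2]
          simp
      · rw [krausOp_eq_zero h₁ e1]
        simp
  rw [Finset.sum_congr rfl fun a _ => key a, Finset.sum_comm]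
  have shift : ∀ c, ∑ a, krausOp u₁ (a - c) * (krausOp u₂ c * ρ * (krausOp u₂ c)ᴴ)
        * (krausOp u₁ (a - c))ᴴ
      = ∑ a, krausOp u₁ a * (krausOp u₂ c * ρ * (krausOp u₂ c)ᴴ) * (krausOp u₁ a)ᴴ := fun c =>
    Equiv.sum_comp (Equiv.subRight c)
      fun a => krausOp u₁ a * (krausOp u₂ c * ρ * (krausOp u₂ c)ᴴ) * (krausOp u₁ a)ᴴ
  rw [Finset.sum_congr rfl fun c _ => shift c, Finset.sum_comm]
  refine Finset.sum_congr rfl fun a _ => ?_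
  rw [Finset.mul_sum, Finset.sum_mul]

variable {K₁ K₂ : SysOp n} {J₁ J₂ : Fin n → SysOp n}

lemma ActsIn.commute {A B : JointOp n} (hA : ActsIn X₁ S₁ A) (hB : ActsIn X₂ S₂ B)
    (hX : Disjoint X₁ X₂) (hS : Disjoint S₁ S₂) : Commute A B :=
  ActsOn.commute (AddSubgroup.prod_mono (zeroOff_le_zeroOn hX) (zeroOff_le_zeroOn hS))
    (AddSubgroup.prod_mono (zeroOff_le_zeroOn hX.symm) (zeroOff_le_zeroOn hS.symm)) hA hB

lemma Confined.reducedMap_add (h₁ : Confined X₁ S₁ K₁ J₁) (h₂ : Confined X₂ S₂ K₂ J₂)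
    (hX : Disjoint X₁ X₂) (hS : Disjoint S₁ S₂) (x : ℝ) :
    reducedMap (K₁ + K₂) (J₁ + J₂) x = reducedMap K₁ J₁ x * reducedMap K₂ J₂ x := by
  have a₁ := h₁.actsIn_genSum x
  have a₂ := h₂.actsIn_genSum x
  rw [reducedMap, h₁.genSum_add h₂ hX hS,
    Matrix.exp_add_of_commute _ _ (a₁.commute a₂ hX hS)]
  exact sandwich_mul a₁.exp a₂.exp hS

lemma sandwich_sysOp_mul (A B A' B' : SysOp n) : sandwich (sysOp A) (sysOp B)
    * sandwich (sysOp A') (sysOp B') = sandwich (sysOp (A * A')) (sysOp (B' * B)) := by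
  ext1 ρ
  simp only [ContinuousLinearMap.mul_def, ContinuousLinearMap.comp_apply, sandwich_apply,
    traceAnc_mul_kronecker_one, traceAnc_kronecker_one_mul, traceAnc_kronecker, trace_vac, one_smul,
    mul_assoc]

lemma commute_sandwich_sysOp {A B A' B' : SysOp n} (hA : Commute A A') (hB : Commute B B') :
    Commute (sandwich (sysOp A) (sysOp B)) (sandwich (sysOp A') (sysOp B')) := by
  rw [Commute, SemiconjBy, sandwich_sysOp_mul, sandwich_sysOp_mul, hA.eq, hB.eq]

lemma Confined.noJump_add (h₁ : Confined X₁ S₁ K₁ J₁) (h₂ : Confined X₂ S₂ K₂ J₂)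
    (hS : Disjoint S₁ S₂) : LindbladDilation.noJump (K₁ + K₂) (J₁ + J₂)
      = LindbladDilation.noJump K₁ J₁ + LindbladDilation.noJump K₂ J₂ := by
  have e : ∀ i, ((J₁ + J₂) i)ᴴ * (J₁ + J₂) i = (J₁ i)ᴴ * J₁ i + (J₂ i)ᴴ * J₂ i := fun i => by
    rcases h₁.eq_zero_or h₂ hS i with h | h <;> simp [h]
  simp only [LindbladDilation.noJump, numOp, e, Finset.sum_add_distrib]
  module

lemma Confined.lindbladOp_add (h₁ : Confined X₁ S₁ K₁ J₁) (h₂ : Confined X₂ S₂ K₂ J₂)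
    (hS : Disjoint S₁ S₂) (A₁ A₂ : SysOp n) :
    lindbladOp (A₁ + A₂) (J₁ + J₂) = lindbladOp A₁ J₁ + lindbladOp A₂ J₂ := by
  ext1 ρ
  have e : ∀ i, (J₁ + J₂) i * (ρ * ((J₁ + J₂) i)ᴴ)
      = J₁ i * (ρ * (J₁ i)ᴴ) + J₂ i * (ρ * (J₂ i)ᴴ) := fun i => by
    rcases h₁.eq_zero_or h₂ hS i with h | h <;> simp [h]
  simp only [add_apply, lindbladOp_apply, lindbladMap, jump_apply, e, Finset.sum_add_distrib,
    Matrix.conjTranspose_add, add_mul, mul_add]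
  abel

lemma Confined.commute_lindbladOp (h₁ : Confined X₁ S₁ K₁ J₁) (h₂ : Confined X₂ S₂ K₂ J₂)
    (hX : Disjoint X₁ X₂) {A₁ A₂ : SysOp n} (hA₁ : SupportedOn X₁ A₁) (hA₂ : SupportedOn X₂ A₂) :
    Commute (lindbladOp A₁ J₁) (lindbladOp A₂ J₂) := by
  have one : (1 : JointOp n) = sysOp 1 := Matrix.one_kronecker_one.symm
  have key : ∀ {A B : SysOp n}, SupportedOn X₁ A → SupportedOn X₁ B →
      Commute (sandwich (sysOp A) (sysOp B)) (lindbladOp A₂ J₂) := by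
    intro A B hA hB
    rw [lindbladOp_eq_sandwich, one]
    refine ((commute_sandwich_sysOp (hA.commute hX hA₂) (Commute.one_right B)).add_right
      (commute_sandwich_sysOp (Commute.one_right A) (hB.commute hX hA₂.conjTranspose))).add_right
      (Commute.sum_right _ _ _ fun i _ => commute_sandwich_sysOp (hA.commute hX (h₂.jumps i))
        (hB.commute hX (h₂.jumps i).conjTranspose))
  have s1 : SupportedOn X₁ (1 : SysOp n) := supportedOn_iff.2 (actsOn_one _ _)
  rw [lindbladOp_eq_sandwich A₁, one]
  exact ((key hA₁ s1).add_left (key s1 hA₁.conjTranspose)).add_left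
    (Commute.sum_left _ _ _ fun i _ => key (h₁.jumps i) (h₁.jumps i).conjTranspose)

end Factorization

/-! ### The leading coefficient of the error -/

section Extensivity

open Asymptotics

variable {n : ℕ}

lemma eq_zero_of_smul_isBigO {E : Type*} [NormedAddCommGroup E] [NormedSpace ℂ E] {B : E} {m : ℕ}
    (h : (fun x : ℝ => ((x : ℂ) ^ m) • B) =O[𝓝[>] (0 : ℝ)] (fun x : ℝ => x ^ (m + 1))) : B = 0 := by
  obtain ⟨c, hc⟩ := h.bound
  have h1 : ∀ᶠ x in 𝓝[>] (0 : ℝ), ‖B‖ ≤ c * x := by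
    filter_upwards [hc, self_mem_nhdsWithin] with x hx hx0
    have hx0' : 0 < x := hx0
    rw [norm_smul, norm_pow, Complex.norm_real, Real.norm_of_nonneg hx0'.le, norm_pow,
      Real.norm_of_nonneg hx0'.le, pow_succ] at hx
    refine le_of_mul_le_mul_left ?_ (pow_pos hx0' m)
    linarith
  have h2 : Filter.Tendsto (fun x : ℝ => c * x) (𝓝[>] (0 : ℝ)) (𝓝 0) := by
    have : Filter.Tendsto (fun x : ℝ => c * x) (𝓝 (0 : ℝ)) (𝓝 (c * 0)) :=
      (continuous_const.mul continuous_id).tendsto 0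
    rw [mul_zero] at this
    exact this.mono_left nhdsWithin_le_nhds
  exact norm_le_zero_iff.1 (ge_of_tendsto h2 h1)

lemma exp_smul_add_of_commute {A : Type*} [NormedRing A] [NormedAlgebra ℂ A] [CompleteSpace A]
    {a b : A} (h : Commute a b) (z : ℂ) :
    NormedSpace.exp (z • a + z • b) = NormedSpace.exp (z • a) * NormedSpace.exp (z • b) :=
  let _ : NormedAlgebra ℚ A := NormedAlgebra.restrictScalars ℚ ℂ A
  NormedSpace.exp_add_of_commute ((h.smul_left z).smul_right z)

lemma isBigO_sub_one {A : Type*} [NormedRing A] [NormedAlgebra ℂ A] {f : ℝ → A} {a : ℕ → A}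
    (hf : HasJet f a) (h : a 0 = 1) :
    (fun x => f x - 1) =O[𝓝[>] (0 : ℝ)] (fun x : ℝ => x ^ 1) := by
  refine (hf.sub hasJet_one).isBigO_of_eq_zero (by norm_num) fun p hp => ?_
  rw [Nat.lt_one_iff.1 hp, h, if_pos rfl, sub_self]

variable {X₁ X₂ : Set (Fin (n + 1))} {S₁ S₂ : Set (Fin n)} {K₁ K₂ : SysOp n}
  {J₁ J₂ : Fin n → SysOp n}

/-- The leading coefficient of the error is additive over distant sets of bonds, because both the
Lindblad evolution and the dilated evolution factorize. -/
lemma Confined.errorCoeff_add (h₁ : Confined X₁ S₁ K₁ J₁) (h₂ : Confined X₂ S₂ K₂ J₂)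
    (hX : Disjoint X₁ X₂) (hS : Disjoint S₁ S₂) (hJ₁ : JumpsCommute J₁) (hJ₂ : JumpsCommute J₂)
    (hJ : JumpsCommute (J₁ + J₂)) (hK₁ : K₁ᴴ = -K₁) (hK₂ : K₂ᴴ = -K₂) :
    errorCoeff (K₁ + K₂) (J₁ + J₂) = errorCoeff K₁ J₁ + errorCoeff K₂ J₂ := by
  have hK : (K₁ + K₂)ᴴ = -(K₁ + K₂) := by
    rw [Matrix.conjTranspose_add, hK₁, hK₂, neg_add]
  set L₁ := lindbladOp (LindbladDilation.noJump K₁ J₁) J₁ with hL₁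
  set L₂ := lindbladOp (LindbladDilation.noJump K₂ J₂) J₂ with hL₂
  set e₂ : ℝ → SuperOp (Sys n) := fun x => NormedSpace.exp (((x : ℂ) ^ 2) • L₂) with he₂
  -- `E₁ E₂ - R₁ R₂ = (E₁ - R₁) E₂ + R₁ (E₂ - R₂)` for the exact evolutions `E` and the reduced ones
  -- `R`; as `E₂` and `R₁` are `1 + O(x)`, the order `x ^ 8` is additive.
  have hfact : ∀ x : ℝ, errorMap (K₁ + K₂) (J₁ + J₂) x
      = errorMap K₁ J₁ x * e₂ x + reducedMap K₁ J₁ x * errorMap K₂ J₂ x := by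
    intro x
    have hexp : NormedSpace.exp (((x : ℂ) ^ 2) • L₁ + ((x : ℂ) ^ 2) • L₂)
        = NormedSpace.exp (((x : ℂ) ^ 2) • L₁) * NormedSpace.exp (((x : ℂ) ^ 2) • L₂) := by
      exact exp_smul_add_of_commute (A := SuperOp (Sys n))
        (h₁.commute_lindbladOp h₂ hX h₁.noJump h₂.noJump) _
    rw [errorMap, h₁.noJump_add h₂ hS, h₁.lindbladOp_add h₂ hS, smul_add, ← hL₁, ← hL₂, hexp,
      h₁.reducedMap_add h₂ hX hS, errorMap, errorMap, ← hL₁, ← hL₂, he₂]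
    simp only [sub_mul, mul_sub]
    abel
  have je : HasJet e₂ (expCoeff (Pi.single 2 L₂)) :=
    HasJet.exp (A := SuperOp (Sys n)) (hasJet_single_two _)
      (Pi.single_eq_of_ne (by norm_num) _)
  have he : (fun x => e₂ x - 1) =O[𝓝[>] (0 : ℝ)] (fun x : ℝ => x ^ 1) :=
    isBigO_sub_one (A := SuperOp (Sys n)) je
      (by simpa using expCoeff_single_two L₂ 0)
  have hr : (fun x => reducedMap K₁ J₁ x - 1) =O[𝓝[>] (0 : ℝ)] (fun x : ℝ => x ^ 1) :=
    isBigO_sub_one (A := SuperOp (Sys n)) hasJet_reducedMap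
      (by simpa using hJ₁.reducedCoeff_eq hK₁ (Nat.zero_le 3))
  have m1 : (fun x => errorMap K₁ J₁ x * (e₂ x - 1)) =O[𝓝[>] (0 : ℝ)] (fun x : ℝ => x ^ 9) := by
    simpa only [← pow_add] using (hJ₁.errorMap_isBigO hK₁).mul he
  have m2 : (fun x => (reducedMap K₁ J₁ x - 1) * errorMap K₂ J₂ x)
      =O[𝓝[>] (0 : ℝ)] (fun x : ℝ => x ^ 9) := by
    simpa only [← pow_add] using hr.mul (hJ₂.errorMap_isBigO hK₂)
  have h9 := isBigO_pow_of_le (show 9 ≤ 10 by norm_num)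
  have r := (hJ.errorMap_sub_isBigO hK).trans h9
  have r1 := (hJ₁.errorMap_sub_isBigO hK₁).trans h9
  have r2 := (hJ₂.errorMap_sub_isBigO hK₂).trans h9
  rw [← sub_eq_zero, ← neg_eq_zero]
  refine eq_zero_of_smul_isBigO (E := SuperOp (Sys n)) (m := 8)
    ((r.sub (((r1.add r2).add m1).add m2)).congr_left fun x => ?_)
  rw [hfact]
  simp only [smul_neg, smul_sub, smul_add, mul_sub, sub_mul, mul_one, one_mul]
  abel

variable {H J : Fin n → SysOp n} {b : ℝ}

lemma restrict_union {M : Type*} [AddMonoid M] {S S' : Finset (Fin n)} (h : Disjoint S S')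
    (T : Fin n → M) : restrict (S ∪ S') T = restrict S T + restrict S' T := by
  ext1 i
  have := fun hi : i ∈ S => Finset.disjoint_left.1 h hi
  by_cases h1 : i ∈ S <;> by_cases h2 : i ∈ S' <;> simp_all [restrict]

lemma restrict_univ {M : Type*} [Zero M] (T : Fin n → M) : restrict Finset.univ T = T := by
  ext1 i
  simp [restrict]

lemma JumpsCommute.restrict (hJ : JumpsCommute J) (S : Finset (Fin n)) :
    JumpsCommute (restrict S J) := by
  intro i j hij
  by_cases hi : i ∈ S <;> by_cases hj : j ∈ S <;>
    simp [LindbladDilation.restrict, hi, hj, hJ i j hij]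

lemma hamGen_add (H H' : Fin n → SysOp n) : hamGen (H + H') = hamGen H + hamGen H' := by
  simp only [hamGen, Pi.add_apply, Finset.sum_add_distrib, smul_add]

lemma restrict_isHermitian (hH : ∀ i, (H i).IsHermitian) (S : Finset (Fin n)) (i : Fin n) :
    (restrict S H i).IsHermitian := by
  rw [restrict]
  split_ifs
  · exact hH i
  · exact Matrix.isHermitian_zero

/-- The sites of the bonds in `S`. -/
def sites (S : Finset (Fin n)) : Set (Fin (n + 1)) := {k | ∃ i ∈ S, k ∈ bondNhd 0 i}

lemma Separated.disjoint_sites {S S' : Finset (Fin n)} (h : Separated S S') :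
    Disjoint (sites S) (sites S') := by
  refine Set.disjoint_left.2 ?_
  rintro k ⟨i, hi, h1, h2⟩ ⟨j, hj, h3, h4⟩
  have := h i hi j hj
  omega

lemma LocalTerms.supportedOn_restrict (hJ : LocalTerms b J) (S : Finset (Fin n)) (i : Fin n) :
    SupportedOn (sites S) (restrict S J i) := by
  rw [restrict]
  split_ifs with hi
  · exact (hJ i).1.mono fun k hk => ⟨i, hi, hk⟩
  · exact SupportedOn.zero _

lemma LocalTerms.confined (hJ : LocalTerms b J) (hH : LocalTerms b H) (S : Finset (Fin n)) :
    Confined (sites S) S (hamGen (restrict S H)) (restrict S J) where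
  ham := (SupportedOn.sum fun i _ => hH.supportedOn_restrict S i).smul _
  jumps := hJ.supportedOn_restrict S
  eq_zero _ hi := if_neg hi

lemma LocalTerms.errorCoeff_union (hJ : LocalTerms b J) (hH : LocalTerms b H)
    (hc : JumpsCommute J) (hh : ∀ i, (H i).IsHermitian) {S S' : Finset (Fin n)}
    (h : Separated S S') :
    errorCoeff (hamGen (restrict (S ∪ S') H)) (restrict (S ∪ S') J)
      = errorCoeff (hamGen (restrict S H)) (restrict S J)
        + errorCoeff (hamGen (restrict S' H)) (restrict S' J) := by
  have hc' := hc.restrict (S ∪ S')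
  rw [restrict_union h.disjoint] at hc'
  rw [restrict_union h.disjoint, restrict_union h.disjoint, hamGen_add]
  exact (hJ.confined hH S).errorCoeff_add (hJ.confined hH S') h.disjoint_sites
    (Finset.disjoint_coe.2 h.disjoint) (hc.restrict S) (hc.restrict S') hc'
    (hamGen_conjTranspose (restrict_isHermitian hh S))
    (hamGen_conjTranspose (restrict_isHermitian hh S'))

/-- The leading coefficient of the error is of order `n`, since it has bounded degree in the set of
bonds and is additive over distant sets of bonds. -/
theorem exists_diamondLE_errorCoeff_mul (hb : 0 ≤ b) :
    ∃ B : ℝ, 0 ≤ B ∧ ∀ {n : ℕ} {H J : Fin n → SysOp n}, LocalTerms b H → LocalTerms b J →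
      JumpsCommute J → (∀ i, (H i).IsHermitian) →
      DiamondLE (errorCoeff (hamGen H) J) (B * n) := by
  -- `40` is the degree of `errorCoeff`.
  obtain ⟨B, hB, h⟩ := exists_diamondLE_errorCoeff 40 hb (show 0 ≤ (40 : ℕ) * b by positivity)
  refine ⟨41 * clusterBound B 40, mul_nonneg (by norm_num) (clusterBound_nonneg hB 40),
    fun {n H J} hH hJ hc hh => ?_⟩
  have hdegJ : ∀ (T : Fin n → SysOp n) i, HasDegree 1 (fun S => restrict S T i) :=
    fun T i => HasDegree.indicator i (T i)
  have hdegK : HasDegree 1 (fun S => hamGen (restrict S H)) :=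
    (HasDegree.sum fun i _ => hdegJ H i).matrix_smul _
  have hnorm : ∀ {T : Fin n → SysOp n}, LocalTerms b T → ∀ S i, ‖restrict S T i‖ ≤ b :=
    fun hT S i => by
      rw [restrict]
      split_ifs
      · exact (hT i).2
      · rwa [norm_zero]
  have key := diamondLE_of_additive hB (hasDegree_errorCoeff (hdegJ J) hdegK)
    (fun S S' hS => hJ.errorCoeff_union hH hc hh hS) fun S hS =>
      h hS (fun _ hi => if_neg hi) (hnorm hJ S) (by
        rw [hamGen, norm_smul, norm_neg, Complex.norm_I, one_mul]
        exact norm_sum_le_of_card_le hS hb (fun _ hi => if_neg hi) (hnorm hH S))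
  simp only [restrict_univ] at key
  refine key.mono (le_of_eq ?_)
  push_cast
  ring

end Extensivity

/-! ### The time step as a square -/

section TimeStep

open Asymptotics

variable {n : ℕ} {H J : Fin n → SysOp n}

lemma tendsto_sqrt_nhdsGT : Filter.Tendsto Real.sqrt (𝓝[>] (0 : ℝ)) (𝓝[>] (0 : ℝ)) := by
  refine tendsto_nhdsWithin_iff.2 ⟨?_, ?_⟩
  · have h := Real.continuous_sqrt.tendsto 0
    rw [Real.sqrt_zero] at h
    exact h.mono_left nhdsWithin_le_nhds
  · filter_upwards [self_mem_nhdsWithin] with τ hτ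
    exact Real.sqrt_pos.2 hτ

lemma dilationError_eq (hH : ∀ i, (H i).IsHermitian) {τ : ℝ} (hτ : 0 < τ) :
    dilationError H J (dilation H J) τ = errorMap (hamGen H) J (Real.sqrt τ) := by
  rw [← dilationError_sq hH (Real.sqrt_pos.2 hτ), Real.sq_sqrt hτ.le]

lemma dilationError_isBigO (hH : ∀ i, (H i).IsHermitian) (hJ : JumpsCommute J) :
    (fun τ : ℝ => dilationError H J (dilation H J) τ)
      =O[𝓝[>] (0 : ℝ)] (fun τ : ℝ => τ ^ 4) := by
  refine ((hJ.errorMap_isBigO (hamGen_conjTranspose hH)).comp_tendsto tendsto_sqrt_nhdsGT).congr'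
    ?_ ?_ <;> filter_upwards [self_mem_nhdsWithin] with τ hτ
  · exact (dilationError_eq hH hτ).symm
  · rw [Function.comp_apply, show 8 = 2 * 4 by norm_num, pow_mul, Real.sq_sqrt (le_of_lt hτ)]

lemma dilationError_sub_isBigO (hH : ∀ i, (H i).IsHermitian) (hJ : JumpsCommute J) :
    (fun τ : ℝ => dilationError H J (dilation H J) τ - ((τ : ℂ) ^ 4) • errorCoeff (hamGen H) J)
      =O[𝓝[>] (0 : ℝ)] (fun τ : ℝ => τ ^ 5) := by
  refine ((hJ.errorMap_sub_isBigO (hamGen_conjTranspose hH)).comp_tendsto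
    tendsto_sqrt_nhdsGT).congr' ?_ ?_ <;> filter_upwards [self_mem_nhdsWithin] with τ hτ
  · have h : ((Real.sqrt τ : ℂ)) ^ 8 = (τ : ℂ) ^ 4 := by
      rw [show 8 = 2 * 4 by norm_num, pow_mul, ← Complex.ofReal_pow, Real.sq_sqrt (le_of_lt hτ)]
    rw [Function.comp_apply, ← dilationError_eq hH hτ, h]
  · rw [Function.comp_apply, show 10 = 2 * 5 by norm_num, pow_mul, Real.sq_sqrt (le_of_lt hτ)]

end TimeStep

end LindbladDilation

end

theorem theorem6 :
    ∃ K R : ℕ, ∀ Λ : ℝ, ∃ C : ℝ, ∀ (n : ℕ) (H J : Fin n → LindbladDilation.SysOp n),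
      (∀ i, (H i).IsHermitian ∧
        LindbladDilation.SupportedOn (LindbladDilation.bondNhd 0 i) (H i) ∧ ‖H i‖ ≤ Λ) →
      (∀ i, LindbladDilation.SupportedOn (LindbladDilation.bondNhd 0 i) (J i) ∧ ‖J i‖ ≤ Λ) →
      (∀ i j, i ≠ j → Commute (J i) (J j) ∧ Commute (J i) (J j)ᴴ) →
      ∃ D : LindbladDilation.DilationData n K,
        (∀ η : ℝ, 0 < η → η ≤ 1 → ∀ i,
          (D.h i η).IsHermitian ∧
          LindbladDilation.SupportedOn (LindbladDilation.bondNhd R i) (D.h i η) ∧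
          ‖D.h i η - H i‖ ≤ C * η ^ 2) ∧
        (∀ i k, LindbladDilation.SupportedOn (LindbladDilation.bondNhd R i) (D.S i k) ∧
          ‖D.S i k‖ ≤ C) ∧
        (∀ η : ℝ, 0 < η → η ≤ 1 → ∀ i k, ‖D.O i k η‖ ≤ C * η⁻¹) ∧
        (fun τ : ℝ => LindbladDilation.dilationError H J D τ)
          =O[𝓝[>] (0 : ℝ)] (fun τ : ℝ => τ ^ 4) ∧
        ∃ G : LindbladDilation.SuperOp (LindbladDilation.Sys n),
          (fun τ : ℝ => LindbladDilation.dilationError H J D τ - ((τ : ℂ) ^ 4) • G)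
            =O[𝓝[>] (0 : ℝ)] (fun τ : ℝ => τ ^ 5) ∧
          LindbladDilation.diamondNorm G ≤ ENNReal.ofReal (C * ((n : ℝ) + 1)) := by
  refine ⟨4, 2, fun Λ => ?_⟩
  -- For a bound `b ≥ 1` the lower powers are estimated by `b ^ 5`.
  have hb : (1 : ℝ) ≤ max Λ 1 := le_max_right _ _
  set b : ℝ := max Λ 1
  have hb0 : 0 ≤ b := zero_le_one.trans hb
  obtain ⟨B, hB, hG⟩ := LindbladDilation.exists_diamondLE_errorCoeff_mul hb0
  set l : ℝ := ‖LindbladDilation.lowering‖ + ‖LindbladDilation.toFourᴴ‖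
  have hl : 0 ≤ l := add_nonneg (norm_nonneg _) (norm_nonneg _)
  have p3 : 0 ≤ b ^ 3 := pow_nonneg hb0 3
  have p5 : 0 ≤ b ^ 5 := pow_nonneg hb0 5
  refine ⟨b ^ 3 + b ^ 5 + 7 * b ^ 5 + l + B, fun n H J hH hJ hc => ?_⟩
  have hH' : LindbladDilation.LocalTerms b H := fun i =>
    ⟨(hH i).2.1, (hH i).2.2.trans (le_max_left _ _)⟩
  have hJ' : LindbladDilation.LocalTerms b J := fun i =>
    ⟨(hJ i).1, (hJ i).2.trans (le_max_left _ _)⟩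
  have hh : ∀ i, (H i).IsHermitian := fun i => (hH i).1
  refine ⟨LindbladDilation.dilation H J, fun η h0 h1 i =>
    ⟨LindbladDilation.dilation_h_isHermitian hh i η, hJ'.dilation_h hH' i η,
      (hJ'.norm_dilation_h_sub_le hH' i h0 h1).trans ?_⟩,
    fun i k => ⟨(hJ'.dilation_S hH' hb i k).1, (hJ'.dilation_S hH' hb i k).2.trans ?_⟩,
    fun η h0 h1 i k => (LindbladDilation.norm_dilation_O_le i k h0 h1).trans ?_,
    LindbladDilation.dilationError_isBigO hh hc,
    LindbladDilation.errorCoeff (LindbladDilation.hamGen H) J,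
    LindbladDilation.dilationError_sub_isBigO hh hc,
    ((hG hH' hJ' hc hh).mono ?_).diamondNorm_le⟩
  · exact mul_le_mul_of_nonneg_right (by linarith) (sq_nonneg η)
  · linarith
  · exact mul_le_mul_of_nonneg_right (by linarith) (inv_nonneg.2 h0.le)
  · exact mul_le_mul (by linarith) (by linarith) (Nat.cast_nonneg n) (by linarith)
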